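/- **Setting.** Let $\mathcal S$ be a compact smooth manifold (without boundary) of dimension $n-1\ge 1$, let $R\in\mathbb R$, and let $\mathbf G$ be a smooth Riemannian metric on $\mathcal M=(R,\infty)\times\mathcal S$. Let $w:(R,\infty)\to(0,\infty)$ be smooth. In local coordinates $\theta=(\theta_1,\dots,\theta_{n-1})$ on $\mathcal S$ write $$\mathbf G=\mathbf a\,dx^2+2\,\mathbf b_i\,dx\,d\theta_i/w(x)+\mathbf g_{ij}\,d\theta_i\,d\theta_j/w(x)^2 .$$ Let $\langle x\rangle=(1+x^2)^{1/2}$. For $V\subset\mathbb R^{n-1}$ open, a smooth $f$ on $(M,\infty)\times V$ is in $S^m$ if $\partial_x^j\partial_\theta^\alpha f=O(\langle x\rangle^{m-j})$ on $(M,\infty)\times K$ for all compact $K\subset V$ and all $j,\alpha$; a function on $(M,\infty)$ is in $S^m$ if $\partial_x^jf=O(\langle x\rangle^{m-j})$ on $(M,\infty)$ for all $j$; a function on $(M,\infty)\times\mathcal S$ is in $S^m$ if it is so in all charts of $\mathcal S$. Assume that, for some smooth Riemannian metric $\overline{\mathbf g}$ on $\mathcal S$, $$w\in S^{-\lambda},\quad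 (w'/w)'\in S^{-1-\varepsilon},\quad \mathbf a-1\in S^{-\mu},\quad \mathbf b\in S^{-\nu},\quad \mathbf g-\overline{\mathbf g}\in S^{-\tau},$$ on $(R,\infty)$, respectively on $(R,\infty)\times V$ for all charts (with image $V$) of some atlas of $\mathcal S$, with $\varepsilon>0$, $\tau>0$, $\mu\ge 1+\tau$, $\nu\ge\frac{1+\tau}2$, $\lambda\ge\frac{1+\tau}2$. For $r>R$ let $\nu_r$ be the unit normal field to $\{r\}\times\mathcal S$ with $dx(\nu_r)>0$, and let $N_r(t,\omega)=\exp_{(r,\omega)}(t\nu_r)=:(x_r(t,\omega),\omega_r(t,\omega))$ for $t\ge0$, $\omega\in\mathcal S$. Let $d$ be the geodesic distance on $\mathcal S$ of an arbitrary fixed Riemannian metric ($d=\infty$ between different components). Fix a norm on $\mathbb R^{n-1}$ and a finite cover $\mathcal S=\bigcup_i\theta_{(i)}^{-1}(B(\theta_{0,i},\epsilon_i))$, where $\theta_{(i)}:U_i\to V_i\subset\mathbb R^{n-1}$ are charts, $\epsilon_i>0$ and $\overline B(\theta_{0,i},4\epsilon_i)\subset V_i$. **Proposition (Global properties of the normal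 flow).** There are constants $C$ and $r_0$ such that for all $r>R$ with $r\ge r_0$ the map $N_r$ is defined on all of $[0,\infty)\times\mathcal S$ and the following hold. 1. For each $t\ge0$, $\omega_r(t,\cdot)$ is a diffeomorphism from $\mathcal S$ onto $\mathcal S$, and $d(\omega,\omega_r(t,\omega))\le C\langle r\rangle^{-\tau}$ for all $\omega\in\mathcal S$ ($C$ does not depend on $r,t,\omega$). 2. The limit $\Omega_r:=\lim_{t\to\infty}\omega_r(t,\cdot)$ exists and is a diffeomorphism from $\mathcal S$ onto $\mathcal S$. 3. For each $i$, $\Omega_r^{-1}\circ\omega_r(t,\cdot)$ maps $\theta_{(i)}^{-1}(B(\theta_{0,i},\epsilon_i))$ into $U_i$ for all $t\ge 0$, and $\theta_{(i)}\big(\Omega_r^{-1}\circ\omega_r(t,\theta_{(i)}^{-1}(\theta))\big)-\theta$ belongs to $S^{-\tau}$ on $(0,\infty)_t\times B(\theta_{0,i},\epsilon_i)$. 4. There is $\phi_r\in C^\infty(\mathcal S,\mathbb R)$ such that $x_r(t,\omega)-t-\phi_r(\omega)$ belongs to $S^{-\tau}$ on $(0,\infty)_t\times\mathcal S$. 5.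 $N_r$ is a homeomorphism from $[0,\infty)\times\mathcal S$ onto $[r,\infty)\times\mathcal S$, and its restriction is a diffeomorphism from $(0,\infty)\times\mathcal S$ onto $(r,\infty)\times\mathcal S$. -/

import Mathlib

open scoped Manifold ContDiff Topology Bundle
open Set Filter

noncomputable section

namespace NormalFlow

/-- The Japanese bracket `⟨x⟩ = (1 + x²)^{1/2}`. -/
def bracket (x : ℝ) : ℝ := Real.sqrt (1 + x ^ 2)

/-- The symbol class `S^m` on `(M, ∞)`: smooth functions all of whose derivatives satisfy
`∂_x^j f = O(⟨x⟩^{m-j})` on `(M, ∞)`. -/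
def IsSymbolLine (m M : ℝ) (f : ℝ → ℝ) : Prop :=
  ContDiffOn ℝ ∞ f (Ioi M) ∧
    ∀ j : ℕ, ∃ C : ℝ, ∀ x ∈ Ioi M, |iteratedDeriv j f x| ≤ C * bracket x ^ (m - j)

/-- The symbol class `S^m` on `(M, ∞) × V`, `V` open in a finite dimensional space: smooth functions
with `∂_x^j ∂_θ^α f = O(⟨x⟩^{m-j})` on `(M, ∞) × K` for all compact `K ⊆ V` and all `j`, `α`.
The derivatives `∂_θ^α` with `|α| = k` are the components of the `k`-th Fréchet derivative in `θ`.
Only the values of `f` on `(M, ∞) × V` matter. -/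
def IsSymbol {E W : Type*} [NormedAddCommGroup E] [NormedSpace ℝ E]
    [NormedAddCommGroup W] [NormedSpace ℝ W] (m M : ℝ) (V : Set E) (f : ℝ → E → W) : Prop :=
  ContDiffOn ℝ ∞ (fun p : ℝ × E => f p.1 p.2) (Ioi M ×ˢ V) ∧
    ∀ K : Set E, K ⊆ V → IsCompact K → ∀ j k : ℕ, ∃ C : ℝ, ∀ x ∈ Ioi M, ∀ θ ∈ K,
      ‖iteratedDeriv j (fun s : ℝ => iteratedFDeriv ℝ k (f s) θ) x‖ ≤ C * bracket x ^ (m - j)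

/-- The symbol class `S^m` for functions on `(M, ∞) × S`, `S` a manifold: the expressions in all
coordinate charts are symbols. -/
def IsSymbolOnManifold {E S : Type*} [NormedAddCommGroup E] [NormedSpace ℝ E]
    [TopologicalSpace S] [ChartedSpace E S] (m M : ℝ) (f : ℝ → S → ℝ) : Prop :=
  ∀ e ∈ IsManifold.maximalAtlas 𝓘(ℝ, E) ∞ S,
    IsSymbol m M e.target (fun x (θ : E) => f x (e.symm θ))

/-! ### Riemannian metrics, geodesics and the exponential map -/

section Geodesics

variable {F H X : Type*} [NormedAddCommGroup F] [NormedSpace ℝ F] [TopologicalSpace H]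
  {I : ModelWithCorners ℝ F H} [TopologicalSpace X] [ChartedSpace H X] [IsManifold I ∞ X]

/-- A smooth Riemannian metric on the manifold `X`. -/
abbrev SmoothMetric (I : ModelWithCorners ℝ F H) (X : Type*) [TopologicalSpace X]
    [ChartedSpace H X] [IsManifold I ∞ X] :=
  Bundle.ContMDiffRiemannianMetric I ∞ F (fun p : X => TangentSpace I p)

/-- The metric read in the preferred chart at `q`: the value at the point of `X` with coordinates
`z`, on the tangent vectors with coordinates `u` and `v`. -/
def metricInChart (G : SmoothMetric I X) (q : X) (z u v : F) : ℝ :=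
  G.inner ((extChartAt I q).symm z)
    (mfderiv 𝓘(ℝ, F) I (extChartAt I q).symm z u)
    (mfderiv 𝓘(ℝ, F) I (extChartAt I q).symm z v)

/-- The Christoffel symbols of the first kind of the Levi-Civita connection, in the preferred chart
at `q`: `Γ(u, v; y) = (D_u G(v, y) + D_v G(u, y) - D_y G(u, v)) / 2`. -/
def christoffel (G : SmoothMetric I X) (q : X) (z u v y : F) : ℝ :=
  (fderiv ℝ (fun z' => metricInChart G q z' v y) z u
    + fderiv ℝ (fun z' => metricInChart G q z' u y) z v
    - fderiv ℝ (fun z' => metricInChart G q z' u v) z y) / 2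

/-- The curve `γ` in the boundaryless manifold `X` is of class `C²` near time `t` and satisfies the
geodesic equation `∇_{γ'} γ' = 0` at time `t`. The equation is written in the preferred chart at
`γ t`, and paired with an arbitrary vector `y`: `G(c'', y) + Γ(c', c'; y) = 0`. -/
def IsGeodesicAt (G : SmoothMetric I X) (γ : ℝ → X) (t : ℝ) : Prop :=
  ContMDiffAt 𝓘(ℝ, ℝ) I 2 γ t ∧
    let c : ℝ → F := fun s => extChartAt I (γ t) (γ s)
    ∀ y : F, metricInChart G (γ t) (c t) (deriv (deriv c) t) y
      + christoffel G (γ t) (c t) (deriv c t) (deriv c t) y = 0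

/-- `γ` is, on the time interval `[0, 1]`, the geodesic with initial position and velocity `q`. -/
def IsUnitTimeGeodesic (G : SmoothMetric I X) (q : TangentBundle I X) (γ : ℝ → X) : Prop :=
  (⟨γ 0, mfderiv 𝓘(ℝ, ℝ) I γ 0 (1 : ℝ)⟩ : TangentBundle I X) = q ∧
    ∀ t ∈ Icc (0 : ℝ) 1, IsGeodesicAt G γ t

/-- The tangent vector `q` is in the domain of the exponential map. -/
def InExpDomain (G : SmoothMetric I X) (q : TangentBundle I X) : Prop :=
  ∃ γ : ℝ → X, IsUnitTimeGeodesic G q γ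

open scoped Classical in
/-- The Riemannian exponential map: the position at time `1` of the geodesic with initial position
and velocity `q` (and, arbitrarily, the base point of `q` if there is no such geodesic). -/
def expMap (G : SmoothMetric I X) (q : TangentBundle I X) : X :=
  if h : InExpDomain G q then h.choose 1 else q.proj

/-- The geodesic distance of the Riemannian metric `h` (infinite between different connected
components). -/
def geodesicEDist (h : SmoothMetric I X) (p q : X) : ENNReal :=
  letI : Bundle.RiemannianBundle (fun p : X => TangentSpace I p) := ⟨h.toRiemannianMetric⟩
  Manifold.riemannianEDist I p q

end Geodesics

/-! ### The end `(R, ∞) × S` -/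

/-- The half-line `(R, ∞)`, as an open submanifold of `ℝ`. -/
abbrev HalfLine (R : ℝ) : TopologicalSpace.Opens ℝ := ⟨Ioi R, isOpen_Ioi⟩

section End

variable {E S : Type*} [NormedAddCommGroup E] [NormedSpace ℝ E]
  [TopologicalSpace S] [ChartedSpace E S] [IsManifold 𝓘(ℝ, E) ∞ S] {R : ℝ}

/-- A smooth Riemannian metric on the end `(R, ∞) × S`. -/
abbrev EndMetric (R : ℝ) (E S : Type*) [NormedAddCommGroup E] [NormedSpace ℝ E]
    [TopologicalSpace S] [ChartedSpace E S] [IsManifold 𝓘(ℝ, E) ∞ S] :=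
  SmoothMetric (𝓘(ℝ, ℝ).prod 𝓘(ℝ, E)) (HalfLine R × S)

/-- The tangent vector `ρ ∂_x + v` of the end, with `v` tangent to `S`. -/
def tangentPair (p : HalfLine R × S) (ρ : ℝ) (v : TangentSpace 𝓘(ℝ, E) p.2) :
    TangentSpace (𝓘(ℝ, ℝ).prod 𝓘(ℝ, E)) p :=
  ((ρ, v) : ℝ × E)

/-- The component `dx(ξ)` of a tangent vector `ξ` of the end. -/
def dxComponent (p : HalfLine R × S) (ξ : TangentSpace (𝓘(ℝ, ℝ).prod 𝓘(ℝ, E)) p) : ℝ :=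
  (show ℝ × E from ξ).1

/-- The tangent vector of `S`, at the point with coordinates `θ` in the chart `e`, whose coordinates
are `u` (for the `i`-th basis vector `u`, this is `∂/∂θ_i`). -/
def coordVec (e : OpenPartialHomeomorph S E) (θ u : E) : TangentSpace 𝓘(ℝ, E) (e.symm θ) :=
  mfderiv 𝓘(ℝ, E) 𝓘(ℝ, E) e.symm θ u

/-- The coefficient `a` of `G = a dx² + 2 b_i dx dθ_i / w + g_{ij} dθ_i dθ_j / w²` in the chart `e`
of `S` (set to `0` outside `(R, ∞)`). -/
def coefA (G : EndMetric R E S) (e : OpenPartialHomeomorph S E) (x : ℝ) (θ : E) : ℝ :=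
  if h : R < x then
    G.inner (⟨x, h⟩, e.symm θ) (tangentPair (⟨x, h⟩, e.symm θ) 1 0)
      (tangentPair (⟨x, h⟩, e.symm θ) 1 0)
  else 0

/-- The component `b(u)` of the coefficient `b` in the chart `e` (`b(u) = b_i` for the `i`-th basis
vector `u`). -/
def coefB (G : EndMetric R E S) (w : ℝ → ℝ) (e : OpenPartialHomeomorph S E) (u : E)
    (x : ℝ) (θ : E) : ℝ :=
  if h : R < x then
    w x * G.inner (⟨x, h⟩, e.symm θ) (tangentPair (⟨x, h⟩, e.symm θ) 1 0)
      (tangentPair (⟨x, h⟩, e.symm θ) 0 (coordVec e θ u))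
  else 0

/-- The component `g(u, v)` of the coefficient `g` in the chart `e` (`g(u, v) = g_{ij}` for the
`i`-th and `j`-th basis vectors `u`, `v`). -/
def coefG (G : EndMetric R E S) (w : ℝ → ℝ) (e : OpenPartialHomeomorph S E) (u v : E)
    (x : ℝ) (θ : E) : ℝ :=
  if h : R < x then
    w x ^ 2 * G.inner (⟨x, h⟩, e.symm θ) (tangentPair (⟨x, h⟩, e.symm θ) 0 (coordVec e θ u))
      (tangentPair (⟨x, h⟩, e.symm θ) 0 (coordVec e θ v))
  else 0

/-- The component `g̅(u, v)` in the chart `e` of a metric `g̅` on `S`. -/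
def coefBar (gbar : SmoothMetric 𝓘(ℝ, E) S) (e : OpenPartialHomeomorph S E) (u v : E)
    (θ : E) : ℝ :=
  gbar.inner (e.symm θ) (coordVec e θ u) (coordVec e θ v)

/-- `ξ` is the outgoing unit normal vector at `p = (r, σ)` to the hypersurface `{r} × S`. -/
def IsOutgoingNormal (G : EndMetric R E S) (p : HalfLine R × S)
    (ξ : TangentSpace (𝓘(ℝ, ℝ).prod 𝓘(ℝ, E)) p) : Prop :=
  (∀ v : TangentSpace 𝓘(ℝ, E) p.2, G.inner p ξ (tangentPair p 0 v) = 0) ∧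
    G.inner p ξ ξ = 1 ∧ 0 < dxComponent p ξ

theorem existsUnique_normal_aux [FiniteDimensional ℝ E] (B : (ℝ × E) →L[ℝ] (ℝ × E) →L[ℝ] ℝ)
    (hpos : ∀ v, v ≠ 0 → 0 < B v v) :
    ∃! ξ : ℝ × E, (∀ v : E, B ξ (0, v) = 0) ∧ B ξ ξ = 1 ∧ 0 < ξ.1 := by
  let L : (ℝ × E) →ₗ[ℝ] Module.Dual ℝ (ℝ × E) :=
    (ContinuousLinearMap.coeLM ℝ).comp B.toLinearMap
  have hL : ∀ u v, L u v = B u v := fun _ _ => rfl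
  have hinj : Function.Injective L := by
    rw [injective_iff_map_eq_zero]
    intro u hu
    by_contra h
    have h1 := hpos u h
    rw [← hL, hu] at h1
    simp at h1
  have hsurj : Function.Surjective L :=
    (LinearMap.injective_iff_surjective_of_finrank_eq_finrank
      (Subspace.dual_finrank_eq (K := ℝ) (V := ℝ × E)).symm).1 hinj
  obtain ⟨u, hu⟩ := hsurj (LinearMap.fst ℝ ℝ E)
  have hu' : ∀ v, B u v = v.1 := fun v => by rw [← hL, hu]; rfl
  have hu0 : u ≠ 0 := by
    rintro rfl
    have := hu' (1, 0)
    simp at this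
  have hu1 : 0 < u.1 := by rw [← hu']; exact hpos u hu0
  have hs : 0 < Real.sqrt u.1 := Real.sqrt_pos.2 hu1
  have hss : Real.sqrt u.1 * Real.sqrt u.1 = u.1 := Real.mul_self_sqrt hu1.le
  refine ⟨(Real.sqrt u.1)⁻¹ • u, ⟨?_, ?_, ?_⟩, ?_⟩
  · intro v
    simp [hu']
  · simp only [map_smul, smul_apply, hu', smul_eq_mul]
    field_simp
    nlinarith
  · simp only [Prod.smul_fst, smul_eq_mul]
    positivity
  · rintro ξ ⟨h1, h2, h3⟩
    have hξ : ∀ v, B ξ v = B ξ (1, 0) * v.1 := by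
      intro v
      have hv : v = v.1 • ((1, 0) : ℝ × E) + (0, v.2) := by ext <;> simp
      conv_lhs => rw [hv]
      rw [map_add, map_smul, h1, smul_eq_mul]
      ring
    have hc : ξ = B ξ (1, 0) • u := by
      apply hinj
      refine LinearMap.ext fun v => ?_
      rw [map_smul, LinearMap.smul_apply, hL, hL, hu', hξ, smul_eq_mul]
    generalize B ξ (1, 0) = c at hc
    subst hc
    simp only [map_smul, smul_apply, hu', smul_eq_mul, Prod.smul_fst] at h2 h3
    have hcpos : 0 < c := (mul_pos_iff_of_pos_right hu1).1 h3
    have : c * Real.sqrt u.1 = 1 := by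
      have hp : 0 < c * Real.sqrt u.1 := by positivity
      have : (c * Real.sqrt u.1) ^ 2 = 1 := by
        calc (c * Real.sqrt u.1) ^ 2 = c * (c * (Real.sqrt u.1 * Real.sqrt u.1)) := by ring
          _ = 1 := by rw [hss]; simpa using h2
      nlinarith
    rw [eq_inv_of_mul_eq_one_left this]

/-- The outgoing unit normal exists and is unique. -/
theorem existsUnique_outgoingNormal [FiniteDimensional ℝ E] (G : EndMetric R E S)
    (p : HalfLine R × S) : ∃! ξ, IsOutgoingNormal G p ξ :=
  existsUnique_normal_aux (G.inner p) (G.pos p)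

/-- The outgoing unit normal vector field `ν_r` to `{r} × S`, at the point `p = (r, σ)`. -/
def outgoingNormal [FiniteDimensional ℝ E] (G : EndMetric R E S) (p : HalfLine R × S) :
    TangentSpace (𝓘(ℝ, ℝ).prod 𝓘(ℝ, E)) p :=
  (existsUnique_outgoingNormal G p).choose

/-- The tangent vector `t ν_r` at `(r, σ)`. -/
def scaledNormal [FiniteDimensional ℝ E] (G : EndMetric R E S) (r : HalfLine R) (t : ℝ) (σ : S) :
    TangentBundle (𝓘(ℝ, ℝ).prod 𝓘(ℝ, E)) (HalfLine R × S) :=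
  ⟨(r, σ), t • outgoingNormal G (r, σ)⟩

/-- The outgoing normal geodesic flow `N_r (t, σ) = exp_{(r, σ)} (t ν_r)`. -/
def normalFlow [FiniteDimensional ℝ E] (G : EndMetric R E S) (r : HalfLine R) (t : ℝ) (σ : S) :
    HalfLine R × S :=
  expMap G (scaledNormal G r t σ)

/-- The component `x_r` of the normal flow on `(R, ∞)`. -/
def radialPart [FiniteDimensional ℝ E] (G : EndMetric R E S) (r : HalfLine R) (t : ℝ) (σ : S) :
    ℝ :=
  ((normalFlow G r t σ).1 : ℝ)

/-- The component `σ_r` of the normal flow on `S`. -/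
def angularPart [FiniteDimensional ℝ E] (G : EndMetric R E S) (r : HalfLine R) (t : ℝ) (σ : S) :
    S :=
  (normalFlow G r t σ).2

end End

end NormalFlow

end

/-!
# The normal flow of an asymptotically conical end

The unit speed geodesics that leave `{r} × S` orthogonally are followed in coordinates `(x, θ)` of
the end, in Hamiltonian form: the unknowns are `x`, `θ` and the angular momentum `η`, which vanishes
initially (`mfderivModel_endParam_eq_outgoingNormal`). Conservation of energy gives the radial speed
as a function of `(x, θ, η)` (`radialSpeed`), and conversely the equations for `θ` and `η` together
with the unit speed imply the geodesic equation (`eulerLagrange_eq_zero_of_momentum`).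

By the decay assumptions, the right-hand side `F` of the equations for `(x - t, θ, η)` is
`O(x ^ (-1 - τ))`. More precisely, the rescaled fields `x₀ ^ (1 + τ) F(x₀ μ, θ, η)`, for `μ` in a
compact subset of `(0, ∞)`, form a bounded family of smooth functions as `x₀ → ∞`
(`IsAsymptotic.exists_smoothFamily`). After a truncation, the equations take the integral form
`u(t) = (0, θ, 0) + ∫_0^t (r + ⟨s⟩) ^ (-1 - τ) f(s, u(s)) ds` with `f` bounded along with its
derivatives, and the right-hand side is a contraction, with constant `O(r ^ (-τ))`, of the space of
bounded continuous functions on the line (`IsAsymptotic.exists_trajectories`). This gives at once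
the global existence of the trajectories, their limits at infinity, the `O(r ^ (-τ))` distance to
the translations `(r + t, θ)`, and, by the implicit function theorem, the smooth dependence on `θ`,
uniformly in time (`exists_contDiff_fixedPoint`).

For the symbol estimates, derivatives in time are turned into derivatives in a parameter. The
trajectory run with speed `l` solves an equation of the same form, in which `l` is one more
parameter, and its value at time `t` is that of the original one at time `l t`. Hence `t ∂_t`
amounts to differentiation in `l` at `l = 1`. The deviation from the limit is the integral over
`(t, ∞)` of a bounded function which depends smoothly on `(l, θ)`, against a weight that is
`O(s ^ (-1 - τ))`, and so remains `O(t ^ (-τ))` under all these differentiations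
(`isSymbol_of_tail`, `isSymbol_sub_limit`).

The exponential map is defined by arbitrary geodesics, and the uniqueness of geodesics
(`eqOn_of_isUnitTimeGeodesic`) identifies it with the trajectories
(`normalFlow_eq_of_reducedField`).

For the global statements, `S` is covered by finitely many coordinate balls, the cells, such that
the points `W`-close to a given one lie in one cell, for some entourage `W` of the diagonal. A map
which is in each cell a perturbation of the identity, small in the Lipschitz sense, is a local
diffeomorphism. It is injective since points with the same image lie in one cell, and surjective
since its image is open and closed and meets each of the connected cells
(`ChartCover.exists_diffeomorph`). The same argument applies to the flow as a map from
`(0, ∞) × S` to `(r, ∞) × S`, which is proper since `x` grows at least linearly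
(`IsFlow.exists_flow_equiv`).
-/

open scoped Manifold ContDiff Topology Bundle
open Set Filter

noncomputable section

namespace NormalFlow

/-! ### Families of smooth functions with uniformly bounded derivatives -/

section SmoothFamily

variable {N N' Q Q' Y Y' Y₁ Y₂ Y₃ : Type*}
  [NormedAddCommGroup N] [NormedSpace ℝ N] [NormedAddCommGroup N'] [NormedSpace ℝ N']
  [NormedAddCommGroup Q] [NormedSpace ℝ Q] [NormedAddCommGroup Q'] [NormedSpace ℝ Q']
  [NormedAddCommGroup Y] [NormedSpace ℝ Y] [NormedAddCommGroup Y'] [NormedSpace ℝ Y']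
  [NormedAddCommGroup Y₁] [NormedSpace ℝ Y₁] [NormedAddCommGroup Y₂] [NormedSpace ℝ Y₂]
  [NormedAddCommGroup Y₃] [NormedSpace ℝ Y₃]

/-- A family of functions `f i` on `U`, with `i` in `I`, that is jointly smooth and such that each
derivative in the second variable is bounded on `U`, uniformly in `i`. No uniformity is asked of
the derivatives in `i`. -/
structure SmoothFamily (I : Set N) (U : Set Q) (f : N → Q → Y) : Prop where
  contDiffOn : ContDiffOn ℝ ∞ (fun p : N × Q => f p.1 p.2) (I ×ˢ U)
  bound : ∀ n : ℕ, ∃ C : ℝ, ∀ i ∈ I, ∀ q ∈ U, ‖iteratedFDeriv ℝ n (f i) q‖ ≤ C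

variable {I : Set N} {I' : Set N'} {U : Set Q} {U' : Set Q'} {f : N → Q → Y}

theorem contDiffOn_slice {i : N} (hf : ContDiffOn ℝ ∞ (fun p : N × Q => f p.1 p.2) (I ×ˢ U))
    (hi : i ∈ I) : ContDiffOn ℝ ∞ (f i) U :=
  hf.comp (f := fun q => (i, q)) (contDiff_prodMk_right i).contDiffOn fun _ hq => ⟨hi, hq⟩

namespace SmoothFamily

theorem slice (hf : SmoothFamily I U f) {i : N} (hi : i ∈ I) : ContDiffOn ℝ ∞ (f i) U :=
  contDiffOn_slice hf.contDiffOn hi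

theorem bound_zero (hf : SmoothFamily I U f) : ∃ C : ℝ, 0 ≤ C ∧ ∀ i ∈ I, ∀ q ∈ U, ‖f i q‖ ≤ C := by
  obtain ⟨C, hC⟩ := hf.bound 0
  refine ⟨max C 0, le_max_right _ _, fun i hi q hq => ?_⟩
  have := hC i hi q hq
  rw [norm_iteratedFDeriv_zero] at this
  exact this.trans (le_max_left _ _)

theorem bound_fderiv (hf : SmoothFamily I U f) :
    ∃ C : ℝ, 0 ≤ C ∧ ∀ i ∈ I, ∀ q ∈ U, ‖fderiv ℝ (f i) q‖ ≤ C := by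
  obtain ⟨C, hC⟩ := hf.bound 1
  refine ⟨max C 0, le_max_right _ _, fun i hi q hq => ?_⟩
  have := hC i hi q hq
  rw [norm_iteratedFDeriv_one] at this
  exact this.trans (le_max_left _ _)

/-- A common bound for all derivatives up to a given order. -/
theorem bound_le (hf : SmoothFamily I U f) (n : ℕ) :
    ∃ C : ℝ, 1 ≤ C ∧ ∀ k ≤ n, ∀ i ∈ I, ∀ q ∈ U, ‖iteratedFDeriv ℝ k (f i) q‖ ≤ C := by
  choose C hC using hf.bound
  refine ⟨1 + ∑ k ∈ Finset.range (n + 1), |C k|, ?_, fun k hk i hi q hq => ?_⟩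
  · have : 0 ≤ ∑ k ∈ Finset.range (n + 1), |C k| := Finset.sum_nonneg fun _ _ => abs_nonneg _
    linarith
  · have h1 : |C k| ≤ ∑ k ∈ Finset.range (n + 1), |C k| :=
      Finset.single_le_sum (f := fun k => |C k|) (fun _ _ => abs_nonneg _)
        (Finset.mem_range.2 (by omega))
    have := (hC k i hi q hq).trans (le_abs_self _)
    linarith

theorem mono (hf : SmoothFamily I U f) {J : Set N} {V : Set Q} (hJ : J ⊆ I) (hV : V ⊆ U) :
    SmoothFamily J V f :=
  ⟨hf.contDiffOn.mono (prod_mono hJ hV), fun n => by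
    obtain ⟨C, hC⟩ := hf.bound n
    exact ⟨C, fun i hi q hq => hC i (hJ hi) q (hV hq)⟩⟩

theorem congr (hU : IsOpen U) (hf : SmoothFamily I U f) {g : N → Q → Y}
    (h : ∀ i ∈ I, ∀ q ∈ U, g i q = f i q) : SmoothFamily I U g := by
  refine ⟨hf.contDiffOn.congr fun p hp => h p.1 hp.1 p.2 hp.2, fun n => ?_⟩
  obtain ⟨C, hC⟩ := hf.bound n
  refine ⟨C, fun i hi q hq => ?_⟩
  have : g i =ᶠ[𝓝 q] f i := by
    filter_upwards [hU.mem_nhds hq] with y hy using h i hi y hy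
  rw [(this.iteratedFDeriv ℝ n).eq_of_nhds]
  exact hC i hi q hq

theorem reindex (hf : SmoothFamily I U f) {ρ : N' → N} (hρ : ContDiffOn ℝ ∞ ρ I')
    (hmaps : MapsTo ρ I' I) : SmoothFamily I' U (fun i => f (ρ i)) := by
  refine ⟨?_, fun n => ?_⟩
  · refine hf.contDiffOn.comp (f := fun p : N' × Q => (ρ p.1, p.2)) (s := I' ×ˢ U) ?_ ?_
    · exact (hρ.comp contDiff_fst.contDiffOn fun p hp => hp.1).prodMk contDiff_snd.contDiffOn
    · exact fun p hp => ⟨hmaps hp.1, hp.2⟩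
  · obtain ⟨C, hC⟩ := hf.bound n
    exact ⟨C, fun i hi q hq => hC (ρ i) (hmaps hi) q hq⟩

/-- Composition of families; the derivatives of the outer family need only be bounded on a set `K`
containing all the values of the inner one. -/
theorem comp_of_bound (hU : IsOpen U) {f : N → Q → Q'} (hf : SmoothFamily I U f)
    {V K : Set Q'} (hV : IsOpen V) (hKV : K ⊆ V) {g : N → Q' → Y}
    (hg : ContDiffOn ℝ ∞ (fun p : N × Q' => g p.1 p.2) (I ×ˢ V))
    (hgb : ∀ n : ℕ, ∃ C : ℝ, ∀ i ∈ I, ∀ y ∈ K, ‖iteratedFDeriv ℝ n (g i) y‖ ≤ C)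
    (hmaps : ∀ i ∈ I, ∀ q ∈ U, f i q ∈ K) :
    SmoothFamily I U (fun i q => g i (f i q)) := by
  refine ⟨?_, fun n => ?_⟩
  · refine hg.comp (f := fun p : N × Q => (p.1, f p.1 p.2)) (s := I ×ˢ U) ?_ ?_
    · exact contDiff_fst.contDiffOn.prodMk hf.contDiffOn
    · exact fun p hp => ⟨hp.1, hKV (hmaps _ hp.1 _ hp.2)⟩
  · obtain ⟨D, hD1, hD⟩ := hf.bound_le n
    choose C hC using hgb
    let C' := ∑ k ∈ Finset.range (n + 1), |C k|
    refine ⟨n.factorial * C' * D ^ n, fun i hi q hq => ?_⟩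
    have hfi := hf.slice hi
    have hgi : ContDiffOn ℝ ∞ (g i) V := contDiffOn_slice hg hi
    have hm : MapsTo (f i) U V := fun q hq => hKV (hmaps i hi q hq)
    have := norm_iteratedFDerivWithin_comp_le (n := n) (N := (n : ℕ∞)) (x := q) (C := C') (D := D)
      (hgi.of_le (by exact_mod_cast le_top)) (hfi.of_le (by exact_mod_cast le_top)) le_rfl
      hV.uniqueDiffOn hU.uniqueDiffOn hm hq ?_ ?_
    · rwa [iteratedFDerivWithin_of_isOpen n hU hq] at this
    · intro k hk
      rw [iteratedFDerivWithin_of_isOpen k hV (hm hq)]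
      refine ((hC k i hi _ (hmaps i hi q hq)).trans (le_abs_self _)).trans ?_
      exact Finset.single_le_sum (f := fun k => |C k|) (fun _ _ => abs_nonneg _)
        (Finset.mem_range.2 (by omega))
    · intro k hk1 hk
      rw [iteratedFDerivWithin_of_isOpen k hU hq]
      exact (hD k hk i hi q hq).trans (le_self_pow₀ hD1 (by omega))

theorem comp (hU : IsOpen U) {f : N → Q → Q'} (hf : SmoothFamily I U f)
    {V : Set Q'} (hV : IsOpen V) {g : N → Q' → Y} (hg : SmoothFamily I V g)
    (hmaps : ∀ i ∈ I, ∀ q ∈ U, f i q ∈ V) :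
    SmoothFamily I U (fun i q => g i (f i q)) :=
  comp_of_bound hU hf hV Subset.rfl hg.contDiffOn hg.bound hmaps

/-- Composition with a fixed smooth function defined near a compact set of values. -/
theorem comp_smooth (hU : IsOpen U) {f : N → Q → Q'} (hf : SmoothFamily I U f)
    {V K : Set Q'} (hV : IsOpen V) (hK : IsCompact K) (hKV : K ⊆ V) {g : Q' → Y}
    (hg : ContDiffOn ℝ ∞ g V) (hmaps : ∀ i ∈ I, ∀ q ∈ U, f i q ∈ K) :
    SmoothFamily I U (fun i q => g (f i q)) := by
  refine comp_of_bound (g := fun _ => g) hU hf hV hKV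
    (hg.comp contDiff_snd.contDiffOn fun p hp => hp.2) (fun n => ?_) hmaps
  have hc : ContinuousOn (fun y => iteratedFDeriv ℝ n g y) K := by
    have := hg.continuousOn_iteratedFDerivWithin (m := n) (by exact_mod_cast le_top)
      hV.uniqueDiffOn
    exact (this.mono hKV).congr fun y hy => (iteratedFDerivWithin_of_isOpen n hV (hKV hy)).symm
  obtain ⟨C, hC⟩ := hK.exists_bound_of_continuousOn hc
  exact ⟨C, fun _ _ y hy => hC y hy⟩

theorem comp_contDiff [ProperSpace Q'] (hU : IsOpen U) {f : N → Q → Q'}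
    (hf : SmoothFamily I U f) {g : Q' → Y} (hg : ContDiff ℝ ∞ g) :
    SmoothFamily I U (fun i q => g (f i q)) := by
  obtain ⟨C, -, hC⟩ := hf.bound_zero
  exact comp_smooth hU hf isOpen_univ (isCompact_closedBall (0 : Q') C) (subset_univ _)
    hg.contDiffOn fun i hi q hq => by simpa using hC i hi q hq

theorem prodMk (hU : IsOpen U) {f : N → Q → Y₁} {g : N → Q → Y₂} (hf : SmoothFamily I U f)
    (hg : SmoothFamily I U g) : SmoothFamily I U (fun i q => (f i q, g i q)) := by
  refine ⟨hf.contDiffOn.prodMk hg.contDiffOn, fun n => ?_⟩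
  obtain ⟨C, hC⟩ := hf.bound n
  obtain ⟨D, hD⟩ := hg.bound n
  refine ⟨max C D, fun i hi q hq => ?_⟩
  rw [iteratedFDeriv_prodMk ((hf.slice hi).contDiffAt (hU.mem_nhds hq))
    ((hg.slice hi).contDiffAt (hU.mem_nhds hq)) (by exact_mod_cast le_top)]
  rw [ContinuousMultilinearMap.opNorm_prod]
  exact max_le_max (hC i hi q hq) (hD i hi q hq)

theorem clm_comp (hU : IsOpen U) (L : Y →L[ℝ] Y') (hf : SmoothFamily I U f) :
    SmoothFamily I U (fun i q => L (f i q)) := by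
  refine ⟨L.contDiff.comp_contDiffOn hf.contDiffOn, fun n => ?_⟩
  obtain ⟨C, hC⟩ := hf.bound n
  refine ⟨‖L‖ * C, fun i hi q hq => ?_⟩
  have := L.norm_iteratedFDeriv_comp_left (n := n) (N := ∞)
    ((hf.slice hi).contDiffAt (hU.mem_nhds hq)) (by exact_mod_cast le_top)
  exact this.trans (mul_le_mul_of_nonneg_left (hC i hi q hq) (norm_nonneg _))

/-- A fixed smooth function, as a constant family. -/
theorem of_contDiffOn {V K : Set Q} (hV : IsOpen V) (hK : IsCompact K) (hKV : K ⊆ V) (hUK : U ⊆ K)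
    {g : Q → Y} (hg : ContDiffOn ℝ ∞ g V) : SmoothFamily I U (fun _ => g) := by
  refine ⟨hg.comp contDiff_snd.contDiffOn fun p hp => hKV (hUK hp.2), fun n => ?_⟩
  have hc : ContinuousOn (fun y => iteratedFDeriv ℝ n g y) K := by
    have := hg.continuousOn_iteratedFDerivWithin (m := n) (by exact_mod_cast le_top)
      hV.uniqueDiffOn
    exact (this.mono hKV).congr fun y hy => (iteratedFDerivWithin_of_isOpen n hV (hKV hy)).symm
  obtain ⟨C, hC⟩ := hK.exists_bound_of_continuousOn hc
  exact ⟨C, fun _ _ y hy => hC y (hUK hy)⟩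

theorem of_contDiff [ProperSpace Q] (hb : Bornology.IsBounded U) {g : Q → Y}
    (hg : ContDiff ℝ ∞ g) : SmoothFamily I U (fun _ => g) :=
  of_contDiffOn isOpen_univ (Metric.isCompact_of_isClosed_isBounded isClosed_closure hb.closure)
    (subset_univ _) subset_closure hg.contDiffOn

/-- A bounded function of the index. -/
theorem of_index {s : N → Y} (hs : ContDiffOn ℝ ∞ s I) {C : ℝ} (hC : ∀ i ∈ I, ‖s i‖ ≤ C) :
    SmoothFamily I U (fun i _ => s i) := by
  refine ⟨hs.comp contDiff_fst.contDiffOn fun p hp => hp.1, fun n => ?_⟩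
  refine ⟨max C 0, fun i hi q _ => ?_⟩
  rcases Nat.eq_zero_or_pos n with rfl | hn
  · rw [norm_iteratedFDeriv_zero]
    exact (hC i hi).trans (le_max_left _ _)
  · rw [iteratedFDeriv_const_of_ne hn.ne']
    simp

theorem const (c : Y) : SmoothFamily I U (fun _ _ => c) :=
  of_index (C := ‖c‖) contDiffOn_const fun _ _ => le_rfl

theorem bilinear [ProperSpace Y₁] [ProperSpace Y₂] (hU : IsOpen U) (B : Y₁ →L[ℝ] Y₂ →L[ℝ] Y₃)
    {f : N → Q → Y₁} {g : N → Q → Y₂} (hf : SmoothFamily I U f) (hg : SmoothFamily I U g) :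
    SmoothFamily I U (fun i q => B (f i q) (g i q)) :=
  (hf.prodMk hU hg).comp_contDiff hU (g := fun p : Y₁ × Y₂ => B p.1 p.2)
    B.isBoundedBilinearMap.contDiff

theorem add (hU : IsOpen U) {g : N → Q → Y} (hf : SmoothFamily I U f)
    (hg : SmoothFamily I U g) : SmoothFamily I U (fun i q => f i q + g i q) :=
  (hf.prodMk hU hg).clm_comp hU (ContinuousLinearMap.fst ℝ Y Y + ContinuousLinearMap.snd ℝ Y Y)

theorem sub (hU : IsOpen U) {g : N → Q → Y} (hf : SmoothFamily I U f)
    (hg : SmoothFamily I U g) : SmoothFamily I U (fun i q => f i q - g i q) :=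
  (hf.prodMk hU hg).clm_comp hU (ContinuousLinearMap.fst ℝ Y Y - ContinuousLinearMap.snd ℝ Y Y)

theorem neg (hU : IsOpen U) (hf : SmoothFamily I U f) : SmoothFamily I U (fun i q => -f i q) :=
  hf.clm_comp hU (-ContinuousLinearMap.id ℝ Y)

theorem sum {κ : Type*} (hU : IsOpen U) (s : Finset κ) {f : κ → N → Q → Y}
    (hf : ∀ k ∈ s, SmoothFamily I U (f k)) : SmoothFamily I U (fun i q => ∑ k ∈ s, f k i q) := by
  classical
  induction s using Finset.induction_on with
  | empty => simpa using const (0 : Y)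
  | insert a s ha ih =>
    simp only [Finset.sum_insert ha]
    exact (hf a (by simp)).add hU (ih fun k hk => hf k (by simp [hk]))

theorem smul [ProperSpace Y] (hU : IsOpen U) {c : N → Q → ℝ} (hc : SmoothFamily I U c)
    (hf : SmoothFamily I U f) : SmoothFamily I U (fun i q => c i q • f i q) :=
  bilinear hU (ContinuousLinearMap.lsmul ℝ ℝ) hc hf

theorem mul (hU : IsOpen U) {f g : N → Q → ℝ} (hf : SmoothFamily I U f)
    (hg : SmoothFamily I U g) : SmoothFamily I U (fun i q => f i q * g i q) :=
  smul hU hf hg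

theorem clm_apply [ProperSpace Y] [ProperSpace (Y →L[ℝ] Y')] (hU : IsOpen U)
    {L : N → Q → (Y →L[ℝ] Y')} (hL : SmoothFamily I U L) (hf : SmoothFamily I U f) :
    SmoothFamily I U (fun i q => L i q (f i q)) :=
  bilinear hU (ContinuousLinearMap.id ℝ (Y →L[ℝ] Y')) hL hf

theorem real_comp (hU : IsOpen U) {f : N → Q → ℝ} (hf : SmoothFamily I U f) {c : ℝ}
    (hc : 0 < c) (hcf : ∀ i ∈ I, ∀ q ∈ U, c ≤ f i q) {g : ℝ → ℝ}
    (hg : ContDiffOn ℝ ∞ g (Ioi 0)) : SmoothFamily I U (fun i q => g (f i q)) := by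
  obtain ⟨C, -, hC⟩ := hf.bound_zero
  exact comp_smooth hU hf isOpen_Ioi (isCompact_Icc (a := c) (b := C))
    (fun x hx => hc.trans_le hx.1) hg
    fun i hi q hq => ⟨hcf i hi q hq, (le_abs_self _).trans (hC i hi q hq)⟩

theorem inv (hU : IsOpen U) {f : N → Q → ℝ} (hf : SmoothFamily I U f) {c : ℝ}
    (hc : 0 < c) (hcf : ∀ i ∈ I, ∀ q ∈ U, c ≤ f i q) :
    SmoothFamily I U (fun i q => (f i q)⁻¹) :=
  hf.real_comp hU hc hcf (contDiffOn_id.inv fun _ hx => (mem_Ioi.1 hx).ne')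

theorem sqrt (hU : IsOpen U) {f : N → Q → ℝ} (hf : SmoothFamily I U f) {c : ℝ}
    (hc : 0 < c) (hcf : ∀ i ∈ I, ∀ q ∈ U, c ≤ f i q) :
    SmoothFamily I U (fun i q => Real.sqrt (f i q)) :=
  hf.real_comp hU hc hcf (contDiffOn_id.sqrt fun _ hx => (mem_Ioi.1 hx).ne')

theorem fderiv (hI : IsOpen I) (hU : IsOpen U) (hf : SmoothFamily I U f) :
    SmoothFamily I U (fun i q => fderiv ℝ (f i) q) := by
  refine ⟨?_, fun n => ?_⟩
  · have h1 : ContDiffOn ℝ ∞ (fun p : N × Q => _root_.fderiv ℝ (fun p : N × Q => f p.1 p.2) p)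
        (I ×ˢ U) := hf.contDiffOn.fderiv_of_isOpen (hI.prod hU) (by simp)
    have h2 := h1.clm_comp (contDiffOn_const (c := ContinuousLinearMap.inr ℝ N Q))
    refine h2.congr fun p hp => ?_
    have hd : DifferentiableAt ℝ (fun p : N × Q => f p.1 p.2) p :=
      (hf.contDiffOn.contDiffAt ((hI.prod hU).mem_nhds hp)).differentiableAt (by simp)
    have := hd.hasFDerivAt.comp (f := fun q => (p.1, q)) p.2 (hasFDerivAt_prodMk_right p.1 p.2)
    exact this.fderiv
  · obtain ⟨C, hC⟩ := hf.bound (n + 1)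
    refine ⟨C, fun i hi q hq => ?_⟩
    rw [norm_iteratedFDeriv_fderiv]
    exact hC i hi q hq

end SmoothFamily

end SmoothFamily

/-! ### Superposition operators on bounded continuous functions -/

section Superposition

open BoundedContinuousFunction

universe u

variable {T : Type*} [TopologicalSpace T]
  {Z Y : Type*} [NormedAddCommGroup Z] [NormedSpace ℝ Z] [NormedAddCommGroup Y] [NormedSpace ℝ Y]

set_option synthInstance.maxHeartbeats 200000 in
/-- Pointwise evaluation of a bounded family of operators on a bounded family of vectors. -/
def pointwiseApply (T Z Y : Type*) [TopologicalSpace T] [NormedAddCommGroup Z] [NormedSpace ℝ Z]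
    [NormedAddCommGroup Y] [NormedSpace ℝ Y] :
    (T →ᵇ (Z →L[ℝ] Y)) →L[ℝ] (T →ᵇ Z) →L[ℝ] (T →ᵇ Y) :=
  LinearMap.mkContinuous₂ (E := T →ᵇ (Z →L[ℝ] Y)) (F := T →ᵇ Z) (G := T →ᵇ Y)
    (LinearMap.mk₂ ℝ
      (fun (A : T →ᵇ (Z →L[ℝ] Y)) (h : T →ᵇ Z) =>
        BoundedContinuousFunction.ofNormedAddCommGroup (fun t => A t (h t))
          (A.continuous.clm_apply h.continuous) (‖A‖ * ‖h‖) fun t =>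
            (A t).le_of_opNorm_le_of_le (norm_coe_le_norm A t) (norm_coe_le_norm h t))
      (fun A B h => by ext t; simp)
      (fun c A h => by ext t; simp)
      (fun A h k => by ext t; simp)
      (fun c A h => by ext t; simp))
    1 fun A h => by
      rw [one_mul]
      exact (BoundedContinuousFunction.norm_le (by positivity)).2 fun t =>
        (A t).le_of_opNorm_le_of_le (norm_coe_le_norm A t) (norm_coe_le_norm h t)

@[simp] theorem pointwiseApply_apply (A : T →ᵇ (Z →L[ℝ] Y)) (h : T →ᵇ Z) (t : T) :
    pointwiseApply T Z Y A h t = A t (h t) := rfl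

/-- The superposition operator `u ↦ (t ↦ f t (u t))`. -/
def superposition (f : ℝ → Z → Y) (hf : SmoothFamily univ univ f) (u : ℝ →ᵇ Z) : ℝ →ᵇ Y :=
  BoundedContinuousFunction.ofNormedAddCommGroup (fun t => f t (u t))
    (Continuous.comp (g := fun p : ℝ × Z => f p.1 p.2) (f := fun t => (t, u t))
      (contDiffOn_univ.1 (by simpa only [univ_prod_univ] using hf.contDiffOn)).continuous
      (continuous_id.prodMk u.continuous))
    hf.bound_zero.choose fun t =>
      hf.bound_zero.choose_spec.2 t (mem_univ _) (u t) (mem_univ _)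

@[simp] theorem superposition_apply (f : ℝ → Z → Y) (hf : SmoothFamily univ univ f) (u : ℝ →ᵇ Z)
    (t : ℝ) : superposition f hf u t = f t (u t) := rfl

set_option synthInstance.maxHeartbeats 200000 in
/-- The derivative of a superposition operator is the pointwise multiplication by the
superposition operator of the derivative. -/
theorem hasFDerivAt_superposition (f : ℝ → Z → Y) (hf : SmoothFamily univ univ f)
    (u : ℝ →ᵇ Z) :
    HasFDerivAt (superposition f hf)
      (pointwiseApply ℝ Z Y (superposition _ (hf.fderiv isOpen_univ isOpen_univ) u)) u := by
  obtain ⟨C, hC0, hC⟩ := (hf.fderiv isOpen_univ isOpen_univ).bound_fderiv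
  have hd : ∀ t, ContDiff ℝ ∞ (f t) := fun t => contDiffOn_univ.1 (hf.slice (mem_univ t))
  have hlip : ∀ t x y, ‖fderiv ℝ (f t) x - fderiv ℝ (f t) y‖ ≤ C * ‖x - y‖ := fun t x y =>
    convex_univ.norm_image_sub_le_of_norm_fderiv_le (𝕜 := ℝ) (f := fderiv ℝ (f t))
      (fun z _ => ((hd t).fderiv_right (m := ∞) (by simp)).differentiable (by simp) z)
      (fun z _ => hC t (mem_univ _) z (mem_univ _)) (mem_univ _) (mem_univ _)
  rw [hasFDerivAt_iff_isLittleO_nhds_zero]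
  have hb : ∀ h : ℝ →ᵇ Z, ‖superposition f hf (u + h) - superposition f hf u
      - pointwiseApply ℝ Z Y (superposition _ (hf.fderiv isOpen_univ isOpen_univ) u) h‖
      ≤ C * ‖h‖ ^ 2 := by
    intro h
    refine (BoundedContinuousFunction.norm_le (by positivity)).2 fun t => ?_
    have hball : Convex ℝ (Metric.closedBall (u t) ‖h‖) := convex_closedBall _ _
    have := hball.norm_image_sub_le_of_norm_fderiv_le' (𝕜 := ℝ) (f := f t)
      (φ := fderiv ℝ (f t) (u t)) (C := C * ‖h‖) (x := u t) (y := u t + h t)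
      (fun z _ => (hd t).differentiable (by simp) z)
      (fun z hz => (hlip t z (u t)).trans (mul_le_mul_of_nonneg_left
        (by simpa [dist_eq_norm] using hz) hC0))
      (by simp) (by simpa [dist_eq_norm] using norm_coe_le_norm h t)
    simp only [add_sub_cancel_left] at this
    change ‖f t (u t + h t) - f t (u t) - fderiv ℝ (f t) (u t) (h t)‖ ≤ C * ‖h‖ ^ 2
    refine this.trans ?_
    calc C * ‖h‖ * ‖h t‖ ≤ C * ‖h‖ * ‖h‖ :=
          mul_le_mul_of_nonneg_left (norm_coe_le_norm h t) (by positivity)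
      _ = C * ‖h‖ ^ 2 := by ring
  refine (Asymptotics.IsBigO.of_bound (g := fun h : ℝ →ᵇ Z => ‖h‖ ^ 2) C
    (Eventually.of_forall fun h => ?_)).trans_isLittleO ?_
  · simpa using hb h
  · simpa using (Asymptotics.isLittleO_norm_pow_id (E' := ℝ →ᵇ Z) one_lt_two)

set_option synthInstance.maxHeartbeats 200000 in
theorem contDiff_superposition {Z : Type u} [NormedAddCommGroup Z] [NormedSpace ℝ Z]
    {Y : Type u} [NormedAddCommGroup Y] [NormedSpace ℝ Y]
    (f : ℝ → Z → Y) (hf : SmoothFamily univ univ f) :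
    ContDiff ℝ ∞ (superposition f hf) := by
  rw [contDiff_infty]
  intro n
  induction n generalizing Y with
  | zero =>
    exact contDiff_zero.2 (continuous_iff_continuousAt.2 fun u =>
      (hasFDerivAt_superposition f hf u).continuousAt)
  | succ n ih =>
    rw [Nat.cast_add, Nat.cast_one, contDiff_succ_iff_hasFDerivAt]
    exact ⟨fun u => pointwiseApply ℝ Z Y (superposition _ (hf.fderiv isOpen_univ isOpen_univ) u),
      (ih _ (hf.fderiv isOpen_univ isOpen_univ)).continuousLinearMap_comp (pointwiseApply ℝ Z Y),
      hasFDerivAt_superposition f hf⟩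

end Superposition

/-! ### Integration against an integrable weight -/

section Weight

open BoundedContinuousFunction MeasureTheory

/-- A continuous nonnegative integrable function on the line. -/
structure Weight where
  /-- the underlying function -/
  toFun : ℝ → ℝ
  continuous : Continuous toFun
  nonneg : ∀ t, 0 ≤ toFun t
  integrable : Integrable toFun

instance : CoeFun Weight fun _ => ℝ → ℝ := ⟨Weight.toFun⟩

variable (m : Weight) {X : Type*} [NormedAddCommGroup X] [NormedSpace ℝ X]

/-- The total mass of a weight. -/
def Weight.mass : ℝ := ∫ t, m t

theorem Weight.mass_nonneg : 0 ≤ m.mass := integral_nonneg m.nonneg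

theorem Weight.setIntegral_le_mass (s : Set ℝ) : ∫ t in s, m t ≤ m.mass :=
  setIntegral_le_integral m.integrable (Eventually.of_forall m.nonneg)

theorem Weight.continuous_smul (u : ℝ →ᵇ X) : Continuous fun s => m s • u s :=
  m.continuous.smul u.continuous

theorem Weight.integrable_smul (u : ℝ →ᵇ X) : Integrable fun s => m s • u s := by
  refine (m.integrable.mul_const ‖u‖).mono' (m.continuous_smul u).aestronglyMeasurable ?_
  refine Eventually.of_forall fun s => ?_
  rw [norm_smul, Real.norm_of_nonneg (m.nonneg s)]
  exact mul_le_mul_of_nonneg_left (norm_coe_le_norm u s) (m.nonneg s)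

theorem Weight.norm_setIntegral_le (u : ℝ →ᵇ X) (s : Set ℝ) :
    ‖∫ t in s, m t • u t‖ ≤ (∫ t in s, m t) * ‖u‖ := by
  rw [← integral_mul_const]
  refine norm_integral_le_of_norm_le (m.integrable.integrableOn.mul_const _)
    (Eventually.of_forall fun t => ?_)
  rw [norm_smul, Real.norm_of_nonneg (m.nonneg t)]
  exact mul_le_mul_of_nonneg_left (norm_coe_le_norm u t) (m.nonneg t)

/-- The tail `u ↦ ∫_t^∞ m u`. -/
def Weight.tail (X : Type*) [NormedAddCommGroup X] [NormedSpace ℝ X] (t : ℝ) :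
    (ℝ →ᵇ X) →L[ℝ] X :=
  LinearMap.mkContinuous
    { toFun := fun u => ∫ s in Ioi t, m s • u s
      map_add' := fun u v => by
        simp only [BoundedContinuousFunction.add_apply, smul_add]
        exact integral_add (m.integrable_smul u).integrableOn (m.integrable_smul v).integrableOn
      map_smul' := fun c u => by
        simp only [BoundedContinuousFunction.smul_apply, RingHom.id_apply, smul_comm _ c]
        exact integral_smul _ _ }
    (∫ s in Ioi t, m s) fun u => m.norm_setIntegral_le u _

theorem Weight.tail_apply (t : ℝ) (u : ℝ →ᵇ X) : m.tail X t u = ∫ s in Ioi t, m s • u s := rfl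

theorem Weight.norm_tail_le (t : ℝ) : ‖m.tail X t‖ ≤ ∫ s in Ioi t, m s :=
  LinearMap.mkContinuous_norm_le _ (integral_nonneg m.nonneg) _

theorem Weight.norm_intervalIntegral_le (u : ℝ →ᵇ X) (t : ℝ) :
    ‖∫ s in (0 : ℝ)..t, m s • u s‖ ≤ m.mass * ‖u‖ := by
  rw [intervalIntegral.norm_intervalIntegral_eq]
  exact (m.norm_setIntegral_le u _).trans
    (mul_le_mul_of_nonneg_right (m.setIntegral_le_mass _) (norm_nonneg _))

theorem Weight.hasDerivAt_intervalIntegral [CompleteSpace X] (u : ℝ →ᵇ X) (t : ℝ) :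
    HasDerivAt (fun t => ∫ s in (0 : ℝ)..t, m s • u s) (m t • u t) t :=
  intervalIntegral.integral_hasDerivAt_right ((m.continuous_smul u).intervalIntegrable _ _)
    (m.continuous_smul u).stronglyMeasurable.stronglyMeasurableAtFilter
    (m.continuous_smul u).continuousAt

/-- The primitive `u ↦ (t ↦ ∫_0^t m u)`. -/
def Weight.primitive (X : Type*) [NormedAddCommGroup X] [NormedSpace ℝ X] [CompleteSpace X] :
    (ℝ →ᵇ X) →L[ℝ] (ℝ →ᵇ X) :=
  LinearMap.mkContinuous
    { toFun := fun u => BoundedContinuousFunction.ofNormedAddCommGroup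
        (fun t => ∫ s in (0 : ℝ)..t, m s • u s)
        (continuous_iff_continuousAt.2 fun t => (m.hasDerivAt_intervalIntegral u t).continuousAt)
        (m.mass * ‖u‖) (m.norm_intervalIntegral_le u)
      map_add' := fun u v => by
        ext t
        simp only [coe_ofNormedAddCommGroup, BoundedContinuousFunction.add_apply, smul_add]
        exact intervalIntegral.integral_add ((m.continuous_smul u).intervalIntegrable _ _)
          ((m.continuous_smul v).intervalIntegrable _ _)
      map_smul' := fun c u => by
        ext t
        simp only [coe_ofNormedAddCommGroup, BoundedContinuousFunction.smul_apply,
          RingHom.id_apply, smul_comm _ c]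
        exact intervalIntegral.integral_smul _ _ }
    m.mass fun u => norm_ofNormedAddCommGroup_le _
      (mul_nonneg m.mass_nonneg (norm_nonneg _)) (m.norm_intervalIntegral_le u)

variable [CompleteSpace X]

theorem Weight.primitive_apply (u : ℝ →ᵇ X) (t : ℝ) :
    m.primitive X u t = ∫ s in (0 : ℝ)..t, m s • u s := rfl

theorem Weight.norm_primitive_le : ‖m.primitive X‖ ≤ m.mass :=
  LinearMap.mkContinuous_norm_le _ m.mass_nonneg _

theorem Weight.hasDerivAt_primitive (u : ℝ →ᵇ X) (t : ℝ) :
    HasDerivAt (m.primitive X u) (m t • u t) t :=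
  m.hasDerivAt_intervalIntegral u t

theorem Weight.primitive_zero (u : ℝ →ᵇ X) : m.primitive X u 0 = 0 := by
  rw [m.primitive_apply, intervalIntegral.integral_same]

theorem Weight.tail_zero_sub_primitive (u : ℝ →ᵇ X) (t : ℝ) :
    m.tail X 0 u - m.primitive X u t = m.tail X t u := by
  rw [m.tail_apply, m.tail_apply, m.primitive_apply, sub_eq_iff_eq_add, add_comm]
  exact (intervalIntegral.integral_interval_add_Ioi (m.integrable_smul u).integrableOn
    (m.integrable_smul u).integrableOn).symm

/-- If the derivative of `c` is `m u` on `[0, ∞)` then `c` is the primitive of `u`. -/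
theorem Weight.sub_eq_primitive (u : ℝ →ᵇ X) {c : ℝ → X} {t : ℝ} (ht : 0 ≤ t)
    (hc : ∀ s ∈ Icc 0 t, HasDerivAt c (m s • u s) s) : c t - c 0 = m.primitive X u t := by
  rw [m.primitive_apply]
  refine (intervalIntegral.integral_eq_sub_of_hasDerivAt (fun s hs => hc s ?_)
    ((m.continuous_smul u).intervalIntegrable _ _)).symm
  rwa [uIcc_of_le ht] at hs

end Weight

/-! ### Parametrized fixed points -/

section FixedPoint

open BoundedContinuousFunction

/-- The fixed point of a smooth family of uniform contractions depends smoothly on the parameter. -/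
theorem exists_contDiff_fixedPoint {P B : Type*} [NormedAddCommGroup P] [NormedSpace ℝ P]
    [CompleteSpace P] [NormedAddCommGroup B] [NormedSpace ℝ B] [CompleteSpace B]
    (Ψ : P × B → B) (hΨ : ContDiff ℝ ∞ Ψ)
    (hlip : ∀ p v v', ‖Ψ (p, v) - Ψ (p, v')‖ ≤ 1 / 2 * ‖v - v'‖) :
    ∃ v : P → B, ContDiff ℝ ∞ v ∧ ∀ p, Ψ (p, v p) = v p := by
  have hcontr : ∀ p, ContractingWith (1 / 2) fun v => Ψ (p, v) := fun p =>
    ⟨by rw [← NNReal.coe_lt_coe]; norm_num,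
      LipschitzWith.of_dist_le_mul fun v v' => by
        rw [dist_eq_norm, dist_eq_norm]; simpa using hlip p v v'⟩
  let v : P → B := fun p => (hcontr p).fixedPoint
  have hv : ∀ p, Ψ (p, v p) = v p := fun p => (hcontr p).fixedPoint_isFixedPt
  have huniq : ∀ p y, Ψ (p, y) = y → y = v p := fun p y hy =>
    (hcontr p).fixedPoint_unique hy
  refine ⟨v, contDiff_iff_contDiffAt.2 fun p => ?_, hv⟩
  let F : P × B → B := fun q => q.2 - Ψ q
  have hF : ContDiffAt ℝ ∞ F (p, v p) := (contDiff_snd.sub hΨ).contDiffAt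
  have hΨd : DifferentiableAt ℝ (fun y => Ψ (p, y)) (v p) :=
    (hΨ.comp (contDiff_prodMk_right p)).differentiable (by simp) _
  have hder : fderiv ℝ F (p, v p) ∘L .inr ℝ P B
      = ContinuousLinearMap.id ℝ B - fderiv ℝ (fun y => Ψ (p, y)) (v p) := by
    have h1 : HasFDerivAt (fun y => F (p, y)) (fderiv ℝ F (p, v p) ∘L .inr ℝ P B) (v p) :=
      (hF.differentiableAt (by simp)).hasFDerivAt.comp (v p) (hasFDerivAt_prodMk_right p (v p))
    exact h1.unique ((hasFDerivAt_id (v p)).sub hΨd.hasFDerivAt)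
  have hT : ‖fderiv ℝ (fun y => Ψ (p, y)) (v p)‖ < 1 := by
    have := norm_fderiv_le_of_lip' (𝕜 := ℝ) (f := fun y => Ψ (p, y)) (x₀ := v p) (C := 1 / 2)
      (by norm_num) (Eventually.of_forall fun y => hlip p y (v p))
    linarith
  have hinv : (fderiv ℝ F (p, v p) ∘L .inr ℝ P B).IsInvertible := by
    rw [hder]
    exact ⟨ContinuousLinearEquiv.unitsEquiv ℝ B (Units.oneSub _ hT), rfl⟩
  have hsm := hF.contDiffAt_implicitFunction (by simp) hinv
  refine hsm.congr_of_eventuallyEq ?_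
  filter_upwards [hF.eventually_apply_implicitFunction (by simp) hinv] with q hq
  refine (huniq q _ ?_).symm
  have : F (p, v p) = 0 := sub_eq_zero.2 (hv p).symm
  rw [this] at hq
  exact (sub_eq_zero.1 hq).symm

end FixedPoint

/-! ### Symbol classes: derivatives and dilations -/

section PartialDerivatives

variable {N Q W : Type*} [NormedAddCommGroup N] [NormedSpace ℝ N]
  [NormedAddCommGroup Q] [NormedSpace ℝ Q] [NormedAddCommGroup W] [NormedSpace ℝ W]
  {I : Set N} {V : Set Q}

theorem hasFDerivAt_slice_right {Φ : N → Q → W} {p : N × Q}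
    (h : DifferentiableAt ℝ (fun p : N × Q => Φ p.1 p.2) p) :
    HasFDerivAt (Φ p.1)
      (fderiv ℝ (fun p : N × Q => Φ p.1 p.2) p ∘L ContinuousLinearMap.inr ℝ N Q) p.2 :=
  h.hasFDerivAt.comp (f := fun q => (p.1, q)) p.2 (hasFDerivAt_prodMk_right p.1 p.2)

theorem hasDerivAt_slice_left {Φ : ℝ → Q → W} {p : ℝ × Q}
    (h : DifferentiableAt ℝ (fun p : ℝ × Q => Φ p.1 p.2) p) :
    HasDerivAt (fun s => Φ s p.2)
      (fderiv ℝ (fun p : ℝ × Q => Φ p.1 p.2) p (1, 0)) p.1 := by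
  have := h.hasFDerivAt.comp_hasDerivAt (f := fun s : ℝ => (s, p.2)) p.1
    ((hasDerivAt_id p.1).prodMk (hasDerivAt_const p.1 p.2))
  exact this

theorem contDiffOn_fderiv_slice {Φ : N → Q → W} (hI : IsOpen I) (hV : IsOpen V)
    (h : ContDiffOn ℝ ∞ (fun p : N × Q => Φ p.1 p.2) (I ×ˢ V)) :
    ContDiffOn ℝ ∞ (fun p : N × Q => fderiv ℝ (Φ p.1) p.2) (I ×ˢ V) := by
  have h1 : ContDiffOn ℝ ∞ (fun p : N × Q => fderiv ℝ (fun p : N × Q => Φ p.1 p.2) p)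
      (I ×ˢ V) := h.fderiv_of_isOpen (hI.prod hV) (by simp)
  refine (h1.clm_comp (contDiffOn_const (c := ContinuousLinearMap.inr ℝ N Q))).congr fun p hp => ?_
  exact (hasFDerivAt_slice_right ((h.contDiffAt ((hI.prod hV).mem_nhds hp)).differentiableAt
    (by simp))).fderiv

theorem contDiffOn_deriv_slice {I : Set ℝ} {Φ : ℝ → Q → W} (hI : IsOpen I) (hV : IsOpen V)
    (h : ContDiffOn ℝ ∞ (fun p : ℝ × Q => Φ p.1 p.2) (I ×ˢ V)) :
    ContDiffOn ℝ ∞ (fun p : ℝ × Q => deriv (fun s => Φ s p.2) p.1) (I ×ˢ V) := by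
  have h1 : ContDiffOn ℝ ∞ (fun p : ℝ × Q => fderiv ℝ (fun p : ℝ × Q => Φ p.1 p.2) p)
      (I ×ˢ V) := h.fderiv_of_isOpen (hI.prod hV) (by simp)
  refine (h1.clm_apply (contDiffOn_const (c := ((1 : ℝ), (0 : Q))))).congr fun p hp => ?_
  exact (hasDerivAt_slice_left ((h.contDiffAt ((hI.prod hV).mem_nhds hp)).differentiableAt
    (by simp))).deriv

/-- Symmetry of second derivatives, for a derivative along the line and a derivative in `Q`. -/
theorem deriv_fderiv_slice_comm {I : Set ℝ} {Φ : ℝ → Q → W} (hI : IsOpen I) (hV : IsOpen V)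
    (h : ContDiffOn ℝ ∞ (fun p : ℝ × Q => Φ p.1 p.2) (I ×ˢ V)) {x : ℝ} {θ : Q} (hx : x ∈ I)
    (hθ : θ ∈ V) :
    deriv (fun s => fderiv ℝ (Φ s) θ) x = fderiv ℝ (fun θ => deriv (fun s => Φ s θ) x) θ := by
  have hO : IsOpen (I ×ˢ V) := hI.prod hV
  let F : ℝ × Q → W := fun p => Φ p.1 p.2
  have hF : ∀ p ∈ I ×ˢ V, DifferentiableAt ℝ F p := fun p hp =>
    (h.contDiffAt (hO.mem_nhds hp)).differentiableAt (by simp)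
  have hp : (x, θ) ∈ I ×ˢ V := ⟨hx, hθ⟩
  have hF2 : DifferentiableAt ℝ (fderiv ℝ F) (x, θ) :=
    ((h.fderiv_of_isOpen (m := ∞) hO (by simp)).contDiffAt (hO.mem_nhds hp)).differentiableAt
      (by simp)
  have hsymm : IsSymmSndFDerivAt ℝ F (x, θ) :=
    (h.contDiffAt (hO.mem_nhds hp)).isSymmSndFDerivAt (by
      rw [minSmoothness_of_isRCLikeNormedField]; exact WithTop.coe_le_coe.2 (le_top : (2 : ℕ∞) ≤ ⊤))
  have h1 : HasDerivAt (fun s => fderiv ℝ (Φ s) θ)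
      ((fderiv ℝ (fderiv ℝ F) (x, θ) (1, 0)) ∘L ContinuousLinearMap.inr ℝ ℝ Q) x := by
    have h2 : HasDerivAt (fun s => fderiv ℝ F (s, θ)) (fderiv ℝ (fderiv ℝ F) (x, θ) (1, 0)) x :=
      hF2.hasFDerivAt.comp_hasDerivAt (f := fun s : ℝ => (s, θ)) x
        ((hasDerivAt_id x).prodMk (hasDerivAt_const x θ))
    have h3 := h2.clm_comp (hasDerivAt_const x (ContinuousLinearMap.inr ℝ ℝ Q))
    simp only [ContinuousLinearMap.comp_zero, add_zero] at h3
    refine h3.congr_of_eventuallyEq ?_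
    filter_upwards [hI.mem_nhds hx] with s hs
    exact (hasFDerivAt_slice_right (hF (s, θ) ⟨hs, hθ⟩)).fderiv
  have h4 : HasFDerivAt (fun θ => deriv (fun s => Φ s θ) x)
      (((fderiv ℝ (fderiv ℝ F) (x, θ)) ∘L ContinuousLinearMap.inr ℝ ℝ Q).flip (1, 0)) θ := by
    have h5 : HasFDerivAt (fun θ => fderiv ℝ F (x, θ))
        (fderiv ℝ (fderiv ℝ F) (x, θ) ∘L ContinuousLinearMap.inr ℝ ℝ Q) θ :=
      hF2.hasFDerivAt.comp (f := fun q => (x, q)) θ (hasFDerivAt_prodMk_right x θ)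
    have h6 := h5.clm_apply (hasFDerivAt_const ((1 : ℝ), (0 : Q)) θ)
    simp only [ContinuousLinearMap.comp_zero, zero_add] at h6
    refine h6.congr_of_eventuallyEq ?_
    filter_upwards [hV.mem_nhds hθ] with q hq
    exact (hasDerivAt_slice_left (hF (x, q) ⟨hx, hq⟩)).deriv
  rw [h1.deriv, h4.fderiv]
  ext v
  simpa using hsymm.eq (1, 0) (0, v)

theorem deriv_isometryEquiv_comp {A B : Type*} [NormedAddCommGroup A] [NormedSpace ℝ A]
    [NormedAddCommGroup B] [NormedSpace ℝ B] (L : A ≃ₗᵢ[ℝ] B) (h : ℝ → A) (x : ℝ) :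
    deriv (fun s => L (h s)) x = L (deriv h x) := by
  have := L.toContinuousLinearEquiv.comp_fderiv (f := h) (x := x)
  rw [← fderiv_apply_one_eq_deriv, ← fderiv_apply_one_eq_deriv]
  exact congrArg (fun T : ℝ →L[ℝ] B => T 1) this

set_option synthInstance.maxHeartbeats 200000 in
theorem contDiffOn_iteratedFDeriv_slice {Φ : N → Q → W} (hI : IsOpen I) (hV : IsOpen V)
    (h : ContDiffOn ℝ ∞ (fun p : N × Q => Φ p.1 p.2) (I ×ˢ V)) (k : ℕ) :
    ContDiffOn ℝ ∞ (fun p : N × Q => iteratedFDeriv ℝ k (Φ p.1) p.2) (I ×ˢ V) := by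
  induction k with
  | zero =>
    simp only [iteratedFDeriv_zero_eq_comp, Function.comp_apply]
    exact (continuousMultilinearCurryFin0 ℝ Q W).symm.toContinuousLinearEquiv.contDiff.comp_contDiffOn
      h
  | succ k ih =>
    simp only [iteratedFDeriv_succ_eq_comp_left, Function.comp_apply]
    exact (continuousMultilinearCurryLeftEquiv ℝ (fun _ : Fin (k + 1) => Q)
      W).symm.toContinuousLinearEquiv.contDiff.comp_contDiffOn
      (contDiffOn_fderiv_slice (Φ := fun i => iteratedFDeriv ℝ k (Φ i)) hI hV ih)

set_option synthInstance.maxHeartbeats 200000 in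
theorem deriv_iteratedFDeriv_slice_comm {I : Set ℝ} {Φ : ℝ → Q → W} (hI : IsOpen I)
    (hV : IsOpen V) (h : ContDiffOn ℝ ∞ (fun p : ℝ × Q => Φ p.1 p.2) (I ×ˢ V)) (k : ℕ) {x : ℝ}
    (hx : x ∈ I) {θ : Q} (hθ : θ ∈ V) :
    deriv (fun s => iteratedFDeriv ℝ k (Φ s) θ) x
      = iteratedFDeriv ℝ k (fun θ => deriv (fun s => Φ s θ) x) θ := by
  induction k generalizing θ with
  | zero =>
    simp only [iteratedFDeriv_zero_eq_comp, Function.comp_apply]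
    have hd := (hasDerivAt_slice_left (p := (x, θ))
      ((h.contDiffAt ((hI.prod hV).mem_nhds ⟨hx, hθ⟩)).differentiableAt
      (by simp))).differentiableAt
    exact ((continuousMultilinearCurryFin0 ℝ Q W).symm.toContinuousLinearEquiv.hasFDerivAt
      (x := Φ x θ)).comp_hasDerivAt x hd.hasDerivAt |>.deriv
  | succ k ih =>
    simp only [iteratedFDeriv_succ_eq_comp_left, Function.comp_apply]
    have hk := contDiffOn_iteratedFDeriv_slice hI hV h k
    have h1 := deriv_isometryEquiv_comp (continuousMultilinearCurryLeftEquiv ℝ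
      (fun _ : Fin (k + 1) => Q) W).symm (fun s => fderiv ℝ (iteratedFDeriv ℝ k (Φ s)) θ) x
    refine h1.trans ?_
    have h2 := deriv_fderiv_slice_comm (Φ := fun i => iteratedFDeriv ℝ k (Φ i)) hI hV hk hx hθ
    have h3 : fderiv ℝ (fun θ => deriv (fun s => iteratedFDeriv ℝ k (Φ s) θ) x) θ
        = fderiv ℝ (iteratedFDeriv ℝ k fun θ => deriv (fun s => Φ s θ) x) θ := by
      refine Filter.EventuallyEq.fderiv_eq ?_
      filter_upwards [hV.mem_nhds hθ] with q hq using ih hq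
    rw [h3] at h2
    exact congrArg _ h2

theorem norm_iteratedDeriv_clm_comp_le (L : Q →L[ℝ] W) {h : ℝ → Q} {x : ℝ}
    (hh : ContDiffAt ℝ ∞ h x) (j : ℕ) :
    ‖iteratedDeriv j (fun s => L (h s)) x‖ ≤ ‖L‖ * ‖iteratedDeriv j h x‖ := by
  rw [← norm_iteratedFDeriv_eq_norm_iteratedDeriv, ← norm_iteratedFDeriv_eq_norm_iteratedDeriv]
  exact L.norm_iteratedFDeriv_comp_left hh (by exact_mod_cast le_top)

theorem iteratedDeriv_congr_of_mem {I : Set ℝ} (hI : IsOpen I) {g h : ℝ → W}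
    (hgh : ∀ s ∈ I, g s = h s) (j : ℕ) {x : ℝ} (hx : x ∈ I) :
    iteratedDeriv j g x = iteratedDeriv j h x := by
  have : g =ᶠ[𝓝 x] h := by filter_upwards [hI.mem_nhds hx] with s hs using hgh s hs
  rw [iteratedDeriv_eq_iteratedFDeriv, iteratedDeriv_eq_iteratedFDeriv,
    (this.iteratedFDeriv ℝ j).eq_of_nhds]

end PartialDerivatives

section Bracket

theorem one_le_bracket (x : ℝ) : 1 ≤ bracket x := by
  unfold bracket
  rw [Real.one_le_sqrt]
  nlinarith [sq_nonneg x]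

theorem bracket_pos (x : ℝ) : 0 < bracket x := one_pos.trans_le (one_le_bracket x)

theorem abs_le_bracket (x : ℝ) : |x| ≤ bracket x := by
  unfold bracket
  exact Real.abs_le_sqrt (by linarith)

theorem bracket_le_one_add_abs (x : ℝ) : bracket x ≤ 1 + |x| := by
  unfold bracket
  rw [Real.sqrt_le_left (by positivity)]
  nlinarith [abs_nonneg x, sq_abs x]

theorem contDiff_bracket : ContDiff ℝ ∞ bracket := by
  unfold bracket
  exact (contDiff_const.add (contDiff_id.pow 2)).sqrt fun x => by positivity

/-- Powers of comparable numbers are comparable. -/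
theorem rpow_le_of_comparable {a b c m : ℝ} (ha : 0 < a) (hb : 0 < b) (hc : 1 ≤ c)
    (h1 : a ≤ c * b) (h2 : b ≤ c * a) : a ^ m ≤ c ^ |m| * b ^ m := by
  have hc0 : 0 < c := by linarith
  rcases le_total 0 m with hm | hm
  · rw [abs_of_nonneg hm, ← Real.mul_rpow hc0.le hb.le]
    exact Real.rpow_le_rpow ha.le h1 hm
  · rw [abs_of_nonpos hm]
    have : a ^ m ≤ (b / c) ^ m :=
      Real.rpow_le_rpow_of_nonpos (by positivity) (by rwa [div_le_iff₀' hc0]) hm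
    rwa [Real.div_rpow hb.le hc0.le, div_eq_inv_mul, ← Real.rpow_neg hc0.le] at this

end Bracket

section Symbol

variable {E : Type*} [NormedAddCommGroup E] [NormedSpace ℝ E] {m M : ℝ} {V : Set E}

/-- The `x`-derivative of a symbol of order `m` is a symbol of order `m - 1`. -/
theorem IsSymbol.deriv_left {f : ℝ → E → ℝ} (hV : IsOpen V) (hf : IsSymbol m M V f) :
    IsSymbol (m - 1) M V (fun x θ => deriv (fun s => f s θ) x) := by
  refine ⟨contDiffOn_deriv_slice isOpen_Ioi hV hf.1, fun K hKV hK j k => ?_⟩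
  obtain ⟨C, hC⟩ := hf.2 K hKV hK (j + 1) k
  refine ⟨C, fun x hx θ hθ => ?_⟩
  rw [iteratedDeriv_congr_of_mem isOpen_Ioi (fun s hs =>
    (deriv_iteratedFDeriv_slice_comm isOpen_Ioi hV hf.1 k hs (hKV hθ)).symm) j hx]
  have := hC x hx θ hθ
  rw [iteratedDeriv_succ'] at this
  convert this using 3
  push_cast
  ring

/-- The derivatives in `θ` of a symbol are symbols of the same order. -/
theorem IsSymbol.fderiv_right {f : ℝ → E → ℝ} (hV : IsOpen V) (hf : IsSymbol m M V f) (v : E) :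
    IsSymbol m M V (fun x θ => fderiv ℝ (f x) θ v) := by
  refine ⟨(contDiffOn_fderiv_slice isOpen_Ioi hV hf.1).clm_apply contDiffOn_const,
    fun K hKV hK j k => ?_⟩
  obtain ⟨C, hC⟩ := hf.2 K hKV hK j (k + 1)
  let L : (E [×(k + 1)]→L[ℝ] ℝ) →L[ℝ] (E [×k]→L[ℝ] ℝ) :=
    (ContinuousLinearMap.compContinuousMultilinearMapL ℝ (fun _ : Fin k => E) (E →L[ℝ] ℝ) ℝ
      (ContinuousLinearMap.apply ℝ ℝ v)) ∘L
      (continuousMultilinearCurryRightEquiv' ℝ k E ℝ).toContinuousLinearEquiv.toContinuousLinearMap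
  refine ⟨‖L‖ * C, fun x hx θ hθ => ?_⟩
  have hk := contDiffOn_iteratedFDeriv_slice isOpen_Ioi hV hf.1 (k + 1)
  rw [iteratedDeriv_congr_of_mem isOpen_Ioi (h := fun s => L (iteratedFDeriv ℝ (k + 1) (f s) θ))
    (fun s hs => ?_) j hx]
  · refine (norm_iteratedDeriv_clm_comp_le L ?_ j).trans ?_
    · exact (hk.contDiffAt ((isOpen_Ioi.prod hV).mem_nhds ⟨hx, hKV hθ⟩)).comp x
        (f := fun s : ℝ => (s, θ)) (contDiff_prodMk_left θ).contDiffAt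
    · rw [mul_assoc]
      exact mul_le_mul_of_nonneg_left (hC x hx θ hθ) (norm_nonneg _)
  · have hs' : ContDiffAt ℝ ∞ (fderiv ℝ (f s)) θ :=
      ((contDiffOn_slice hf.1 hs).contDiffAt (hV.mem_nhds (hKV hθ))).fderiv_right (by simp)
    have h1 := (ContinuousLinearMap.apply ℝ ℝ v).iteratedFDeriv_comp_left hs'
      (i := k) (by exact_mod_cast le_top)
    refine Eq.trans h1 ?_
    simp only [L, iteratedFDeriv_succ_eq_comp_right]
    simp

theorem IsSymbol.mono {W : Type*} [NormedAddCommGroup W] [NormedSpace ℝ W] {f : ℝ → E → W}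
    (hf : IsSymbol m M V f) {m' : ℝ} (h : m ≤ m') : IsSymbol m' M V f := by
  refine ⟨hf.1, fun K hKV hK j k => ?_⟩
  obtain ⟨C, hC⟩ := hf.2 K hKV hK j k
  refine ⟨|C|, fun x hx θ hθ => (hC x hx θ hθ).trans ?_⟩
  have h1 : bracket x ^ (m - j) ≤ bracket x ^ (m' - j) :=
    Real.rpow_le_rpow_of_exponent_le (one_le_bracket x) (by linarith)
  have h0 : 0 ≤ bracket x ^ (m - j) := Real.rpow_nonneg (bracket_pos x).le _
  exact (mul_le_mul_of_nonneg_right (le_abs_self C) h0).trans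
    (mul_le_mul_of_nonneg_left h1 (abs_nonneg C))

/-- A symbol on the line is a symbol independent of `θ`. -/
theorem IsSymbolLine.isSymbol {f : ℝ → ℝ} (hf : IsSymbolLine m M f) :
    IsSymbol m M V (fun x _ => f x) := by
  refine ⟨hf.1.comp contDiff_fst.contDiffOn fun p hp => hp.1, fun K _ _ j k => ?_⟩
  obtain ⟨C, hC⟩ := hf.2 j
  rcases Nat.eq_zero_or_pos k with rfl | hk
  · refine ⟨‖((continuousMultilinearCurryFin0 ℝ E
      ℝ).symm.toContinuousLinearEquiv.toContinuousLinearMap)‖ * C, fun x hx θ _ => ?_⟩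
    simp only [iteratedFDeriv_zero_eq_comp, Function.comp_def]
    refine (norm_iteratedDeriv_clm_comp_le
      ((continuousMultilinearCurryFin0 ℝ E
        ℝ).symm.toContinuousLinearEquiv.toContinuousLinearMap)
      (hf.1.contDiffAt (Ioi_mem_nhds hx)) j).trans ?_
    rw [mul_assoc]
    exact mul_le_mul_of_nonneg_left (hC x hx) (norm_nonneg _)
  · refine ⟨0, fun x _ θ _ => ?_⟩
    simp [iteratedFDeriv_const_of_ne hk.ne']

variable [FiniteDimensional ℝ E]

/-- The derivatives of the dilations `(y, θ) ↦ f (x y, θ)` of a symbol `f` of order `m` are bounded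
by multiples of `x ^ m`, locally uniformly. -/
theorem IsSymbol.exists_iteratedFDeriv_dilation_le (hV : IsOpen V) {x₀ : ℝ} (hx₀ : 1 ≤ x₀)
    (hM : 4 * M ≤ x₀) {U K : Set E} (hU : IsOpen U) (hUK : U ⊆ K) (hK : IsCompact K) (hKV : K ⊆ V)
    (n : ℕ) : ∀ (m : ℝ) (f : ℝ → E → ℝ), IsSymbol m M V f →
    ∃ C : ℝ, ∀ x ∈ Ioi x₀, ∀ q ∈ Ioo (1 / 4 : ℝ) 4 ×ˢ U,
      ‖iteratedFDeriv ℝ n (fun q : ℝ × E => x ^ (-m) * f (x * q.1) q.2) q‖ ≤ C := by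
  have hmem : ∀ x ∈ Ioi x₀, ∀ q ∈ Ioo (1 / 4 : ℝ) 4 ×ˢ U, (x * q.1, q.2) ∈ Ioi M ×ˢ V := by
    intro x hx q hq
    refine ⟨?_, hKV (hUK hq.2)⟩
    have hx1 : x₀ < x := hx
    have := hq.1.1
    simp only [mem_Ioi]
    nlinarith
  induction n with
  | zero =>
    intro m f hf
    obtain ⟨C, hC⟩ := hf.2 K hKV hK 0 0
    -- `x y` and `⟨x y⟩` are comparable to `x`, since `1 / 4 < y < 4` and `⟨x y⟩ ≤ 1 + x y`
    refine ⟨|C| * 8 ^ |m|, fun x hx q hq => ?_⟩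
    have hx1 : 1 < x := hx₀.trans_lt hx
    have hq1 := hq.1.1
    have hq2 := hq.1.2
    have hb := hC (x * q.1) (hmem x hx q hq).1 q.2 (hUK hq.2)
    rw [iteratedDeriv_zero, norm_iteratedFDeriv_zero] at hb
    rw [norm_iteratedFDeriv_zero, norm_mul, Real.norm_of_nonneg (by positivity)]
    simp only [Nat.cast_zero, sub_zero] at hb
    have hpos : 0 < x * q.1 := by nlinarith
    have h1 : bracket (x * q.1) ^ m ≤ 8 ^ |m| * x ^ m := by
      refine rpow_le_of_comparable (bracket_pos _) (by linarith) (by norm_num) ?_ ?_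
      · refine (bracket_le_one_add_abs _).trans ?_
        rw [abs_of_pos hpos]
        nlinarith
      · have := abs_le_bracket (x * q.1)
        rw [abs_of_pos hpos] at this
        nlinarith
    have hx0 : 0 < x := by linarith
    calc x ^ (-m) * ‖f (x * q.1) q.2‖ ≤ x ^ (-m) * (|C| * (8 ^ |m| * x ^ m)) := by
          refine mul_le_mul_of_nonneg_left ?_ (by positivity)
          refine hb.trans ((mul_le_mul_of_nonneg_right (le_abs_self C)
            (Real.rpow_nonneg (bracket_pos _).le _)).trans ?_)
          exact mul_le_mul_of_nonneg_left h1 (abs_nonneg C)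
      _ = |C| * 8 ^ |m| * (x ^ (-m) * x ^ m) := by ring
      _ = |C| * 8 ^ |m| := by rw [← Real.rpow_add hx0]; simp
  | succ n ih =>
    intro m f hf
    let b := Module.finBasis ℝ E
    let β : Fin (Module.finrank ℝ E) → (E →L[ℝ] ℝ) := fun i =>
      LinearMap.toContinuousLinearMap (b.coord i)
    obtain ⟨C₀, hC₀⟩ := ih (m - 1) _ (hf.deriv_left hV)
    choose C hC using fun i => ih m _ (hf.fderiv_right hV (b i))
    -- the derivative is a combination of dilations of symbols: of `∂_x f`, of order `m - 1`, and of
    -- the derivatives of `f` along a basis of `E`, of order `m`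
    let T₀ : ℝ →L[ℝ] ((ℝ × E) →L[ℝ] ℝ) :=
      (ContinuousLinearMap.id ℝ ℝ).smulRight (ContinuousLinearMap.fst ℝ ℝ E)
    let T : Fin (Module.finrank ℝ E) → (ℝ →L[ℝ] ((ℝ × E) →L[ℝ] ℝ)) := fun i =>
      (ContinuousLinearMap.id ℝ ℝ).smulRight (β i ∘L ContinuousLinearMap.snd ℝ ℝ E)
    refine ⟨‖T₀‖ * C₀ + ∑ i, ‖T i‖ * C i, fun x hx q hq => ?_⟩
    have hx0 : 0 < x := by linarith [hx₀.trans_lt hx]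
    let g₀ : ℝ × E → ℝ := fun q => x ^ (-(m - 1)) * deriv (fun s => f s q.2) (x * q.1)
    let g : Fin (Module.finrank ℝ E) → ℝ × E → ℝ := fun i q =>
      x ^ (-m) * fderiv ℝ (f (x * q.1)) q.2 (b i)
    have hO : IsOpen (Ioo (1 / 4 : ℝ) 4 ×ˢ U) := isOpen_Ioo.prod hU
    have hdil : ContDiff ℝ ∞ (fun q : ℝ × E => (x * q.1, q.2)) :=
      (contDiff_const.mul contDiff_fst).prodMk contDiff_snd
    have hsm : ∀ (F : ℝ → E → ℝ), ContDiffOn ℝ ∞ (fun p : ℝ × E => F p.1 p.2) (Ioi M ×ˢ V) →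
        ∀ c : ℝ, ContDiffOn ℝ ∞ (fun q : ℝ × E => c * F (x * q.1) q.2)
          (Ioo (1 / 4 : ℝ) 4 ×ˢ U) := fun F hF c =>
      contDiffOn_const.mul (hF.comp hdil.contDiffOn fun q hq => hmem x hx q hq)
    have hg₀ : ContDiffAt ℝ ∞ g₀ q :=
      (hsm (fun x θ => deriv (fun s => f s θ) x) (hf.deriv_left hV).1 _).contDiffAt (hO.mem_nhds hq)
    have hg : ∀ i, ContDiffAt ℝ ∞ (g i) q := fun i =>
      (hsm (fun x θ => fderiv ℝ (f x) θ (b i)) (hf.fderiv_right hV (b i)).1 _).contDiffAt (hO.mem_nhds hq)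
    have hder : fderiv ℝ (fun q : ℝ × E => x ^ (-m) * f (x * q.1) q.2)
        =ᶠ[𝓝 q] fun q => T₀ (g₀ q) + ∑ i, T i (g i q) := by
      filter_upwards [hO.mem_nhds hq] with y hy
      have hd : DifferentiableAt ℝ (fun p : ℝ × E => f p.1 p.2) (x * y.1, y.2) :=
        (hf.1.contDiffAt ((isOpen_Ioi.prod hV).mem_nhds (hmem x hx y hy))).differentiableAt
          (by simp)
      have hdl : HasFDerivAt (fun q : ℝ × E => (x * q.1, q.2))
          ((x • ContinuousLinearMap.fst ℝ ℝ E).prod (ContinuousLinearMap.snd ℝ ℝ E)) y :=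
        (((ContinuousLinearMap.fst ℝ ℝ E).hasFDerivAt (x := y)).const_mul x).prodMk
          (ContinuousLinearMap.snd ℝ ℝ E).hasFDerivAt
      have h1 := (hd.hasFDerivAt.comp y hdl).const_mul (x ^ (-m))
      refine h1.fderiv.trans ?_
      have hL := hasDerivAt_slice_left hd
      have hR := hasFDerivAt_slice_right hd
      ext v
      · simp only [T₀, T, g₀, g, hL.deriv, hR.fderiv]
        simp only [ContinuousLinearMap.comp_apply, ContinuousLinearMap.inl_apply]
        simp [neg_sub, Real.rpow_sub hx0, Real.rpow_neg hx0.le]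
        rw [show ((x, (0 : E)) : ℝ × E) = x • ((1 : ℝ), (0 : E)) by simp, map_smul, smul_eq_mul]
        field_simp
      · simp only [T₀, T, g₀, g, hL.deriv, hR.fderiv]
        have hv : v = ∑ i, β i v • b i := (b.sum_repr v).symm
        simp only [ContinuousLinearMap.comp_apply, ContinuousLinearMap.inr_apply]
        simp
        conv_lhs => rw [hv]
        have : ((0 : ℝ), ∑ i, β i v • b i) = ∑ i, β i v • ((0 : ℝ), b i) := by
          ext <;> simp [Prod.fst_sum, Prod.snd_sum]
        rw [this, map_sum, Finset.mul_sum]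
        refine Finset.sum_congr rfl fun i _ => ?_
        rw [map_smul, smul_eq_mul]
        ring
    rw [← norm_iteratedFDeriv_fderiv, (hder.iteratedFDeriv ℝ n).eq_of_nhds]
    have hT₀ : ContDiffAt ℝ n (fun q => T₀ (g₀ q)) q :=
      (hg₀.continuousLinearMap_comp T₀).of_le (by exact_mod_cast le_top)
    have hT : ∀ i, ContDiffAt ℝ n (fun q => T i (g i q)) q := fun i =>
      ((hg i).continuousLinearMap_comp (T i)).of_le (by exact_mod_cast le_top)
    change ‖iteratedFDeriv ℝ n ((fun q => T₀ (g₀ q)) + fun q => ∑ i, T i (g i q)) q‖ ≤ _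
    rw [iteratedFDeriv_add_apply hT₀ (ContDiffAt.sum fun i _ => hT i),
      iteratedFDeriv_fun_sum_apply fun i _ => hT i]
    refine (norm_add_le _ _).trans (add_le_add ?_ ((norm_sum_le _ _).trans
      (Finset.sum_le_sum fun i _ => ?_)))
    · refine (T₀.norm_iteratedFDeriv_comp_left hg₀ (by exact_mod_cast le_top)).trans ?_
      exact mul_le_mul_of_nonneg_left (hC₀ x hx q hq) (norm_nonneg _)
    · refine ((T i).norm_iteratedFDeriv_comp_left (hg i) (by exact_mod_cast le_top)).trans ?_
      exact mul_le_mul_of_nonneg_left (hC i x hx q hq) (norm_nonneg _)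

/-- The dilations `(y, θ) ↦ x ^ (-m) f (x y, θ)` of a symbol of order `m` form a bounded family of
smooth functions. -/
theorem IsSymbol.smoothFamily (hV : IsOpen V) {x₀ : ℝ} (hx₀ : 1 ≤ x₀)
    (hM : 4 * M ≤ x₀) {U K : Set E} (hU : IsOpen U) (hUK : U ⊆ K) (hK : IsCompact K) (hKV : K ⊆ V)
    {f : ℝ → E → ℝ} (hf : IsSymbol m M V f) :
    SmoothFamily (Ioi x₀) (Ioo (1 / 4 : ℝ) 4 ×ˢ U)
      (fun x (q : ℝ × E) => x ^ (-m) * f (x * q.1) q.2) := by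
  refine ⟨?_, fun n => hf.exists_iteratedFDeriv_dilation_le hV hx₀ hM hU hUK hK hKV n m⟩
  refine ContDiffOn.mul ?_ ?_
  · refine ContDiffOn.rpow_const_of_ne contDiff_fst.contDiffOn fun p hp => ?_
    have : x₀ < p.1 := hp.1
    linarith
  · refine hf.1.comp (f := fun p : ℝ × ℝ × E => (p.1 * p.2.1, p.2.2)) ?_ fun p hp => ?_
    · exact ((contDiff_fst.mul contDiff_snd.fst).prodMk contDiff_snd.snd).contDiffOn
    · refine ⟨?_, hKV (hUK hp.2.2)⟩
      have h1 : x₀ < p.1 := hp.1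
      have h2 := hp.2.1.1
      simp only [mem_Ioi]
      nlinarith

end Symbol

/-! ### Symbols obtained from tails of integrals -/

section EndWeight

open MeasureTheory

/-- The weight `(r + ⟨t⟩) ^ (-1-τ)`. -/
def endWeight {τ r : ℝ} (hτ : 0 < τ) (hr : 0 ≤ r) : Weight where
  toFun t := (r + bracket t) ^ (-1 - τ)
  continuous := (continuous_const.add contDiff_bracket.continuous).rpow_const fun t => Or.inl
    (add_pos_of_nonneg_of_pos hr (bracket_pos t)).ne'
  nonneg t := by have := bracket_pos t; positivity
  integrable := by
    have h : Integrable (fun t : ℝ => (1 + ‖t‖ ^ 2) ^ (-(1 + τ) / 2)) :=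
      integrable_rpow_neg_one_add_norm_sq (by simpa using hτ)
    refine h.mono' ?_ (Eventually.of_forall fun t => ?_)
    · refine Continuous.aestronglyMeasurable ?_
      exact (continuous_const.add contDiff_bracket.continuous).rpow_const fun t => Or.inl
        (add_pos_of_nonneg_of_pos hr (bracket_pos t)).ne'
    · have h1 := bracket_pos t
      rw [Real.norm_of_nonneg (by positivity)]
      refine (Real.rpow_le_rpow_of_nonpos h1 (by linarith : bracket t ≤ r + bracket t)
        (by linarith)).trans (le_of_eq ?_)
      unfold bracket
      rw [Real.sqrt_eq_rpow, ← Real.rpow_mul (by positivity), Real.norm_eq_abs, sq_abs]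
      congr 1
      ring

theorem endWeight_apply {τ r : ℝ} (hτ : 0 < τ) (hr : 0 ≤ r) (t : ℝ) :
    endWeight hτ hr t = (r + bracket t) ^ (-1 - τ) := rfl

theorem integral_Ioi_add_rpow {τ r t : ℝ} (hτ : 0 < τ) (h : 0 < t + r) :
    ∫ s in Ioi t, (s + r) ^ (-1 - τ) = (t + r) ^ (-τ) / τ := by
  have hint : IntegrableOn (fun s : ℝ => (s + r) ^ (-1 - τ)) (Ioi t) :=
    integrableOn_add_rpow_Ioi_of_lt (by linarith) (by linarith)
  have hder : ∀ s ∈ Ici t, HasDerivAt (fun s => -(s + r) ^ (-τ) / τ) ((s + r) ^ (-1 - τ)) s := by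
    intro s hs
    have hs' : 0 < s + r := by have : t ≤ s := hs; linarith
    have h1 := ((hasDerivAt_id s).add_const r).rpow_const (p := -τ) (Or.inl hs'.ne')
    refine (h1.neg.div_const τ).congr_deriv ?_
    simp only [id_eq, one_mul]
    rw [show -τ - 1 = -1 - τ by ring]
    field_simp
  have hlim : Tendsto (fun s => -(s + r) ^ (-τ) / τ) atTop (𝓝 0) := by
    have h1 : Tendsto (fun s : ℝ => (s + r) ^ (-τ)) atTop (𝓝 0) :=
      (tendsto_rpow_neg_atTop hτ).comp (tendsto_atTop_add_const_right _ r tendsto_id)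
    simpa using (h1.neg.div_const τ)
  rw [integral_Ioi_of_hasDerivAt_of_tendsto' hder hint hlim]
  ring

theorem endWeight_tail_le_add {τ r : ℝ} (hτ : 0 < τ) (hr : 1 ≤ r) {t : ℝ} (ht : 0 ≤ t) :
    ∫ s in Ioi t, endWeight hτ (zero_le_one.trans hr) s ≤ (t + r) ^ (-τ) / τ := by
  rw [← integral_Ioi_add_rpow hτ (by linarith)]
  refine setIntegral_mono_on (endWeight hτ _).integrable.integrableOn
    (integrableOn_add_rpow_Ioi_of_lt (by linarith) (by linarith)) measurableSet_Ioi
    fun s hs => ?_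
  have hs0 : 0 < s := ht.trans_lt hs
  have := abs_le_bracket s
  rw [abs_of_pos hs0] at this
  exact Real.rpow_le_rpow_of_nonpos (by linarith) (by linarith) (by linarith)

theorem endWeight_tail_le {τ r : ℝ} (hτ : 0 < τ) (hr : 1 ≤ r) {t : ℝ} (ht : 0 ≤ t) :
    ∫ s in Ioi t, endWeight hτ (zero_le_one.trans hr) s ≤ bracket t ^ (-τ) / τ := by
  refine (endWeight_tail_le_add hτ hr ht).trans ?_
  have := bracket_le_one_add_abs t
  rw [abs_of_nonneg ht] at this
  gcongr ?_ / _
  exact Real.rpow_le_rpow_of_nonpos (bracket_pos t) (by linarith) (by linarith)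

theorem endWeight_mass_le {τ r : ℝ} (hτ : 0 < τ) (hr : 1 ≤ r) :
    (endWeight hτ (zero_le_one.trans hr)).mass ≤ 2 / τ * r ^ (-τ) := by
  have h1 : (endWeight hτ (zero_le_one.trans hr)).mass
      = 2 * ∫ s in Ioi (0 : ℝ), endWeight hτ (zero_le_one.trans hr) s := by
    rw [← integral_comp_abs]
    refine integral_congr_ae (Eventually.of_forall fun t => ?_)
    simp only [endWeight_apply, bracket, sq_abs]
  have h2 := endWeight_tail_le_add hτ hr le_rfl
  rw [zero_add] at h2
  rw [h1]
  calc _ ≤ 2 * (r ^ (-τ) / τ) := by linarith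
    _ = _ := by ring

end EndWeight

section TailSymbol

open BoundedContinuousFunction

variable {E W : Type*} [NormedAddCommGroup E] [NormedSpace ℝ E]
  [NormedAddCommGroup W] [NormedSpace ℝ W]

theorem contDiffOn_iteratedDeriv_slice {I : Set ℝ} {V : Set E} {Φ : ℝ → E → W} (hI : IsOpen I)
    (hV : IsOpen V) (h : ContDiffOn ℝ ∞ (fun p : ℝ × E => Φ p.1 p.2) (I ×ˢ V)) (j : ℕ) :
    ContDiffOn ℝ ∞ (fun p : ℝ × E => iteratedDeriv j (fun s => Φ s p.2) p.1) (I ×ˢ V) := by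
  induction j with
  | zero => simpa using h
  | succ j ih =>
    simp only [iteratedDeriv_succ]
    exact contDiffOn_deriv_slice (Φ := fun s θ => iteratedDeriv j (fun s => Φ s θ) s) hI hV ih

theorem iteratedDeriv_comp_mul_left (c : ℝ) (f : ℝ → W) (j : ℕ) :
    iteratedDeriv j (fun s => f (c * s)) = fun s => c ^ j • iteratedDeriv j f (c * s) := by
  induction j with
  | zero => simp
  | succ j ih =>
    ext s
    rw [iteratedDeriv_succ, ih, deriv_fun_const_smul_field,
      deriv_comp_mul_left c (iteratedDeriv j f) s, smul_smul, ← iteratedDeriv_succ, pow_succ]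

/-- If `D (y t, θ)` is the tail at `t` of an integral whose integrand depends smoothly, as a bounded
function, on the dilation parameter `y` near `1` and on `θ`, then `D` is a symbol: differentiating
in `y` at `y = 1` amounts to applying `t ∂_t`. -/
theorem isSymbol_of_tail {τ : ℝ} (hτ : 0 < τ) {m : Weight} {C₀ : ℝ}
    (hm : ∀ t : ℝ, 1 ≤ t → ∫ s in Ioi t, m s ≤ C₀ * bracket t ^ (-τ)) {V : Set E} (hV : IsOpen V)
    {D : ℝ → E → W} {ε : ℝ} (hε : 0 < ε)
    (hD : ContDiffOn ℝ ∞ (fun p : ℝ × E => D p.1 p.2) (Ioi (-ε) ×ˢ V))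
    {g : ℝ → E → (ℝ →ᵇ W)} {a b : ℝ} (ha : a < 1) (hb : 1 < b)
    (hg : ContDiffOn ℝ ∞ (fun p : ℝ × E => g p.1 p.2) (Ioo a b ×ˢ V))
    (hDg : ∀ y ∈ Ioo a b, ∀ θ ∈ V, ∀ t : ℝ, 1 ≤ t → D (t * y) θ = m.tail W t (g y θ)) :
    IsSymbol (-τ) 0 V D := by
  refine ⟨hD.mono (prod_mono (Ioi_subset_Ioi (by linarith)) Subset.rfl), fun K hKV hK j k => ?_⟩
  have h1 : (1 : ℝ) ∈ Ioo a b := ⟨ha, hb⟩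
  have hB : ContDiffOn ℝ ∞ (fun p : ℝ × E =>
      iteratedDeriv j (fun s => iteratedFDeriv ℝ k (D s) p.2) p.1) (Ioi (-ε) ×ˢ V) :=
    contDiffOn_iteratedDeriv_slice (Φ := fun s θ => iteratedFDeriv ℝ k (D s) θ) isOpen_Ioi hV
      (contDiffOn_iteratedFDeriv_slice isOpen_Ioi hV hD k) j
  have hG : ContDiffOn ℝ ∞ (fun p : ℝ × E =>
      iteratedDeriv j (fun s => iteratedFDeriv ℝ k (g s) p.2) p.1) (Ioo a b ×ˢ V) :=
    contDiffOn_iteratedDeriv_slice (Φ := fun s θ => iteratedFDeriv ℝ k (g s) θ) isOpen_Ioo hV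
      (contDiffOn_iteratedFDeriv_slice isOpen_Ioo hV hg k) j
  obtain ⟨C₁, hC₁⟩ := (isCompact_Icc.prod hK : IsCompact (Icc (0 : ℝ) 1 ×ˢ K)).exists_bound_of_continuousOn
    (hB.continuousOn.mono (prod_mono (fun t ht => (by linarith [ht.1] : -ε < t)) hKV))
  obtain ⟨C₂, hC₂⟩ := (isCompact_singleton.prod hK : IsCompact ({(1 : ℝ)} ×ˢ K)).exists_bound_of_continuousOn
    (hG.continuousOn.mono (prod_mono (singleton_subset_iff.2 h1) hKV))
  refine ⟨max (|C₁| * 2 ^ (τ + j)) (C₀ * |C₂| * 2 ^ j), fun t ht θ hθ => ?_⟩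
  have ht0 : 0 < t := ht
  have hbr := bracket_pos t
  have hbr2 := bracket_le_one_add_abs t
  rw [abs_of_pos ht0] at hbr2
  have hbp : 0 ≤ bracket t ^ (-τ - j) := by positivity
  -- for `t ≤ 1` the derivatives are bounded by compactness
  rcases le_total t 1 with ht1 | ht1
  · refine le_trans ?_ (mul_le_mul_of_nonneg_right (le_max_left _ _) hbp)
    refine (hC₁ (t, θ) ⟨⟨ht0.le, ht1⟩, hθ⟩).trans ((le_abs_self _).trans ?_)
    rw [mul_assoc]
    refine le_mul_of_one_le_right (abs_nonneg _) ?_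
    rw [show -τ - (j : ℝ) = -(τ + j) by ring, Real.rpow_neg hbr.le, ← div_eq_mul_inv,
      one_le_div (by positivity)]
    exact Real.rpow_le_rpow hbr.le (by linarith) (by positivity)
  · refine le_trans ?_ (mul_le_mul_of_nonneg_right (le_max_right _ _) hbp)
    -- the `j`-th derivative in the dilation parameter, at `1`, is `t ^ j` times the one in `t`
    have hmix : iteratedDeriv j (fun s => iteratedFDeriv ℝ k (D (t * s)) θ) 1
        = t ^ j • iteratedDeriv j (fun s => iteratedFDeriv ℝ k (D s) θ) t := by
      rw [iteratedDeriv_comp_mul_left t (fun s => iteratedFDeriv ℝ k (D s) θ) j]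
      simp only [mul_one]
    let L : (E [×k]→L[ℝ] (ℝ →ᵇ W)) →L[ℝ] (E [×k]→L[ℝ] W) :=
      ContinuousLinearMap.compContinuousMultilinearMapL ℝ (fun _ : Fin k => E) (ℝ →ᵇ W) W
        (m.tail W t)
    have hL : ‖L‖ ≤ C₀ * bracket t ^ (-τ) := by
      refine (ContinuousLinearMap.opNorm_le_bound _ (norm_nonneg _) fun A =>
        (m.tail W t).norm_compContinuousMultilinearMap_le A).trans ?_
      exact (m.norm_tail_le t).trans (hm t ht1)
    have hmix2 : iteratedDeriv j (fun s => iteratedFDeriv ℝ k (D (t * s)) θ) 1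
        = iteratedDeriv j (fun s => L (iteratedFDeriv ℝ k (g s) θ)) 1 := by
      refine iteratedDeriv_congr_of_mem isOpen_Ioo (fun s hs => ?_) j h1
      have heq : D (t * s) =ᶠ[𝓝 θ] m.tail W t ∘ g s := by
        filter_upwards [hV.mem_nhds (hKV hθ)] with q hq using hDg s hs q hq t ht1
      rw [(heq.iteratedFDeriv ℝ k).eq_of_nhds]
      exact (m.tail W t).iteratedFDeriv_comp_left
        ((contDiffOn_slice hg hs).contDiffAt (hV.mem_nhds (hKV hθ))) (by exact_mod_cast le_top)
    have hsm : ContDiffAt ℝ ∞ (fun s => iteratedFDeriv ℝ k (g s) θ) 1 :=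
      ((contDiffOn_iteratedFDeriv_slice isOpen_Ioo hV hg k).contDiffAt
        ((isOpen_Ioo.prod hV).mem_nhds ⟨h1, hKV hθ⟩)).comp 1
        (f := fun s : ℝ => (s, θ)) (contDiff_prodMk_left θ).contDiffAt
    have hbound : t ^ j * ‖iteratedDeriv j (fun s => iteratedFDeriv ℝ k (D s) θ) t‖
        ≤ C₀ * bracket t ^ (-τ) * |C₂| := by
      have h2 := norm_iteratedDeriv_clm_comp_le L hsm j
      rw [← hmix2, hmix, norm_smul, norm_pow, Real.norm_of_nonneg ht0.le] at h2
      refine h2.trans (mul_le_mul hL ((hC₂ (1, θ) ⟨rfl, hθ⟩).trans (le_abs_self _))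
        (norm_nonneg _) ((norm_nonneg L).trans hL))
    have htj : bracket t ^ j ≤ 2 ^ j * t ^ j := by
      rw [← mul_pow]
      exact pow_le_pow_left₀ hbr.le (by linarith) j
    have hx : 0 ≤ ‖iteratedDeriv j (fun s => iteratedFDeriv ℝ k (D s) θ) t‖ := norm_nonneg _
    have : bracket t ^ j * ‖iteratedDeriv j (fun s => iteratedFDeriv ℝ k (D s) θ) t‖
        ≤ C₀ * |C₂| * 2 ^ j * bracket t ^ (-τ) := by
      calc _ ≤ 2 ^ j * t ^ j * ‖iteratedDeriv j (fun s => iteratedFDeriv ℝ k (D s) θ) t‖ :=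
            mul_le_mul_of_nonneg_right htj hx
        _ = 2 ^ j * (t ^ j * ‖iteratedDeriv j (fun s => iteratedFDeriv ℝ k (D s) θ) t‖) := by ring
        _ ≤ 2 ^ j * (C₀ * bracket t ^ (-τ) * |C₂|) := by gcongr
        _ = _ := by ring
    rw [Real.rpow_sub hbr, Real.rpow_natCast, ← mul_div_assoc, le_div_iff₀ (by positivity)]
    linarith

end TailSymbol

/-! ### Riemannian metrics in a parametrization -/

/-! Instance search in nested spaces of continuous linear maps is slow without these shortcuts. -/

section ShortcutInstances

variable {F : Type*} [NormedAddCommGroup F] [NormedSpace ℝ F]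

instance realSMulCommClass : SMulCommClass ℝ ℝ ℝ := Algebra.to_smulCommClass

instance dualNormedAddCommGroup : NormedAddCommGroup (F →L[ℝ] ℝ) :=
  ContinuousLinearMap.toNormedAddCommGroup

instance dualNormedSpace : NormedSpace ℝ (F →L[ℝ] ℝ) := ContinuousLinearMap.toNormedSpace

instance bilinNormedAddCommGroup : NormedAddCommGroup (F →L[ℝ] F →L[ℝ] ℝ) :=
  ContinuousLinearMap.toNormedAddCommGroup

instance bilinNormedSpace : NormedSpace ℝ (F →L[ℝ] F →L[ℝ] ℝ) := ContinuousLinearMap.toNormedSpace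

end ShortcutInstances

section PullbackMetric

variable {F H X : Type*} [NormedAddCommGroup F] [NormedSpace ℝ F] [TopologicalSpace H]
  {I : ModelWithCorners ℝ F H} [TopologicalSpace X] [ChartedSpace H X] [IsManifold I ∞ X]

/-- The scalar product of the metric `G` at `p`, as a form on the model space. -/
def metricForm (G : SmoothMetric I X) (p : X) : F →L[ℝ] F →L[ℝ] ℝ := G.inner p

theorem metricForm_symm (G : SmoothMetric I X) (p : X) (u v : F) :
    metricForm G p u v = metricForm G p v u := G.symm p u v

theorem metricForm_pos (G : SmoothMetric I X) (p : X) {v : F} (hv : v ≠ 0) :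
    0 < metricForm G p v v := G.pos p v hv

/-- The derivative of `ψ : F → X`, as an endomorphism of the model space. -/
def mfderivModel (I : ModelWithCorners ℝ F H) (ψ : F → X) (z : F) : F →L[ℝ] F :=
  mfderiv 𝓘(ℝ, F) I ψ z

/-- The pullback of the metric `G` by a map `ψ` from a vector space into the manifold. -/
def pullbackMetric (G : SmoothMetric I X) (ψ : F → X) (z : F) : F →L[ℝ] F →L[ℝ] ℝ :=
  (metricForm G (ψ z)).bilinearComp (mfderivModel I ψ z) (mfderivModel I ψ z)

theorem metricInChart_eq (G : SmoothMetric I X) (q : X) (z u v : F) :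
    metricInChart G q z u v = pullbackMetric G (extChartAt I q).symm z u v := rfl

theorem pullbackMetric_symm (G : SmoothMetric I X) (ψ : F → X) (z u v : F) :
    pullbackMetric G ψ z u v = pullbackMetric G ψ z v u :=
  metricForm_symm G (ψ z) _ _

theorem pullbackMetric_pos (G : SmoothMetric I X) {ψ : F → X} {z : F}
    (h : Function.Injective (mfderivModel I ψ z)) {v : F} (hv : v ≠ 0) :
    0 < pullbackMetric G ψ z v v :=
  metricForm_pos G (ψ z) fun h0 => hv (h (h0.trans (map_zero _).symm))

theorem contMDiffOn_mfderiv_apply {ψ : F → X} {U : Set F} (hU : IsOpen U)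
    (hψ : ContMDiffOn 𝓘(ℝ, F) I ∞ ψ U) (u : F) :
    ContMDiffOn 𝓘(ℝ, F) I.tangent ∞
      (fun z => (⟨ψ z, mfderiv 𝓘(ℝ, F) I ψ z u⟩ : TangentBundle I X)) U := by
  have h1 := hψ.contMDiffOn_tangentMapWithin (m := ∞) (by simp) hU.uniqueMDiffOn
  have h2 : ContMDiffOn 𝓘(ℝ, F) 𝓘(ℝ, F).tangent ∞
      (fun z => (⟨z, u⟩ : TangentBundle 𝓘(ℝ, F) F)) U :=
    (contMDiff_vectorSpace_iff_contDiff (V := fun _ => u)).2 contDiff_const |>.contMDiffOn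
  refine (h1.comp h2 fun z hz => hz).congr fun z hz => ?_
  simp only [Function.comp_apply, tangentMapWithin]
  rw [mfderivWithin_of_isOpen hU hz]

theorem contDiffOn_pullbackMetric [FiniteDimensional ℝ F] (G : SmoothMetric I X) {ψ : F → X}
    {U : Set F} (hU : IsOpen U) (hψ : ContMDiffOn 𝓘(ℝ, F) I ∞ ψ U) :
    ContDiffOn ℝ ∞ (pullbackMetric G ψ) U := by
  refine contDiffOn_clm_apply.2 fun u => contDiffOn_clm_apply.2 fun v => ?_
  rw [← contMDiffOn_iff_contDiffOn]
  intro z hz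
  have : ContMDiffWithinAt 𝓘(ℝ, F) (I.prod 𝓘(ℝ, ℝ)) ∞
      (fun z ↦ Bundle.TotalSpace.mk' ℝ (E := Bundle.Trivial X ℝ) (ψ z)
        (G.inner (ψ z) (mfderiv 𝓘(ℝ, F) I ψ z u) (mfderiv 𝓘(ℝ, F) I ψ z v))) U z := by
    apply ContMDiffWithinAt.clm_bundle_apply₂ (F₁ := F) (F₂ := F)
      (E₁ := fun p : X => TangentSpace I p) (E₂ := fun p : X => TangentSpace I p)
    · exact ContMDiffAt.comp_contMDiffWithinAt z G.contMDiff.contMDiffAt (hψ z hz)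
    · exact contMDiffOn_mfderiv_apply hU hψ u z hz
    · exact contMDiffOn_mfderiv_apply hU hψ v z hz
  simp only [Bundle.contMDiffWithinAt_totalSpace] at this
  exact this.2

end PullbackMetric

section EulerLagrange

variable {F : Type*} [NormedAddCommGroup F] [NormedSpace ℝ F]

/-- The Euler–Lagrange expression of the energy functional of the metric `M` along the curve `c`,
paired with the vector `y`: `M(c'', y) + D_{c'} M(c', y) - D_y M(c', c') / 2`. -/
def eulerLagrange (M : F → F →L[ℝ] F →L[ℝ] ℝ) (c : ℝ → F) (t : ℝ) (y : F) : ℝ :=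
  M (c t) (deriv (deriv c) t) y + fderiv ℝ M (c t) (deriv c t) (deriv c t) y
    - fderiv ℝ M (c t) y (deriv c t) (deriv c t) / 2

theorem eulerLagrange_congr {M₁ M₂ : F → F →L[ℝ] F →L[ℝ] ℝ} {c₁ c₂ : ℝ → F} {t : ℝ}
    (hM : M₁ =ᶠ[𝓝 (c₁ t)] M₂) (hc : c₁ =ᶠ[𝓝 t] c₂) (y : F) :
    eulerLagrange M₁ c₁ t y = eulerLagrange M₂ c₂ t y := by
  simp only [eulerLagrange, hc.deriv.deriv_eq, hc.deriv_eq]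
  rw [← hc.eq_of_nhds, hM.fderiv_eq, hM.eq_of_nhds]

theorem eulerLagrange_add (M : F → F →L[ℝ] F →L[ℝ] ℝ) (c : ℝ → F) (t : ℝ) (y y' : F) :
    eulerLagrange M c t (y + y') = eulerLagrange M c t y + eulerLagrange M c t y' := by
  simp only [eulerLagrange, map_add, add_apply]; ring

theorem eulerLagrange_smul (M : F → F →L[ℝ] F →L[ℝ] ℝ) (c : ℝ → F) (t a : ℝ) (y : F) :
    eulerLagrange M c t (a • y) = a * eulerLagrange M c t y := by
  simp only [eulerLagrange, map_smul, smul_apply, smul_eq_mul]; ring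

theorem eulerLagrange_comp_mul_left (M : F → F →L[ℝ] F →L[ℝ] ℝ) (c : ℝ → F) (a t : ℝ) (y : F) :
    eulerLagrange M (fun s => c (a * s)) t y = a ^ 2 * eulerLagrange M c (a * t) y := by
  have h1 : deriv (fun s => c (a * s)) = fun s => a • deriv c (a * s) :=
    funext fun s => deriv_comp_mul_left a c s
  have h2 : deriv (fun s => a • deriv c (a * s)) t = a • a • deriv (deriv c) (a * t) := by
    rw [deriv_fun_const_smul_field, deriv_comp_mul_left]
  simp only [eulerLagrange, h1, h2, map_smul, smul_apply, smul_eq_mul]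
  ring

theorem fderiv_bilinearComp_apply {M : F → F →L[ℝ] F →L[ℝ] ℝ} {κ : F → F} {z : F}
    (hM : DifferentiableAt ℝ M (κ z)) (hκ : ContDiffAt ℝ 2 κ z) (h u v : F) :
    fderiv ℝ (fun z => (M (κ z)).bilinearComp (fderiv ℝ κ z) (fderiv ℝ κ z)) z h u v =
      fderiv ℝ M (κ z) (fderiv ℝ κ z h) (fderiv ℝ κ z u) (fderiv ℝ κ z v)
      + M (κ z) (fderiv ℝ (fderiv ℝ κ) z h u) (fderiv ℝ κ z v)
      + M (κ z) (fderiv ℝ κ z u) (fderiv ℝ (fderiv ℝ κ) z h v) := by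
  have hk1 : HasFDerivAt κ (fderiv ℝ κ z) z :=
    (hκ.differentiableAt (by simp)).hasFDerivAt
  have hk2 : HasFDerivAt (fderiv ℝ κ) (fderiv ℝ (fderiv ℝ κ) z) z :=
    ((hκ.fderiv_right (m := 1) (by norm_num)).differentiableAt (by simp)).hasFDerivAt
  have hM1 : HasFDerivAt (fun z => M (κ z)) ((fderiv ℝ M (κ z)).comp (fderiv ℝ κ z)) z :=
    hM.hasFDerivAt.comp z hk1
  -- the bilinear form is differentiable, and its derivative is computed on fixed vectors
  have hD : DifferentiableAt ℝ
      (fun z => (M (κ z)).bilinearComp (fderiv ℝ κ z) (fderiv ℝ κ z)) z := by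
    have e : (fun z => (M (κ z)).bilinearComp (fderiv ℝ κ z) (fderiv ℝ κ z)) =
        fun z => ((ContinuousLinearMap.compL ℝ F F ℝ).flip (fderiv ℝ κ z)).comp
          ((M (κ z)).comp (fderiv ℝ κ z)) := by
      ext z u v; rfl
    rw [e]
    have h3 : DifferentiableAt ℝ (fun z => (ContinuousLinearMap.compL ℝ F F ℝ).flip
        (fderiv ℝ κ z)) z :=
      (ContinuousLinearMap.differentiableAt _).comp z hk2.differentiableAt
    exact h3.clm_comp (hM1.differentiableAt.clm_comp hk2.differentiableAt)
  have e1 := (hD.hasFDerivAt.clm_apply (hasFDerivAt_const u z)).clm_apply (hasFDerivAt_const v z)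
  have e2 := (hM1.clm_apply (hk2.clm_apply (hasFDerivAt_const u z))).clm_apply
    (hk2.clm_apply (hasFDerivAt_const v z))
  have e3 := congrArg (fun L : F →L[ℝ] ℝ => L h) (e1.unique e2)
  simp at e3
  rw [e3]; ring

/-- The Euler–Lagrange expression is invariant under a change of coordinates `κ`. -/
theorem eulerLagrange_bilinearComp {M : F → F →L[ℝ] F →L[ℝ] ℝ} {κ : F → F} {c : ℝ → F} {t : ℝ}
    (hM : DifferentiableAt ℝ M (κ (c t))) (hsymm : ∀ u v, M (κ (c t)) u v = M (κ (c t)) v u)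
    (hκ : ContDiffAt ℝ 2 κ (c t)) (hc : ContDiffAt ℝ 2 c t) (y : F) :
    eulerLagrange (fun z => (M (κ z)).bilinearComp (fderiv ℝ κ z) (fderiv ℝ κ z)) c t y =
      eulerLagrange M (fun s => κ (c s)) t (fderiv ℝ κ (c t) y) := by
  have hc1 : ∀ᶠ s in 𝓝 t, ContDiffAt ℝ 2 c s := hc.eventually (by simp)
  have hk1 : ∀ᶠ s in 𝓝 t, ContDiffAt ℝ 2 κ (c s) :=
    hc.continuousAt.eventually (hκ.eventually (by simp))
  have hd : deriv (fun s => κ (c s)) =ᶠ[𝓝 t] fun s => fderiv ℝ κ (c s) (deriv c s) := by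
    filter_upwards [hc1, hk1] with s h1 h2
    exact ((h2.differentiableAt (by simp)).hasFDerivAt.comp_hasDerivAt s
      (h1.differentiableAt (by simp)).hasDerivAt).deriv
  have hdc : HasDerivAt c (deriv c t) t := (hc.differentiableAt (by simp)).hasDerivAt
  have hddc : HasDerivAt (deriv c) (deriv (deriv c) t) t := by
    have h1 : ContDiffAt ℝ 1 (fderiv ℝ c) t := hc.fderiv_right (by norm_num)
    have h2 : DifferentiableAt ℝ (fun s => fderiv ℝ c s 1) t :=
      (h1.differentiableAt (by simp)).clm_apply (differentiableAt_const _)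
    exact h2.hasDerivAt
  have hk2 : HasFDerivAt (fderiv ℝ κ) (fderiv ℝ (fderiv ℝ κ) (c t)) (c t) :=
    ((hκ.fderiv_right (m := 1) (by norm_num)).differentiableAt (by simp)).hasFDerivAt
  have hdd : deriv (deriv fun s => κ (c s)) t =
      fderiv ℝ (fderiv ℝ κ) (c t) (deriv c t) (deriv c t)
        + fderiv ℝ κ (c t) (deriv (deriv c) t) := by
    rw [hd.deriv_eq]
    exact ((hk2.comp_hasDerivAt t hdc).clm_apply hddc).deriv
  have hs : IsSymmSndFDerivAt ℝ κ (c t) :=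
    hκ.isSymmSndFDerivAt (by rw [minSmoothness_of_isRCLikeNormedField])
  simp only [eulerLagrange, hdd, hd.eq_of_nhds, fderiv_bilinearComp_apply hM hκ]
  have e1 := hs.eq (deriv c t) y
  have e2 := hsymm (fderiv ℝ (fderiv ℝ κ) (c t) y (deriv c t)) (fderiv ℝ κ (c t) (deriv c t))
  simp only [ContinuousLinearMap.bilinearComp_apply, map_add, add_apply, e1, e2]
  ring

end EulerLagrange

/-! ### Geodesics read in a parametrization, and the exponential map -/

section ReadingGeodesics

variable {F H X : Type*} [NormedAddCommGroup F] [NormedSpace ℝ F]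
  [TopologicalSpace H] {I : ModelWithCorners ℝ F H} [TopologicalSpace X]
  [ChartedSpace H X] [IsManifold I ∞ X]

theorem contMDiffOn_extChartAt_symm_target (q : X) :
    ContMDiffOn 𝓘(ℝ, F) I ∞ (extChartAt I q).symm (extChartAt I q).target :=
  contMDiffOn_extChartAt_symm q

variable [I.Boundaryless]

theorem injective_mfderivModel_extChartAt_symm {q : X} {z : F}
    (hz : z ∈ (extChartAt I q).target) :
    Function.Injective (mfderivModel I (extChartAt I q).symm z) := by
  have h := (isInvertible_mfderivWithin_extChartAt_symm (I := I) hz).injective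
  rw [I.range_eq_univ, mfderivWithin_univ] at h
  exact h

/-- The change of coordinates between a parametrization and a preferred chart pulls one local
expression of the metric back to the other. -/
theorem pullbackMetric_eventuallyEq (G : SmoothMetric I X) {ψ : F → X} {U : Set F} (hU : IsOpen U)
    (hψ : ContMDiffOn 𝓘(ℝ, F) I ∞ ψ U) {z₀ : F} (hz₀ : z₀ ∈ U) {q : X}
    (hq : ψ z₀ ∈ (chartAt H q).source) :
    ContDiffAt ℝ ∞ (fun z => extChartAt I q (ψ z)) z₀ ∧
    (∀ᶠ z in 𝓝 z₀, mfderivModel I ψ z = (mfderivModel I (extChartAt I q).symm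
      (extChartAt I q (ψ z))).comp (fderiv ℝ (fun z => extChartAt I q (ψ z)) z)) ∧
    pullbackMetric G ψ =ᶠ[𝓝 z₀] fun z =>
      (pullbackMetric G (extChartAt I q).symm (extChartAt I q (ψ z))).bilinearComp
        (fderiv ℝ (fun z => extChartAt I q (ψ z)) z)
        (fderiv ℝ (fun z => extChartAt I q (ψ z)) z) := by
  have hψ₀ : ContMDiffAt 𝓘(ℝ, F) I ∞ ψ z₀ := hψ.contMDiffAt (hU.mem_nhds hz₀)
  have hκ {z : F} (hz : z ∈ U) (hs : ψ z ∈ (chartAt H q).source) :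
      ContDiffAt ℝ ∞ (fun z => extChartAt I q (ψ z)) z := by
    rw [← contMDiffAt_iff_contDiffAt]
    exact (contMDiffAt_extChartAt' hs).comp z (hψ.contMDiffAt (hU.mem_nhds hz))
  have hev : ∀ᶠ z in 𝓝 z₀, z ∈ U ∧ ψ z ∈ (chartAt H q).source :=
    (hU.eventually_mem hz₀).and (hψ₀.continuousAt.eventually ((chartAt H q).open_source.mem_nhds hq))
  have hcomp : ∀ᶠ z in 𝓝 z₀, mfderivModel I ψ z = (mfderivModel I (extChartAt I q).symm
      (extChartAt I q (ψ z))).comp (fderiv ℝ (fun z => extChartAt I q (ψ z)) z) := by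
    filter_upwards [hev.eventually_nhds] with z hz
    have hz' := hz.self_of_nhds
    have he : ψ =ᶠ[𝓝 z] (extChartAt I q).symm ∘ fun z => extChartAt I q (ψ z) := by
      filter_upwards [hz] with z' h'
      exact ((extChartAt I q).left_inv (by rw [extChartAt_source]; exact h'.2)).symm
    have ht : extChartAt I q (ψ z) ∈ (extChartAt I q).target :=
      (extChartAt I q).map_source (by rw [extChartAt_source]; exact hz'.2)
    have h1 : MDifferentiableAt 𝓘(ℝ, F) I (extChartAt I q).symm (extChartAt I q (ψ z)) :=
      ((contMDiffOn_extChartAt_symm_target q).contMDiffAt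
        ((isOpen_extChartAt_target q).mem_nhds ht)).mdifferentiableAt (by simp)
    have h2 : MDifferentiableAt 𝓘(ℝ, F) 𝓘(ℝ, F) (fun z => extChartAt I q (ψ z)) z :=
      ((hκ hz'.1 hz'.2).differentiableAt (by simp)).mdifferentiableAt
    have h3 := mfderiv_comp z h1 h2
    rw [← he.mfderiv_eq, mfderiv_eq_fderiv] at h3
    exact h3
  refine ⟨hκ hz₀ hq, hcomp, ?_⟩
  filter_upwards [hcomp, hev] with z h1 h2
  have h4 : (extChartAt I q).symm (extChartAt I q (ψ z)) = ψ z :=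
    (extChartAt I q).left_inv (by rw [extChartAt_source]; exact h2.2)
  ext u v
  simp only [pullbackMetric, h1, ContinuousLinearMap.bilinearComp_apply, h4,
    ContinuousLinearMap.comp_apply]

variable [FiniteDimensional ℝ F]

theorem contDiffOn_metricInChart (G : SmoothMetric I X) (q : X) :
    ContDiffOn ℝ ∞ (pullbackMetric G (extChartAt I q).symm) (extChartAt I q).target :=
  contDiffOn_pullbackMetric G (isOpen_extChartAt_target q) (contMDiffOn_extChartAt_symm q)

/-- The geodesic equation, expressed by the Christoffel symbols of the preferred chart, is the
Euler–Lagrange equation of the metric in that chart. -/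
theorem isGeodesicAt_iff (G : SmoothMetric I X) (γ : ℝ → X) (t : ℝ) :
    IsGeodesicAt G γ t ↔ ContMDiffAt 𝓘(ℝ, ℝ) I 2 γ t ∧ ∀ y : F,
      eulerLagrange (pullbackMetric G (extChartAt I (γ t)).symm)
        (fun s => extChartAt I (γ t) (γ s)) t y = 0 := by
  refine and_congr_right fun _ => forall_congr' fun y => ?_
  have hM := ((contDiffOn_metricInChart G (γ t)).contDiffAt
    ((isOpen_extChartAt_target (γ t)).mem_nhds (mem_extChartAt_target (γ t)))).differentiableAt
      (by simp)
  have key (u v h : F) : fderiv ℝ (fun z' => metricInChart G (γ t) z' u v)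
      (extChartAt I (γ t) (γ t)) h =
      fderiv ℝ (pullbackMetric G (extChartAt I (γ t)).symm) (extChartAt I (γ t) (γ t)) h u v := by
    have := ((hM.hasFDerivAt.clm_apply (hasFDerivAt_const u _)).clm_apply
      (hasFDerivAt_const v _)).fderiv
    have := congrArg (fun L : F →L[ℝ] ℝ => L h) this
    simp at this
    exact this
  simp only [christoffel, eulerLagrange]
  rw [key, key, metricInChart_eq]
  constructor <;> intro h <;> linarith

/-- A curve `ψ ∘ c` is a geodesic exactly if `c` solves the Euler–Lagrange equation of the pulled
back metric, whenever `ψ` is an immersion. -/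
theorem isGeodesicAt_iff_pullback (G : SmoothMetric I X) {ψ : F → X} {U : Set F} (hU : IsOpen U)
    (hψ : ContMDiffOn 𝓘(ℝ, F) I ∞ ψ U) {c : ℝ → F} {t : ℝ} (ht : c t ∈ U)
    (hinj : Function.Injective (mfderivModel I ψ (c t))) (hc : ContDiffAt ℝ 2 c t) {γ : ℝ → X}
    (hγ : γ =ᶠ[𝓝 t] fun s => ψ (c s)) :
    IsGeodesicAt G γ t ↔ ∀ y : F, eulerLagrange (pullbackMetric G ψ) c t y = 0 := by
  have hγt := hγ.eq_of_nhds
  set q := γ t with hq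
  have hqs : ψ (c t) ∈ (chartAt H q).source := by rw [← hγt]; exact mem_chart_source H q
  obtain ⟨hκ, hcomp, hpull⟩ := pullbackMetric_eventuallyEq G hU hψ ht hqs
  have htgt : extChartAt I q (ψ (c t)) ∈ (extChartAt I q).target :=
    (extChartAt I q).map_source (by rw [extChartAt_source]; exact hqs)
  have hM := ((contDiffOn_metricInChart G q).contDiffAt
    ((isOpen_extChartAt_target q).mem_nhds htgt)).differentiableAt (by simp)
  have hγ2 : ContMDiffAt 𝓘(ℝ, ℝ) I 2 γ t := by
    have h1 : ContMDiffAt 𝓘(ℝ, F) I 2 ψ (c t) :=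
      (hψ.contMDiffAt (hU.mem_nhds ht)).of_le (WithTop.coe_le_coe.2 (le_top : (2 : ℕ∞) ≤ ⊤))
    exact (h1.comp t hc.contMDiffAt).congr_of_eventuallyEq hγ
  have hEL (y : F) : eulerLagrange (pullbackMetric G ψ) c t y =
      eulerLagrange (pullbackMetric G (extChartAt I q).symm) (fun s => extChartAt I q (γ s)) t
        (fderiv ℝ (fun z => extChartAt I q (ψ z)) (c t) y) := by
    rw [eulerLagrange_congr hpull (EventuallyEq.refl _ c) y,
      eulerLagrange_bilinearComp (κ := fun z => extChartAt I q (ψ z)) hM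
        (pullbackMetric_symm G _ _) (hκ.of_le
          (WithTop.coe_le_coe.2 (le_top : (2 : ℕ∞) ≤ ⊤))) hc]
    refine eulerLagrange_congr (EventuallyEq.refl _ _) ?_ _
    filter_upwards [hγ] with s hs
    rw [hs]
  have hsurj : Function.Surjective (fderiv ℝ (fun z => extChartAt I q (ψ z)) (c t)) := by
    have h1 := hcomp.self_of_nhds
    rw [h1] at hinj
    have h2 : Function.Injective (fderiv ℝ (fun z => extChartAt I q (ψ z)) (c t)) :=
      Function.Injective.of_comp hinj
    exact (LinearMap.injective_iff_surjective
      (f := (fderiv ℝ (fun z => extChartAt I q (ψ z)) (c t)).toLinearMap)).1 h2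
  rw [isGeodesicAt_iff]
  constructor
  · intro h y
    rw [hEL]
    exact h.2 _
  · intro h
    refine ⟨hγ2, fun y => ?_⟩
    obtain ⟨y', rfl⟩ := hsurj y
    rw [← hq, ← hEL]
    exact h y'

/-- The coordinates of a geodesic in a preferred chart solve the Euler–Lagrange equation. -/
theorem IsGeodesicAt.eulerLagrange_extChartAt {G : SmoothMetric I X} {γ : ℝ → X} {t : ℝ}
    (h : IsGeodesicAt G γ t) {q : X} (hq : γ t ∈ (chartAt H q).source) :
    ContDiffAt ℝ 2 (fun s => extChartAt I q (γ s)) t ∧ ∀ y : F,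
      eulerLagrange (pullbackMetric G (extChartAt I q).symm)
        (fun s => extChartAt I q (γ s)) t y = 0 := by
  have h2 : ContDiffAt ℝ 2 (fun s => extChartAt I q (γ s)) t := by
    rw [← contMDiffAt_iff_contDiffAt]
    exact ((contMDiffAt_extChartAt' (n := ∞) hq).of_le
      (WithTop.coe_le_coe.2 (le_top : (2 : ℕ∞) ≤ ⊤))).comp t h.1
  have htgt : extChartAt I q (γ t) ∈ (extChartAt I q).target :=
    (extChartAt I q).map_source (by rw [extChartAt_source]; exact hq)
  refine ⟨h2, (isGeodesicAt_iff_pullback G (isOpen_extChartAt_target q)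
    (contMDiffOn_extChartAt_symm_target q) (c := fun s => extChartAt I q (γ s)) htgt
    (injective_mfderivModel_extChartAt_symm htgt) h2 ?_).1 h⟩
  filter_upwards [h.1.continuousAt.eventually ((chartAt H q).open_source.mem_nhds hq)] with s hs
  exact ((extChartAt I q).left_inv (by rw [extChartAt_source]; exact hs)).symm

end ReadingGeodesics

section Uniqueness

variable {F : Type*} [NormedAddCommGroup F] [NormedSpace ℝ F] [FiniteDimensional ℝ F]

theorem isInvertible_of_pos {B : F →L[ℝ] F →L[ℝ] ℝ} (h : ∀ v, v ≠ 0 → 0 < B v v) :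
    B.IsInvertible := by
  have hinj : Function.Injective B := by
    rw [injective_iff_map_eq_zero]
    intro u hu
    by_contra h0
    have := h u h0
    simp [hu] at this
  have hrank : Module.finrank ℝ F = Module.finrank ℝ (F →L[ℝ] ℝ) := by
    rw [← (LinearMap.toContinuousLinearMap (𝕜 := ℝ) (E := F) (F' := ℝ)).finrank_eq]
    exact (Subspace.dual_finrank_eq (K := ℝ) (V := F)).symm
  let e : F ≃ₗ[ℝ] (F →L[ℝ] ℝ) := LinearEquiv.ofBijective (B : F →ₗ[ℝ] (F →L[ℝ] ℝ))
    ⟨hinj, (LinearMap.injective_iff_surjective_of_finrank_eq_finrank hrank).1 hinj⟩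
  exact ⟨e.toContinuousLinearEquiv, by ext; rfl⟩

/-- The spray of the metric `M`: the first order system in `F × F` which expresses the vanishing
of the Euler–Lagrange expression. -/
def geodesicSpray (M : F → F →L[ℝ] F →L[ℝ] ℝ) (p : F × F) : F × F :=
  (p.2, (M p.1).inverse ((1 / 2 : ℝ) • ((fderiv ℝ M p.1).flip p.2).flip p.2
    - fderiv ℝ M p.1 p.2 p.2))

theorem contDiffAt_geodesicSpray {M : F → F →L[ℝ] F →L[ℝ] ℝ} {p : F × F}
    (hM : ContDiffAt ℝ ∞ M p.1) (hpos : ∀ v, v ≠ 0 → 0 < M p.1 v v) :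
    ContDiffAt ℝ 1 (geodesicSpray M) p := by
  have hM1 : ContDiffAt ℝ 1 (fun p : F × F => M p.1) p :=
    (hM.of_le (by exact_mod_cast le_top)).comp p contDiffAt_fst
  have hD : ContDiffAt ℝ 1 (fun p : F × F => fderiv ℝ M p.1) p :=
    (hM.fderiv_right (m := 1) (WithTop.coe_le_coe.2 (le_top : (2 : ℕ∞) ≤ ⊤))).comp p contDiffAt_fst
  have hinv : ContDiffAt ℝ 1 (fun p : F × F => (M p.1).inverse) p :=
    ContDiffAt.comp p (g := ContinuousLinearMap.inverse)
      (isInvertible_of_pos hpos).contDiffAt_map_inverse hM1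
  refine contDiffAt_snd.prodMk (hinv.clm_apply (ContDiffAt.sub (ContDiffAt.const_smul _ ?_) ?_))
  · have h1 : ContDiffAt ℝ 1 (fun p : F × F => ((fderiv ℝ M p.1).flip p.2)) p :=
      ((ContinuousLinearMap.flipₗᵢ ℝ F F (F →L[ℝ] ℝ)).contDiff.contDiffAt.comp p hD).clm_apply
        contDiffAt_snd
    exact ((ContinuousLinearMap.flipₗᵢ ℝ F F ℝ).contDiff.contDiffAt.comp p h1).clm_apply
      contDiffAt_snd
  · exact (hD.clm_apply contDiffAt_snd).clm_apply contDiffAt_snd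

theorem hasDerivAt_geodesicSpray {M : F → F →L[ℝ] F →L[ℝ] ℝ} {c : ℝ → F} {t : ℝ}
    (hc : ContDiffAt ℝ 2 c t) (hpos : ∀ v, v ≠ 0 → 0 < M (c t) v v)
    (h : ∀ y, eulerLagrange M c t y = 0) :
    HasDerivAt (fun s => (c s, deriv c s)) (geodesicSpray M (c t, deriv c t)) t := by
  have hdc : HasDerivAt c (deriv c t) t := (hc.differentiableAt (by simp)).hasDerivAt
  have hddc : HasDerivAt (deriv c) (deriv (deriv c) t) t := by
    have h1 : ContDiffAt ℝ 1 (fderiv ℝ c) t := hc.fderiv_right (by norm_num)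
    have h2 : DifferentiableAt ℝ (fun s => fderiv ℝ c s 1) t :=
      (h1.differentiableAt (by simp)).clm_apply (differentiableAt_const _)
    exact h2.hasDerivAt
  have e : geodesicSpray M (c t, deriv c t) = (deriv c t, deriv (deriv c) t) := by
    refine Prod.ext rfl ?_
    obtain ⟨L, hL⟩ := isInvertible_of_pos hpos
    have h1 : (1 / 2 : ℝ) • ((fderiv ℝ M (c t)).flip (deriv c t)).flip (deriv c t)
        - fderiv ℝ M (c t) (deriv c t) (deriv c t) = L (deriv (deriv c) t) := by
      ext y
      have h2 := h y
      have h3 : L (deriv (deriv c) t) = M (c t) (deriv (deriv c) t) := by rw [← hL]; rfl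
      simp only [eulerLagrange] at h2
      simp only [h3, sub_apply, smul_apply, ContinuousLinearMap.flip_apply, smul_eq_mul]
      linarith
    simp only [geodesicSpray]
    rw [h1, ← hL, ContinuousLinearMap.inverse_equiv]
    simp
  rw [e]
  exact hdc.prodMk hddc

/-- Solutions of the Euler–Lagrange equation with the same initial position and velocity agree for a
short time, since the spray is locally Lipschitz. -/
theorem eventuallyEq_of_eulerLagrange {M : F → F →L[ℝ] F →L[ℝ] ℝ} {U : Set F} (hU : IsOpen U)
    (hM : ContDiffOn ℝ ∞ M U) (hpos : ∀ z ∈ U, ∀ v, v ≠ 0 → 0 < M z v v) {c₁ c₂ : ℝ → F} {a b : ℝ}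
    (hab : a < b) (h₁ : ∀ t ∈ Icc a b, ContDiffAt ℝ 2 c₁ t ∧ ∀ y, eulerLagrange M c₁ t y = 0)
    (h₂ : ∀ t ∈ Icc a b, ContDiffAt ℝ 2 c₂ t ∧ ∀ y, eulerLagrange M c₂ t y = 0)
    (haU : c₁ a ∈ U) (h0 : c₁ a = c₂ a) (h1 : deriv c₁ a = deriv c₂ a) :
    ∀ᶠ t in 𝓝[>] a, c₁ t = c₂ t := by
  have hcont {c : ℝ → F} {t : ℝ} (hc : ContDiffAt ℝ 2 c t) :
      ContinuousAt (fun s => (c s, deriv c s)) t := by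
    have h1 : ContDiffAt ℝ 1 (fderiv ℝ c) t := hc.fderiv_right (by norm_num)
    have h2 : ContinuousAt (fun s => fderiv ℝ c s 1) t :=
      h1.continuousAt.clm_apply continuousAt_const
    exact hc.continuousAt.prodMk h2
  obtain ⟨K, s, hs, hK⟩ := (contDiffAt_geodesicSpray (M := M) (p := (c₁ a, deriv c₁ a))
    (hM.contDiffAt (hU.mem_nhds haU)) (hpos _ haU)).exists_lipschitzOnWith
  have hsU : s ∩ U ×ˢ univ ∈ 𝓝 (c₁ a, deriv c₁ a) :=
    inter_mem hs (prod_mem_nhds (hU.mem_nhds haU) univ_mem)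
  have ha := left_mem_Icc.2 hab.le
  have e1 : ∀ᶠ t in 𝓝 a, (c₁ t, deriv c₁ t) ∈ s ∩ U ×ˢ univ := hcont (h₁ a ha).1 hsU
  have e2 : ∀ᶠ t in 𝓝 a, (c₂ t, deriv c₂ t) ∈ s ∩ U ×ˢ univ :=
    hcont (h₂ a ha).1 (by simpa only [← h0, ← h1] using hsU)
  obtain ⟨η, hη, hball⟩ := Metric.eventually_nhds_iff.1 (e1.and e2)
  have hb' : a < min b (a + η) := lt_min hab (by linarith)
  have hin : ∀ t ∈ Ico a (min b (a + η)), t ∈ Icc a b ∧ dist t a < η := by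
    intro t ht
    have h3 := lt_min_iff.1 ht.2
    refine ⟨⟨ht.1, h3.1.le⟩, ?_⟩
    rw [Real.dist_eq, abs_of_nonneg (by linarith [ht.1])]
    linarith
  have hIcc : ∀ t ∈ Icc a (min b (a + η)), t ∈ Icc a b :=
    fun t ht => ⟨ht.1, ht.2.trans (min_le_left _ _)⟩
  have := ODE_solution_unique_of_mem_Icc_right (v := fun _ => geodesicSpray M)
    (s := fun _ => s ∩ U ×ˢ univ) (K := K) (f := fun t => (c₁ t, deriv c₁ t))
    (g := fun t => (c₂ t, deriv c₂ t)) (a := a) (b := min b (a + η))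
    (fun t _ => hK.mono inter_subset_left)
    (fun t ht => (hcont (h₁ t (hIcc t ht)).1).continuousWithinAt)
    (fun t ht => (hasDerivAt_geodesicSpray (h₁ t (hin t ht).1).1
      (hpos _ (hball (hin t ht).2).1.2.1) (h₁ t (hin t ht).1).2).hasDerivWithinAt)
    (fun t ht => (hball (hin t ht).2).1)
    (fun t ht => (hcont (h₂ t (hIcc t ht)).1).continuousWithinAt)
    (fun t ht => (hasDerivAt_geodesicSpray (h₂ t (hin t ht).1).1
      (hpos _ (hball (hin t ht).2).2.2.1) (h₂ t (hin t ht).1).2).hasDerivWithinAt)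
    (fun t ht => (hball (hin t ht).2).2) (by rw [h0, h1])
  filter_upwards [Ioo_mem_nhdsGT hb'] with t ht
  exact congrArg Prod.fst (this ⟨ht.1.le, ht.2.le⟩)

end Uniqueness

section ExpMap

variable {F H X : Type*} [NormedAddCommGroup F] [NormedSpace ℝ F] [FiniteDimensional ℝ F]
  [TopologicalSpace H] {I : ModelWithCorners ℝ F H} [I.Boundaryless] [TopologicalSpace X]
  [ChartedSpace H X] [IsManifold I ∞ X]

/-- A geodesic is determined by its initial velocity: the set of times up to which two geodesics
agree is closed, and open to the right by local uniqueness in a chart. -/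
theorem eqOn_of_isUnitTimeGeodesic [T2Space X] {G : SmoothMetric I X} {q : TangentBundle I X}
    {γ₁ γ₂ : ℝ → X} (h₁ : IsUnitTimeGeodesic G q γ₁) (h₂ : IsUnitTimeGeodesic G q γ₂) :
    EqOn γ₁ γ₂ (Icc 0 1) := by
  have hcont {γ : ℝ → X} (h : IsUnitTimeGeodesic G q γ) : ContinuousOn γ (Icc 0 1) :=
    fun t ht => (h.2 t ht).1.continuousAt.continuousWithinAt
  have hq := h₁.1.trans h₂.1.symm
  have h00 : γ₁ 0 = γ₂ 0 := congrArg Bundle.TotalSpace.proj hq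
  have hclosed : IsClosed ({t | γ₁ t = γ₂ t} ∩ Icc 0 1) := by
    have := ((hcont h₁).prodMk (hcont h₂)).preimage_isClosed_of_isClosed isClosed_Icc
      (isClosed_diagonal (X := X))
    rwa [inter_comm] at this
  refine hclosed.Icc_subset_of_forall_mem_nhdsGT_of_Icc_subset h00 fun t ht hle => ?_
  have ht1 : t ∈ Icc (0 : ℝ) 1 := ⟨ht.1, ht.2.le⟩
  have hteq : γ₁ t = γ₂ t := hle ⟨ht.1, le_rfl⟩
  set p := γ₁ t with hp
  set c₁ : ℝ → F := fun s => extChartAt I p (γ₁ s)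
  set c₂ : ℝ → F := fun s => extChartAt I p (γ₂ s)
  have hp1 : γ₁ t ∈ (chartAt H p).source := mem_chart_source H p
  have hp2 : γ₂ t ∈ (chartAt H p).source := by rw [← hteq]; exact hp1
  have ev1 := (h₁.2 t ht1).1.continuousAt.eventually ((chartAt H p).open_source.mem_nhds hp1)
  have ev2 := (h₂.2 t ht1).1.continuousAt.eventually ((chartAt H p).open_source.mem_nhds hp2)
  obtain ⟨b, hb, hbs⟩ := exists_Icc_mem_subset_of_mem_nhdsGE
    (mem_nhdsWithin_of_mem_nhds ((ev1.and ev2).and (Iio_mem_nhds ht.2)))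
  have htb : t < b := by
    rcases lt_or_eq_of_le hb with h | h
    · exact h
    · exfalso
      have h3 := hbs.1
      rw [← h, Icc_self] at h3
      have h4 : ({t} : Set ℝ) ∈ 𝓝[>] t := nhdsWithin_mono _ Ioi_subset_Ici_self h3
      obtain ⟨x, hx, hx'⟩ := (inter_mem h4 self_mem_nhdsWithin : _ ∈ 𝓝[>] t) |> Filter.nonempty_of_mem
      simp only [mem_singleton_iff] at hx
      exact lt_irrefl _ (hx ▸ hx' : t < t)
  have H1 : ∀ s ∈ Icc t b, ContDiffAt ℝ 2 c₁ s ∧ ∀ y, eulerLagrange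
      (pullbackMetric G (extChartAt I p).symm) c₁ s y = 0 := fun s hs =>
    (h₁.2 s ⟨ht.1.trans hs.1, (hbs.2 hs).2.le⟩).eulerLagrange_extChartAt (hbs.2 hs).1.1
  have H2 : ∀ s ∈ Icc t b, ContDiffAt ℝ 2 c₂ s ∧ ∀ y, eulerLagrange
      (pullbackMetric G (extChartAt I p).symm) c₂ s y = 0 := fun s hs =>
    (h₂.2 s ⟨ht.1.trans hs.1, (hbs.2 hs).2.le⟩).eulerLagrange_extChartAt (hbs.2 hs).1.2
  have htt := left_mem_Icc.2 htb.le
  have d1 : DifferentiableAt ℝ c₁ t := (H1 t htt).1.differentiableAt (by simp)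
  have d2 : DifferentiableAt ℝ c₂ t := (H2 t htt).1.differentiableAt (by simp)
  -- the velocities agree: by assumption at time `0`, and later because the curves agree to the left
  have hderiv : deriv c₁ t = deriv c₂ t := by
    rcases eq_or_lt_of_le ht.1 with h0 | h0
    · have hvel {γ : ℝ → X} (hγ : MDifferentiableAt 𝓘(ℝ, ℝ) I γ t)
          (hs : γ t ∈ (chartAt H p).source) : deriv (fun s => extChartAt I p (γ s)) t =
          mfderiv I 𝓘(ℝ, F) (extChartAt I p) (γ t) (mfderiv 𝓘(ℝ, ℝ) I γ t (1 : ℝ)) := by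
        have h1 := mfderiv_comp t ((contMDiffAt_extChartAt' (n := 1) hs).mdifferentiableAt (by simp)) hγ
        rw [mfderiv_eq_fderiv] at h1
        exact congrArg (fun L : ℝ →L[ℝ] F => L 1) h1
      have e1 := hvel ((h₁.2 t ht1).1.mdifferentiableAt (by simp)) hp1
      have e2 := hvel ((h₂.2 t ht1).1.mdifferentiableAt (by simp)) hp2
      have e3 := congrArg (fun v : TangentBundle I X =>
        (mfderiv I 𝓘(ℝ, F) (extChartAt I p) v.1 v.2 : F)) hq
      rw [h0] at e3
      exact e1.trans (e3.trans e2.symm)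
    · have hu : UniqueDiffWithinAt ℝ (Icc 0 t) t :=
        uniqueDiffOn_Icc h0 t (right_mem_Icc.2 h0.le)
      rw [← d1.derivWithin hu, ← d2.derivWithin hu]
      exact derivWithin_congr (fun s hs => by simp only [c₁, c₂, show γ₁ s = γ₂ s from hle hs])
        (by simp only [c₁, c₂, ← hp, ← hteq])
  have hM := contDiffOn_metricInChart G p
  have key := eventuallyEq_of_eulerLagrange (isOpen_extChartAt_target p) hM
    (fun z hz v hv => pullbackMetric_pos G (injective_mfderivModel_extChartAt_symm hz) hv) htb H1 H2
    ((extChartAt I p).map_source (by rw [extChartAt_source]; exact hp1))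
    (by simp only [c₁, c₂, ← hp, ← hteq]) hderiv
  filter_upwards [key, Ioo_mem_nhdsGT htb] with s hs hsb
  have hs' := (hbs.2 ⟨hsb.1.le, hsb.2.le⟩).1
  exact (extChartAt I p).injOn (by rw [extChartAt_source]; exact hs'.1)
    (by rw [extChartAt_source]; exact hs'.2) hs

/-- The exponential map is computed by any geodesic with the given initial velocity. -/
theorem IsUnitTimeGeodesic.expMap_eq [T2Space X] {G : SmoothMetric I X} {q : TangentBundle I X}
    {γ : ℝ → X} (h : IsUnitTimeGeodesic G q γ) : expMap G q = γ 1 := by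
  have hq : InExpDomain G q := ⟨γ, h⟩
  rw [expMap, dif_pos hq]
  exact eqOn_of_isUnitTimeGeodesic hq.choose_spec h (right_mem_Icc.2 zero_le_one)

end ExpMap

/-! ### Coordinates of the end and the Hamiltonian form of the geodesic equation -/

section EndParam

variable {E S : Type*} [NormedAddCommGroup E] [NormedSpace ℝ E]
  [TopologicalSpace S] [ChartedSpace E S] {R : ℝ}

/-- The point of the half-line `(R, ∞)` with coordinate `x`, with an arbitrary value if `x ≤ R`. -/
def toHalfLine (R x : ℝ) : HalfLine R :=
  if h : R < x then ⟨x, h⟩ else ⟨R + 1, lt_add_one R⟩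

theorem toHalfLine_of_lt {x : ℝ} (h : R < x) : toHalfLine R x = ⟨x, h⟩ := dif_pos h

theorem hasMFDerivAt_toHalfLine {x : ℝ} (h : R < x) :
    HasMFDerivAt 𝓘(ℝ, ℝ) 𝓘(ℝ, ℝ) (toHalfLine R) x (ContinuousLinearMap.id ℝ ℝ) := by
  have hev : ∀ᶠ y in 𝓝 x, ((toHalfLine R y : HalfLine R) : ℝ) = y := by
    filter_upwards [Ioi_mem_nhds h] with y hy
    rw [toHalfLine_of_lt hy]
  refine ⟨?_, ?_⟩
  · rw [Topology.IsInducing.subtypeVal.continuousAt_iff]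
    exact continuousAt_id.congr (hev.mono fun y hy => hy.symm)
  · refine HasFDerivAt.hasFDerivWithinAt ?_
    refine (hasFDerivAt_id _).congr_of_eventuallyEq ?_
    filter_upwards [hev] with y hy
    simp only [writtenInExtChartAt, mfld_simps]
    exact hy

theorem contMDiffOn_toHalfLine :
    ContMDiffOn 𝓘(ℝ, ℝ) 𝓘(ℝ, ℝ) ∞ (toHalfLine R) (Ioi R) := by
  intro x hx
  have hev : ∀ᶠ y in 𝓝 x, ((toHalfLine R y : HalfLine R) : ℝ) = y := by
    filter_upwards [Ioi_mem_nhds hx] with y hy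
    rw [toHalfLine_of_lt hy]
  refine ContMDiffAt.contMDiffWithinAt ?_
  rw [contMDiffAt_iff]
  refine ⟨(hasMFDerivAt_toHalfLine hx).1, ContDiffAt.contDiffWithinAt ?_⟩
  refine contDiffAt_id.congr_of_eventuallyEq ?_
  simp only [mfld_simps]
  filter_upwards [hev] with y hy
  exact hy

/-- The parametrization of the end by `(R, ∞)` and the coordinates of the chart `e` of `S`. -/
def endParam (R : ℝ) (e : OpenPartialHomeomorph S E) (z : ℝ × E) : HalfLine R × S :=
  (toHalfLine R z.1, e.symm z.2)

theorem contMDiffOn_endParam [IsManifold 𝓘(ℝ, E) ∞ S] {e : OpenPartialHomeomorph S E}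
    (he : e ∈ IsManifold.maximalAtlas 𝓘(ℝ, E) ∞ S) :
    ContMDiffOn 𝓘(ℝ, ℝ × E) (𝓘(ℝ, ℝ).prod 𝓘(ℝ, E)) ∞ (endParam R e) (Ioi R ×ˢ e.target) := by
  have h1 : ContMDiffOn 𝓘(ℝ, ℝ × E) 𝓘(ℝ, ℝ) ∞ (fun z : ℝ × E => toHalfLine R z.1)
      (Ioi R ×ˢ e.target) :=
    contMDiffOn_toHalfLine.comp contDiff_fst.contMDiff.contMDiffOn fun z hz => hz.1
  have h2 : ContMDiffOn 𝓘(ℝ, ℝ × E) 𝓘(ℝ, E) ∞ (fun z : ℝ × E => e.symm z.2)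
      (Ioi R ×ˢ e.target) :=
    (contMDiffOn_symm_of_mem_maximalAtlas he).comp contDiff_snd.contMDiff.contMDiffOn
      fun z hz => hz.2
  exact h1.prodMk h2

theorem mfderivModel_endParam [IsManifold 𝓘(ℝ, E) ∞ S] {e : OpenPartialHomeomorph S E}
    (he : e ∈ IsManifold.maximalAtlas 𝓘(ℝ, E) ∞ S) {z : ℝ × E} (hz : z ∈ Ioi R ×ˢ e.target)
    (v : ℝ × E) : mfderivModel (𝓘(ℝ, ℝ).prod 𝓘(ℝ, E)) (endParam R e) z v =
      (v.1, mfderivModel 𝓘(ℝ, E) e.symm z.2 v.2) := by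
  have hfst : HasMFDerivAt 𝓘(ℝ, ℝ × E) 𝓘(ℝ, ℝ) (Prod.fst : ℝ × E → ℝ) z
      (ContinuousLinearMap.fst ℝ ℝ E) := hasFDerivAt_fst.hasMFDerivAt
  have hsnd : HasMFDerivAt 𝓘(ℝ, ℝ × E) 𝓘(ℝ, E) (Prod.snd : ℝ × E → E) z
      (ContinuousLinearMap.snd ℝ ℝ E) := hasFDerivAt_snd.hasMFDerivAt
  have h1 := (hasMFDerivAt_toHalfLine hz.1).comp z hfst
  have he' : MDifferentiableAt 𝓘(ℝ, E) 𝓘(ℝ, E) e.symm z.2 :=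
    ((contMDiffOn_symm_of_mem_maximalAtlas he).contMDiffAt
      (e.open_target.mem_nhds hz.2)).mdifferentiableAt (by simp)
  have h2 := he'.hasMFDerivAt.comp z hsnd
  have h3 := (h1.prodMk h2).mfderiv
  exact congrArg (fun L : (ℝ × E) →L[ℝ] (ℝ × E) => L v) h3

theorem injective_mfderivModel_endParam [IsManifold 𝓘(ℝ, E) ∞ S] {e : OpenPartialHomeomorph S E}
    (he : e ∈ IsManifold.maximalAtlas 𝓘(ℝ, E) ∞ S) {z : ℝ × E} (hz : z ∈ Ioi R ×ˢ e.target) :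
    Function.Injective (mfderivModel (𝓘(ℝ, ℝ).prod 𝓘(ℝ, E)) (endParam R e) z) := by
  have hes : MDifferentiableAt 𝓘(ℝ, E) 𝓘(ℝ, E) e.symm z.2 :=
    ((contMDiffOn_symm_of_mem_maximalAtlas he).contMDiffAt
      (e.open_target.mem_nhds hz.2)).mdifferentiableAt (by simp)
  have hee : MDifferentiableAt 𝓘(ℝ, E) 𝓘(ℝ, E) e (e.symm z.2) :=
    ((contMDiffOn_of_mem_maximalAtlas he).contMDiffAt
      (e.open_source.mem_nhds (e.map_target hz.2))).mdifferentiableAt (by simp)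
  have hcomp := mfderiv_comp z.2 hee hes
  have hid : (e ∘ e.symm) =ᶠ[𝓝 z.2] id := by
    filter_upwards [e.open_target.mem_nhds hz.2] with y hy
    exact e.right_inv hy
  rw [hid.mfderiv_eq, mfderiv_id] at hcomp
  have key (u : E) : (mfderiv 𝓘(ℝ, E) 𝓘(ℝ, E) e (e.symm z.2)
      (mfderivModel 𝓘(ℝ, E) e.symm z.2 u) : E) = u :=
    (congrArg (fun L : E →L[ℝ] E => L u) hcomp).symm
  intro v v' hvv
  rw [mfderivModel_endParam he hz, mfderivModel_endParam he hz, Prod.mk.injEq] at hvv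
  refine Prod.ext hvv.1 ?_
  rw [← key v.2, ← key v'.2]
  exact congrArg (fun ξ : E => (mfderiv 𝓘(ℝ, E) 𝓘(ℝ, E) e (e.symm z.2) ξ : E)) hvv.2

/-- The metric of the end in the coordinates `(x, θ)`, in terms of the vectors which define its
coefficients. -/
theorem endMetric_apply [IsManifold 𝓘(ℝ, E) ∞ S] (G : EndMetric R E S)
    {e : OpenPartialHomeomorph S E} (he : e ∈ IsManifold.maximalAtlas 𝓘(ℝ, E) ∞ S) {x : ℝ} {θ : E}
    (hx : R < x) (hθ : θ ∈ e.target) (u v : ℝ × E) :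
    pullbackMetric G (endParam R e) (x, θ) u v =
      G.inner (⟨x, hx⟩, e.symm θ) (tangentPair (⟨x, hx⟩, e.symm θ) u.1 (coordVec e θ u.2))
        (tangentPair (⟨x, hx⟩, e.symm θ) v.1 (coordVec e θ v.2)) := by
  have h := mfderivModel_endParam (R := R) he (z := (x, θ)) ⟨hx, hθ⟩
  simp only [pullbackMetric, ContinuousLinearMap.bilinearComp_apply, h]
  change metricForm G (toHalfLine R x, e.symm θ) _ _ = _
  rw [toHalfLine_of_lt hx]
  rfl

theorem coordVec_zero (e : OpenPartialHomeomorph S E) (θ : E) : coordVec e θ 0 = 0 := map_zero _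

theorem coefA_eq [IsManifold 𝓘(ℝ, E) ∞ S] (G : EndMetric R E S)
    {e : OpenPartialHomeomorph S E} (he : e ∈ IsManifold.maximalAtlas 𝓘(ℝ, E) ∞ S) {x : ℝ} {θ : E}
    (hx : R < x) (hθ : θ ∈ e.target) :
    coefA G e x θ = pullbackMetric G (endParam R e) (x, θ) (1, 0) (1, 0) := by
  rw [endMetric_apply G he hx hθ, coefA, dif_pos hx, coordVec_zero]

theorem coefB_eq [IsManifold 𝓘(ℝ, E) ∞ S] (G : EndMetric R E S) (w : ℝ → ℝ)
    {e : OpenPartialHomeomorph S E} (he : e ∈ IsManifold.maximalAtlas 𝓘(ℝ, E) ∞ S) {x : ℝ} {θ : E}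
    (hx : R < x) (hθ : θ ∈ e.target) (u : E) :
    coefB G w e u x θ = w x * pullbackMetric G (endParam R e) (x, θ) (1, 0) (0, u) := by
  rw [endMetric_apply G he hx hθ, coefB, dif_pos hx, coordVec_zero]

theorem coefG_eq [IsManifold 𝓘(ℝ, E) ∞ S] (G : EndMetric R E S) (w : ℝ → ℝ)
    {e : OpenPartialHomeomorph S E} (he : e ∈ IsManifold.maximalAtlas 𝓘(ℝ, E) ∞ S) {x : ℝ} {θ : E}
    (hx : R < x) (hθ : θ ∈ e.target) (u v : E) :
    coefG G w e u v x θ = w x ^ 2 * pullbackMetric G (endParam R e) (x, θ) (0, u) (0, v) := by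
  rw [endMetric_apply G he hx hθ, coefG, dif_pos hx]

end EndParam

section Hamiltonian

variable {E : Type*} [NormedAddCommGroup E] [NormedSpace ℝ E]

/-- A curve with unit speed in `ℝ × E` whose momentum in the directions of `E` satisfies Hamilton's
equation solves the Euler–Lagrange equation: the only other component follows from the conservation
of energy. -/
theorem eulerLagrange_eq_zero_of_momentum {M : ℝ × E → (ℝ × E) →L[ℝ] (ℝ × E) →L[ℝ] ℝ}
    {c : ℝ → ℝ × E} {η : ℝ → E →L[ℝ] ℝ} {η' : E →L[ℝ] ℝ} {t : ℝ}
    (hM : DifferentiableAt ℝ M (c t)) (hsymm : ∀ u v, M (c t) u v = M (c t) v u)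
    (hc : ContDiffAt ℝ 2 c t) (hη : HasDerivAt η η' t)
    (hη' : ∀ y, η' y = fderiv ℝ M (c t) (0, y) (deriv c t) (deriv c t) / 2)
    (hmom : ∀ᶠ s in 𝓝 t, ∀ y, M (c s) (deriv c s) (0, y) = η s y)
    (hen : ∀ᶠ s in 𝓝 t, M (c s) (deriv c s) (deriv c s) = 1)
    (hne : (deriv c t).1 ≠ 0) (y : ℝ × E) : eulerLagrange M c t y = 0 := by
  have hdc : HasDerivAt c (deriv c t) t := (hc.differentiableAt (by simp)).hasDerivAt
  have hddc : HasDerivAt (deriv c) (deriv (deriv c) t) t := by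
    have h1 : ContDiffAt ℝ 1 (fderiv ℝ c) t := hc.fderiv_right (by norm_num)
    have h2 : DifferentiableAt ℝ (fun s => fderiv ℝ c s 1) t :=
      (h1.differentiableAt (by simp)).clm_apply (differentiableAt_const _)
    exact h2.hasDerivAt
  have hMc : HasDerivAt (fun s => M (c s)) (fderiv ℝ M (c t) (deriv c t)) t :=
    hM.hasFDerivAt.comp_hasDerivAt t hdc
  -- in the directions of `E` this is Hamilton's equation for `η`
  have hvert (y : E) : eulerLagrange M c t (0, y) = 0 := by
    have h1 := (hMc.clm_apply hddc).clm_apply (hasDerivAt_const t ((0, y) : ℝ × E))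
    have h2 : HasDerivAt (fun s => M (c s) (deriv c s) (0, y)) (η' y) t := by
      have h3 := hη.clm_apply (hasDerivAt_const t y)
      simp only [map_zero, add_zero] at h3
      exact h3.congr_of_eventuallyEq (hmom.mono fun s hs => hs y)
    have h3 := h1.unique h2
    simp only [map_zero, add_zero, add_apply] at h3
    simp only [eulerLagrange]
    rw [hη'] at h3
    linarith
  -- in the direction of `c'` it is the derivative of the energy
  have hself : eulerLagrange M c t (deriv c t) = 0 := by
    have h1 := (hMc.clm_apply hddc).clm_apply hddc
    have h2 : HasDerivAt (fun s => M (c s) (deriv c s) (deriv c s)) 0 t :=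
      (hasDerivAt_const t (1 : ℝ)).congr_of_eventuallyEq hen
    have h3 := h1.unique h2
    simp only [add_apply] at h3
    have h4 := hsymm (deriv c t) (deriv (deriv c) t)
    simp only [eulerLagrange]
    linarith
  have hdec : y = (y.1 / (deriv c t).1) • deriv c t
      + (0, y.2 - (y.1 / (deriv c t).1) • (deriv c t).2) := by
    ext
    · simp [hne]
    · simp
  rw [hdec, eulerLagrange_add, eulerLagrange_smul, hself, hvert]
  simp

/-- The coefficient `b` of the metric `M` as a linear form. -/
def angularB (M : ℝ × E → (ℝ × E) →L[ℝ] (ℝ × E) →L[ℝ] ℝ) (w : ℝ → ℝ) (z : ℝ × E) : E →L[ℝ] ℝ :=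
  w z.1 • (M z (1, 0)).comp (ContinuousLinearMap.inr ℝ ℝ E)

/-- The coefficient `g` of the metric `M` as a bilinear form. -/
def angularG (M : ℝ × E → (ℝ × E) →L[ℝ] (ℝ × E) →L[ℝ] ℝ) (w : ℝ → ℝ) (z : ℝ × E) :
    E →L[ℝ] E →L[ℝ] ℝ :=
  w z.1 ^ 2 • (M z).bilinearComp (ContinuousLinearMap.inr ℝ ℝ E) (ContinuousLinearMap.inr ℝ ℝ E)

variable {M : ℝ × E → (ℝ × E) →L[ℝ] (ℝ × E) →L[ℝ] ℝ} {w : ℝ → ℝ}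

theorem angularB_apply (z : ℝ × E) (u : E) : angularB M w z u = w z.1 * M z (1, 0) (0, u) := rfl

theorem angularG_apply (z : ℝ × E) (u v : E) :
    angularG M w z u v = w z.1 ^ 2 * M z (0, u) (0, v) := rfl

/-- The metric in terms of its coefficients `a`, `b`, `g`, for angular velocities written as
`w u`. -/
theorem metric_decomposition {z : ℝ × E} (hsymm : ∀ u v, M z u v = M z v u)
    (ρ ρ' : ℝ) (u u' : E) : M z (ρ, w z.1 • u) (ρ', w z.1 • u') =
      M z (1, 0) (1, 0) * ρ * ρ' + ρ * angularB M w z u' + ρ' * angularB M w z u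
        + angularG M w z u u' := by
  have e (ρ : ℝ) (u : E) : ((ρ, w z.1 • u) : ℝ × E) = ρ • (1, 0) + w z.1 • (0, u) := by simp
  rw [e, e]
  simp only [map_add, map_smul, add_apply, smul_apply, smul_eq_mul, angularB_apply,
    angularG_apply, hsymm (0, u) (1, 0)]
  ring

/-- The radial speed `x'` of a unit speed geodesic with angular momentum `η`, from the conservation
of energy. -/
def radialSpeed (M : ℝ × E → (ℝ × E) →L[ℝ] (ℝ × E) →L[ℝ] ℝ) (w : ℝ → ℝ) (z : ℝ × E)
    (η : E →L[ℝ] ℝ) : ℝ :=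
  Real.sqrt ((1 - w z.1 ^ 2 * η ((angularG M w z).inverse η))
    / (M z (1, 0) (1, 0) - angularB M w z ((angularG M w z).inverse (angularB M w z))))

/-- The angular velocity, divided by `w`, of a unit speed geodesic with angular momentum `η`. -/
def angularSpeed (M : ℝ × E → (ℝ × E) →L[ℝ] (ℝ × E) →L[ℝ] ℝ) (w : ℝ → ℝ) (z : ℝ × E)
    (η : E →L[ℝ] ℝ) : E :=
  w z.1 • (angularG M w z).inverse η
    - radialSpeed M w z η • (angularG M w z).inverse (angularB M w z)

/-- The vector with components `radialSpeed` and `w • angularSpeed` has angular momentum `η`. -/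
theorem metric_apply_velocity {z : ℝ × E} {η : E →L[ℝ] ℝ} (hw : w z.1 ≠ 0)
    (hsymm : ∀ u v, M z u v = M z v u) (hinv : (angularG M w z).IsInvertible)
    (v : E) : M z (radialSpeed M w z η, w z.1 • angularSpeed M w z η) (0, v) = η v := by
  have h1 := metric_decomposition (w := w) hsymm (radialSpeed M w z η) 0 (angularSpeed M w z η)
    ((w z.1)⁻¹ • v)
  rw [smul_inv_smul₀ hw] at h1
  rw [h1, angularSpeed]
  have hi (η : E →L[ℝ] ℝ) : angularG M w z ((angularG M w z).inverse η) = η :=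
    hinv.self_apply_inverse η
  simp only [map_sub, map_smul, sub_apply, smul_apply, hi, smul_eq_mul]
  field_simp
  ring

/-- The vector with components `radialSpeed` and `w • angularSpeed` has length one. -/
theorem metric_velocity_velocity {z : ℝ × E} {η : E →L[ℝ] ℝ}
    (hsymm : ∀ u v, M z u v = M z v u) (hinv : (angularG M w z).IsInvertible)
    (hη : 0 ≤ 1 - w z.1 ^ 2 * η ((angularG M w z).inverse η))
    (hD : 0 < M z (1, 0) (1, 0)
      - angularB M w z ((angularG M w z).inverse (angularB M w z))) :
    M z (radialSpeed M w z η, w z.1 • angularSpeed M w z η)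
      (radialSpeed M w z η, w z.1 • angularSpeed M w z η) = 1 := by
  have hi (η : E →L[ℝ] ℝ) : angularG M w z ((angularG M w z).inverse η) = η :=
    hinv.self_apply_inverse η
  have hgs (u v : E) : angularG M w z u v = angularG M w z v u := by
    rw [angularG_apply, angularG_apply, hsymm]
  have hs : η ((angularG M w z).inverse (angularB M w z)) =
      angularB M w z ((angularG M w z).inverse η) := by
    have h1 := hgs ((angularG M w z).inverse η) ((angularG M w z).inverse (angularB M w z))
    rwa [hi, hi] at h1
  have hξ : radialSpeed M w z η ^ 2 * (M z (1, 0) (1, 0)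
      - angularB M w z ((angularG M w z).inverse (angularB M w z)))
      = 1 - w z.1 ^ 2 * η ((angularG M w z).inverse η) := by
    rw [radialSpeed, Real.sq_sqrt (div_nonneg hη hD.le), div_mul_cancel₀ _ hD.ne']
  rw [metric_decomposition (w := w) hsymm]
  simp only [angularSpeed, map_sub, map_smul, sub_apply, smul_apply, hi, smul_eq_mul, hs]
  linear_combination hξ

/-- The force acting on the angular momentum: half the angular derivative of the energy. -/
def angularForce (M : ℝ × E → (ℝ × E) →L[ℝ] (ℝ × E) →L[ℝ] ℝ) (w : ℝ → ℝ) (z : ℝ × E)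
    (η : E →L[ℝ] ℝ) : E →L[ℝ] ℝ :=
  (1 / 2 : ℝ) • ((((fderiv ℝ M z).flip (radialSpeed M w z η, w z.1 • angularSpeed M w z η)).flip
    (radialSpeed M w z η, w z.1 • angularSpeed M w z η)).comp (ContinuousLinearMap.inr ℝ ℝ E))

theorem angularForce_apply (z : ℝ × E) (η : E →L[ℝ] ℝ) (y : E) :
    angularForce M w z η y =
      fderiv ℝ M z (0, y) (radialSpeed M w z η, w z.1 • angularSpeed M w z η)
        (radialSpeed M w z η, w z.1 • angularSpeed M w z η) / 2 := by
  simp only [angularForce, smul_apply, ContinuousLinearMap.comp_apply,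
    ContinuousLinearMap.flip_apply, ContinuousLinearMap.inr_apply, smul_eq_mul]
  ring

end Hamiltonian

/-! ### Asymptotically conical metrics in a chart -/

section Auxiliary

variable {E W : Type*} [NormedAddCommGroup E] [NormedSpace ℝ E] [NormedAddCommGroup W]
  [NormedSpace ℝ W] {m M : ℝ} {V : Set E}

theorem IsSymbol.congr (hV : IsOpen V) {f g : ℝ → E → W} (hf : IsSymbol m M V f)
    (h : ∀ x ∈ Ioi M, ∀ θ ∈ V, g x θ = f x θ) : IsSymbol m M V g := by
  refine ⟨hf.1.congr fun p hp => h p.1 hp.1 p.2 hp.2, fun K hKV hK j k => ?_⟩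
  obtain ⟨C, hC⟩ := hf.2 K hKV hK j k
  refine ⟨C, fun x hx θ hθ => ?_⟩
  have e : ∀ s ∈ Ioi M, iteratedFDeriv ℝ k (g s) θ = iteratedFDeriv ℝ k (f s) θ := fun s hs =>
    ((show g s =ᶠ[𝓝 θ] f s from by
      filter_upwards [hV.mem_nhds (hKV hθ)] with y hy using h s hs y hy).iteratedFDeriv ℝ k).eq_of_nhds
  rw [iteratedDeriv_congr_of_mem isOpen_Ioi e j hx]
  exact hC x hx θ hθ

variable {N Q : Type*} [NormedAddCommGroup N] [NormedSpace ℝ N] [NormedAddCommGroup Q]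
  [NormedSpace ℝ Q] {I : Set N} {U : Set Q}

set_option synthInstance.maxHeartbeats 200000 in
/-- A family of linear maps on a finite dimensional space is smooth if its values are. -/
theorem SmoothFamily.of_apply [FiniteDimensional ℝ E] (hU : IsOpen U)
    {f : N → Q → (E →L[ℝ] W)} (h : ∀ u, SmoothFamily I U (fun i q => f i q u)) :
    SmoothFamily I U f := by
  let b := Module.finBasis ℝ E
  let c (k : Fin (Module.finrank ℝ E)) : E →L[ℝ] ℝ := LinearMap.toContinuousLinearMap (b.coord k)
  have h1 : SmoothFamily I U fun i q => ∑ k ∈ Finset.univ,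
      (ContinuousLinearMap.smulRightL ℝ E W (c k)) (f i q (b k)) :=
    SmoothFamily.sum hU _ fun k _ => (h (b k)).clm_comp hU _
  refine h1.congr hU fun i _ q _ => ?_
  ext u
  simp only [sum_apply, ContinuousLinearMap.smulRightL_apply_apply,
    ContinuousLinearMap.smulRight_apply]
  conv_lhs => rw [← b.sum_repr u, map_sum]
  simp [c]

end Auxiliary

section ReducedSystem

variable {E : Type*} [NormedAddCommGroup E] [NormedSpace ℝ E]

/-- The right-hand side of the equations for the excess `x - t`, the angular variable and the
angular momentum of a unit speed geodesic. -/
def reducedField (M : ℝ × E → (ℝ × E) →L[ℝ] (ℝ × E) →L[ℝ] ℝ) (w : ℝ → ℝ)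
    (q : ℝ × E × (E →L[ℝ] ℝ)) : ℝ × E × (E →L[ℝ] ℝ) :=
  (radialSpeed M w (q.1, q.2.1) q.2.2 - 1, w q.1 • angularSpeed M w (q.1, q.2.1) q.2.2,
    angularForce M w (q.1, q.2.1) q.2.2)

/-- The metric `M = a dx² + 2 b dx dθ / w + g dθ² / w²` on `(R, ∞) × V` is asymptotic to
`dx² + gbar dθ² / w²`, with rates of decay expressed by `τ`. -/
structure IsAsymptotic (R τ : ℝ) (V : Set E) (M : ℝ × E → (ℝ × E) →L[ℝ] (ℝ × E) →L[ℝ] ℝ)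
    (w : ℝ → ℝ) (gbar : E → E →L[ℝ] E →L[ℝ] ℝ) : Prop where
  isOpen : IsOpen V
  smooth : ContDiffOn ℝ ∞ M (Ioi R ×ˢ V)
  symm : ∀ z u v, M z u v = M z v u
  pos : ∀ z ∈ Ioi R ×ˢ V, ∀ v, v ≠ 0 → 0 < M z v v
  w_pos : ∀ x, R < x → 0 < w x
  w_symbol : IsSymbolLine (-((1 + τ) / 2)) R w
  a_symbol : IsSymbol (-(1 + τ)) R V (fun x θ => M (x, θ) (1, 0) (1, 0) - 1)
  b_symbol : ∀ u, IsSymbol (-((1 + τ) / 2)) R V (fun x θ => angularB M w (x, θ) u)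
  g_symbol : ∀ u v, IsSymbol (-τ) R V (fun x θ => angularG M w (x, θ) u v - gbar θ u v)
  gbar_smooth : ContDiffOn ℝ ∞ gbar V
  gbar_pos : ∀ θ ∈ V, ∀ v, v ≠ 0 → 0 < gbar θ v v

/-- The domain of the rescaled variables `(x / x₀, θ, η)`. -/
def scaledBox (θc : E) (ρ : ℝ) : Set (ℝ × E × (E →L[ℝ] ℝ)) :=
  Ioo (1 / 4 : ℝ) 4 ×ˢ (Metric.ball θc ρ ×ˢ Metric.ball 0 1)

theorem isOpen_scaledBox (θc : E) (ρ : ℝ) : IsOpen (scaledBox θc ρ) :=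
  isOpen_Ioo.prod (Metric.isOpen_ball.prod Metric.isOpen_ball)

theorem isBounded_scaledBox (θc : E) (ρ : ℝ) : Bornology.IsBounded (scaledBox θc ρ) :=
  (Metric.isBounded_Ioo _ _).prod (Metric.isBounded_ball.prod Metric.isBounded_ball)

variable {R τ : ℝ} {V : Set E}
  {M : ℝ × E → (ℝ × E) →L[ℝ] (ℝ × E) →L[ℝ] ℝ} {w : ℝ → ℝ} {gbar : E → E →L[ℝ] E →L[ℝ] ℝ}

/-- The angular derivative of the metric, through the coefficients `a`, `b` and `g`. -/
theorem fderiv_metric_decomposition (h : IsAsymptotic R τ V M w gbar) {x : ℝ} {θ : E}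
    (hx : R < x) (hθ : θ ∈ V) (y : E) (ρ : ℝ) (u : E) :
    fderiv ℝ M (x, θ) (0, y) (ρ, w x • u) (ρ, w x • u) =
      fderiv ℝ (fun θ => M (x, θ) (1, 0) (1, 0)) θ y * ρ * ρ
        + 2 * ρ * fderiv ℝ (fun θ => angularB M w (x, θ)) θ y u
        + fderiv ℝ (fun θ => angularG M w (x, θ)) θ y u u := by
  have hz : (x, θ) ∈ Ioi R ×ˢ V := ⟨hx, hθ⟩
  have hM : DifferentiableAt ℝ M (x, θ) := ((h.smooth.contDiffAt
    ((isOpen_Ioi.prod h.isOpen).mem_nhds hz)).differentiableAt (by simp))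
  have hs : HasFDerivAt (fun θ => M (x, θ)) ((fderiv ℝ M (x, θ)).comp
      (ContinuousLinearMap.inr ℝ ℝ E)) θ := by
    have := hM.hasFDerivAt.comp θ (hasFDerivAt_prodMk_right x θ)
    exact this
  have hap (u v : ℝ × E) : HasFDerivAt (fun θ => M (x, θ) u v)
      (((fderiv ℝ M (x, θ)).flip u).flip v |>.comp (ContinuousLinearMap.inr ℝ ℝ E)) θ := by
    have h1 := (hs.clm_apply (hasFDerivAt_const u θ)).clm_apply (hasFDerivAt_const v θ)
    refine h1.congr_fderiv ?_
    ext y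
    simp
  have hB : DifferentiableAt ℝ (fun θ => angularB M w (x, θ)) θ :=
    ((hs.differentiableAt.clm_apply (differentiableAt_const (1, 0))).clm_comp
      (differentiableAt_const (ContinuousLinearMap.inr ℝ ℝ E))).const_smul (w x)
  have hGd : DifferentiableAt ℝ (fun θ => angularG M w (x, θ)) θ := by
    have e : (fun θ => angularG M w (x, θ)) = fun θ => w x ^ 2 •
        ((ContinuousLinearMap.compL ℝ E (ℝ × E) ℝ).flip (ContinuousLinearMap.inr ℝ ℝ E)).comp
          ((M (x, θ)).comp (ContinuousLinearMap.inr ℝ ℝ E)) := by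
      ext θ u v; rfl
    rw [e]
    exact (DifferentiableAt.clm_comp (differentiableAt_const _)
      (hs.differentiableAt.clm_comp (differentiableAt_const _))).fun_const_smul _
  have e1 : fderiv ℝ (fun θ => angularB M w (x, θ)) θ y u =
      w x * fderiv ℝ M (x, θ) (0, y) (1, 0) (0, u) := by
    have h1 := hB.hasFDerivAt.clm_apply (hasFDerivAt_const u θ)
    have h2 := (hap (1, 0) (0, u)).const_mul (w x)
    have h3 := congrArg (fun L : E →L[ℝ] ℝ => L y) (h1.unique h2)
    simpa using h3
  have e2 : fderiv ℝ (fun θ => angularG M w (x, θ)) θ y u u =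
      w x ^ 2 * fderiv ℝ M (x, θ) (0, y) (0, u) (0, u) := by
    have h1 := (hGd.hasFDerivAt.clm_apply (hasFDerivAt_const u θ)).clm_apply
      (hasFDerivAt_const u θ)
    have h2 := (hap (0, u) (0, u)).const_mul (w x ^ 2)
    have h3 := congrArg (fun L : E →L[ℝ] ℝ => L y) (h1.unique h2)
    simpa using h3
  have e3 : fderiv ℝ M (x, θ) (0, y) (0, u) (1, 0) = fderiv ℝ M (x, θ) (0, y) (1, 0) (0, u) := by
    have h1 := (hap (0, u) (1, 0)).unique
      ((hap (1, 0) (0, u)).congr_of_eventuallyEq (Eventually.of_forall fun θ => h.symm _ _ _))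
    simpa using congrArg (fun L : E →L[ℝ] ℝ => L y) h1
  rw [e1, e2, (hap (1, 0) (1, 0)).fderiv]
  have e4 : ((ρ, w x • u) : ℝ × E) = ρ • (1, 0) + w x • (0, u) := by simp
  rw [e4]
  simp only [map_add, map_smul, add_apply, smul_apply, smul_eq_mul, e3,
    ContinuousLinearMap.comp_apply, ContinuousLinearMap.flip_apply, ContinuousLinearMap.inr_apply]
  ring

variable [FiniteDimensional ℝ E]

theorem IsAsymptotic.isInvertible_angularG (h : IsAsymptotic R τ V M w gbar) {z : ℝ × E}
    (hz : z ∈ Ioi R ×ˢ V) : (angularG M w z).IsInvertible := by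
  refine isInvertible_of_pos fun v hv => ?_
  rw [angularG_apply]
  have := h.w_pos _ hz.1
  have := h.pos z hz (0, v) (by simpa using hv)
  positivity

end ReducedSystem

/-! ### The equations in slowly varying unknowns -/

section ScaledSystem

variable {E : Type*} [NormedAddCommGroup E] [NormedSpace ℝ E] {R τ : ℝ}
  {V : Set E} {M : ℝ × E → (ℝ × E) →L[ℝ] (ℝ × E) →L[ℝ] ℝ} {w : ℝ → ℝ}
  {gbar : E → E →L[ℝ] E →L[ℝ] ℝ}

theorem fderiv_apply_inr {W : Type*} [NormedAddCommGroup W] [NormedSpace ℝ W] {f : ℝ × E → W}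
    {p : ℝ × E} (hf : DifferentiableAt ℝ f p) (y : E) :
    fderiv ℝ f p (0, y) = fderiv ℝ (fun θ => f (p.1, θ)) p.2 y := by
  have h1 : HasFDerivAt (fun θ => f (p.1, θ))
      ((fderiv ℝ f p).comp (ContinuousLinearMap.inr ℝ ℝ E)) p.2 :=
    HasFDerivAt.comp p.2 (g := f) hf.hasFDerivAt (hasFDerivAt_prodMk_right p.1 p.2)
  rw [h1.fderiv]
  rfl

theorem rpow_half_mul_self {x : ℝ} (hx : 0 < x) (τ : ℝ) :
    x ^ ((1 + τ) / 2) * x ^ ((1 + τ) / 2) = x ^ (1 + τ) := by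
  rw [← Real.rpow_add hx]; ring_nf

/-- The radial speed in terms of the rescaled coefficients. -/
theorem radialSpeed_eq {x : ℝ} (hx : 0 < x) (z : ℝ × E) (η : E →L[ℝ] ℝ) :
    radialSpeed M w z η = Real.sqrt
      ((1 - x ^ (-(1 + τ)) * ((x ^ ((1 + τ) / 2) * w z.1) ^ 2 * η ((angularG M w z).inverse η)))
      * (1 + x ^ (-(1 + τ)) * (x ^ (1 + τ) * (M z (1, 0) (1, 0) - 1)
        - (x ^ ((1 + τ) / 2) • angularB M w z)
            ((angularG M w z).inverse (x ^ ((1 + τ) / 2) • angularB M w z))))⁻¹) := by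
  have h1 : x ^ (-(1 + τ)) * x ^ (1 + τ) = 1 := by rw [← Real.rpow_add hx]; simp
  have h2 := rpow_half_mul_self hx τ
  rw [radialSpeed, div_eq_mul_inv]
  simp only [map_smul, smul_apply, smul_eq_mul]
  congr 3
  · linear_combination (-(w z.1 ^ 2 * η ((angularG M w z).inverse η))) * h1
      - (x ^ (-(1 + τ)) * (w z.1 ^ 2 * η ((angularG M w z).inverse η))) * h2
  · linear_combination (-(M z (1, 0) (1, 0) - 1)
      + angularB M w z ((angularG M w z).inverse (angularB M w z))) * h1
      + (x ^ (-(1 + τ)) * angularB M w z ((angularG M w z).inverse (angularB M w z))) * h2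

variable [FiniteDimensional ℝ E]

set_option maxHeartbeats 1000000 in
/-- Rescaling: the fields `x₀^{1+τ} F(x₀ μ, θ, η)`, where `F` is the right-hand side of the reduced
equations, are uniformly smooth in `(μ, θ, η)` as `x₀ → ∞`. -/
theorem IsAsymptotic.exists_smoothFamily (hτ : 0 < τ) (h : IsAsymptotic R τ V M w gbar) {θc : E}
    {ρ : ℝ} (hball : Metric.closedBall θc ρ ⊆ V) :
    ∃ x₀ : ℝ, 1 ≤ x₀ ∧ 4 * R ≤ x₀ ∧
      SmoothFamily (Ioi x₀) (scaledBox θc ρ)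
        (fun x q => x ^ (1 + τ) • reducedField M w (x * q.1, q.2)) ∧
      ∀ x ∈ Ioi x₀, ∀ q ∈ scaledBox θc ρ,
        0 < 1 - w (x * q.1) ^ 2 * q.2.2 ((angularG M w (x * q.1, q.2.1)).inverse q.2.2) ∧
        0 < M (x * q.1, q.2.1) (1, 0) (1, 0) - angularB M w (x * q.1, q.2.1)
          ((angularG M w (x * q.1, q.2.1)).inverse (angularB M w (x * q.1, q.2.1))) := by
  set κ : ℝ := (1 + τ) / 2 with hκ
  set U' : Set (ℝ × E) := Ioo (1 / 4 : ℝ) 4 ×ˢ Metric.ball θc ρ with hU'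
  have hU'o : IsOpen U' := isOpen_Ioo.prod Metric.isOpen_ball
  have hbo := isOpen_scaledBox θc ρ
  have hK : IsCompact (Metric.closedBall θc ρ) := isCompact_closedBall θc ρ
  have hUK : Metric.ball θc ρ ⊆ Metric.closedBall θc ρ := Metric.ball_subset_closedBall
  -- the coefficients `a - 1`, `b`, `g`, `w` and the inverse of `g`, multiplied by the powers of `x`
  -- that compensate their decay
  let al : ℝ → ℝ × E → ℝ := fun x p => x ^ (1 + τ) * (M (x * p.1, p.2) (1, 0) (1, 0) - 1)
  let be : ℝ → ℝ × E → (E →L[ℝ] ℝ) := fun x p => x ^ κ • angularB M w (x * p.1, p.2)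
  let ga : ℝ → ℝ × E → (E →L[ℝ] E →L[ℝ] ℝ) := fun x p => angularG M w (x * p.1, p.2)
  let om : ℝ → ℝ × E → ℝ := fun x p => x ^ κ * w (x * p.1)
  let gi : ℝ → ℝ × E → ((E →L[ℝ] ℝ) →L[ℝ] E) := fun x p => (ga x p).inverse
  set x₁ : ℝ := max 1 (4 * R) with hx₁
  have hx₁1 : 1 ≤ x₁ := le_max_left _ _
  have hx₁R : 4 * R ≤ x₁ := le_max_right _ _
  have hal : SmoothFamily (Ioi x₁) U' al := by
    have := h.a_symbol.smoothFamily h.isOpen hx₁1 hx₁R Metric.isOpen_ball hUK hK hball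
    simpa only [neg_neg] using this
  have hbe : SmoothFamily (Ioi x₁) U' be := by
    refine SmoothFamily.of_apply hU'o fun u => ?_
    have := (h.b_symbol u).smoothFamily h.isOpen hx₁1 hx₁R Metric.isOpen_ball hUK hK hball
    simp only [neg_neg] at this
    exact this
  have hom : SmoothFamily (Ioi x₁) U' om := by
    have := (h.w_symbol.isSymbol (V := V)).smoothFamily h.isOpen hx₁1 hx₁R Metric.isOpen_ball hUK
      hK hball
    simpa only [neg_neg] using this
  have hga0 : SmoothFamily (Ioi x₁) U'
      (fun x p => x ^ τ • (angularG M w (x * p.1, p.2) - gbar p.2)) := by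
    refine SmoothFamily.of_apply hU'o fun u =>
      SmoothFamily.of_apply hU'o fun v => ?_
    have := (h.g_symbol u v).smoothFamily h.isOpen hx₁1 hx₁R Metric.isOpen_ball hUK hK hball
    simp only [neg_neg] at this
    exact this
  have hpow (a : ℝ) (ha : a ≤ 0) : SmoothFamily (Ioi x₁) U' (fun x _ => x ^ a) := by
    refine SmoothFamily.of_index (C := 1) (fun x hx => ?_) fun x hx => ?_
    · have hx0 : x ≠ 0 := by have : x₁ < x := hx; linarith
      exact (Real.contDiffAt_rpow_const_of_ne hx0).contDiffWithinAt
    · have hx0 : 1 ≤ x := by have : x₁ < x := hx; linarith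
      rw [Real.norm_of_nonneg (by positivity)]
      exact Real.rpow_le_one_of_one_le_of_nonpos hx0 ha
  have hgb : SmoothFamily (Ioi x₁) U' (fun (_ : ℝ) (p : ℝ × E) => gbar p.2) := by
    refine SmoothFamily.of_contDiffOn (V := univ ×ˢ V)
      (K := Icc (1 / 4 : ℝ) 4 ×ˢ Metric.closedBall θc ρ) (isOpen_univ.prod h.isOpen)
      (isCompact_Icc.prod hK) (prod_mono (subset_univ _) hball)
      (prod_mono Ioo_subset_Icc_self hUK) ?_
    exact h.gbar_smooth.comp contDiffOn_snd fun p hp => hp.2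
  have hga : SmoothFamily (Ioi x₁) U' ga := by
    refine ((SmoothFamily.smul hU'o (hpow (-τ) (by linarith)) hga0).add hU'o hgb).congr hU'o
      fun x hx p _ => ?_
    have hx0 : 0 < x := by have : x₁ < x := hx; linarith
    rw [smul_smul, ← Real.rpow_add hx0]
    simp [ga]
  -- far out, `g` takes values in a compact set of invertible forms
  have hinvo : IsOpen {B : E →L[ℝ] E →L[ℝ] ℝ | B.IsInvertible} := ContinuousLinearEquiv.isOpen
  obtain ⟨δ, hδ, hKδ⟩ := (hK.image_of_continuousOn
    (h.gbar_smooth.continuousOn.mono hball)).exists_cthickening_subset_open hinvo (by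
      rintro _ ⟨θ, hθ, rfl⟩
      exact isInvertible_of_pos (h.gbar_pos θ (hball hθ)))
  have hKcpt : IsCompact (Metric.cthickening δ (gbar '' Metric.closedBall θc ρ)) :=
    (hK.image_of_continuousOn (h.gbar_smooth.continuousOn.mono hball)).cthickening
  obtain ⟨C₁, hC₁, hga0b⟩ := hga0.bound_zero
  obtain ⟨x₂, hx₂, hx₂b⟩ : ∃ x₂, x₁ ≤ x₂ ∧ ∀ x, x₂ < x → x ^ (-τ) * C₁ ≤ δ := by
    have h1 : Tendsto (fun x : ℝ => x ^ (-τ) * C₁) atTop (𝓝 (0 * C₁)) :=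
      (tendsto_rpow_neg_atTop hτ).mul_const _
    rw [zero_mul] at h1
    obtain ⟨x₂, hx₂⟩ := eventually_atTop.1 (h1.eventually (Iic_mem_nhds hδ))
    exact ⟨max x₁ x₂, le_max_left _ _, fun x hx => hx₂ x ((le_max_right _ _).trans hx.le)⟩
  have hI₂ : Ioi x₂ ⊆ Ioi x₁ := Ioi_subset_Ioi hx₂
  have hgi : SmoothFamily (Ioi x₂) U' gi := by
    refine SmoothFamily.comp_smooth hU'o (hga.mono hI₂ Subset.rfl) hinvo hKcpt hKδ
      (g := ContinuousLinearMap.inverse) (fun B hB =>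
        (ContinuousLinearMap.IsInvertible.contDiffAt_map_inverse hB).contDiffWithinAt)
      fun x hx p hp => ?_
    have hx0 : 0 < x := by have : x₁ < x := hI₂ hx; linarith
    refine Metric.mem_cthickening_of_dist_le _ (gbar p.2) _ _ ⟨p.2, hUK hp.2, rfl⟩ ?_
    have h1 : ga x p - gbar p.2 = x ^ (-τ) • (x ^ τ • (angularG M w (x * p.1, p.2) - gbar p.2)) := by
      rw [smul_smul, ← Real.rpow_add hx0]
      simp [ga]
    rw [dist_eq_norm, h1, norm_smul, Real.norm_of_nonneg (by positivity)]
    exact (mul_le_mul_of_nonneg_left (hga0b x (hI₂ hx) p hp) (by positivity)).trans (hx₂b x hx)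
  -- functions on the box
  have hpr : SmoothFamily (Ioi x₂) (scaledBox θc ρ)
      (fun (_ : ℝ) (q : ℝ × E × (E →L[ℝ] ℝ)) => (q.1, q.2.1)) :=
    SmoothFamily.of_contDiff (isBounded_scaledBox θc ρ)
      (contDiff_fst.prodMk (contDiff_fst.comp contDiff_snd))
  have hη : SmoothFamily (Ioi x₂) (scaledBox θc ρ)
      (fun (_ : ℝ) (q : ℝ × E × (E →L[ℝ] ℝ)) => q.2.2) :=
    SmoothFamily.of_contDiff (isBounded_scaledBox θc ρ) (contDiff_snd.comp contDiff_snd)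
  have hmp : ∀ i ∈ Ioi x₂, ∀ q ∈ scaledBox θc ρ, ((q.1, q.2.1) : ℝ × E) ∈ U' :=
    fun _ _ q hq => ⟨hq.1, hq.2.1⟩
  have lal := hpr.comp hbo hU'o (hal.mono hI₂ Subset.rfl) hmp
  have lbe := hpr.comp hbo hU'o (hbe.mono hI₂ Subset.rfl) hmp
  have lom := hpr.comp hbo hU'o (hom.mono hI₂ Subset.rfl) hmp
  have lgi := hpr.comp hbo hU'o hgi hmp
  have ls := hpr.comp hbo hU'o ((hpow (-(1 + τ)) (by linarith)).mono hI₂ Subset.rfl) hmp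
  have ldal := hpr.comp hbo hU'o ((hal.fderiv isOpen_Ioi hU'o).mono hI₂ Subset.rfl) hmp
  have ldbe := hpr.comp hbo hU'o ((hbe.fderiv isOpen_Ioi hU'o).mono hI₂ Subset.rfl) hmp
  have ldga := hpr.comp hbo hU'o ((hga.fderiv isOpen_Ioi hU'o).mono hI₂ Subset.rfl) hmp
  -- `x ^ (-1 - τ) * NN` is the angular part `w² |η|²` of the energy, and
  -- `1 + x ^ (-1 - τ) * PP` is `a - |b|²`
  let NN : ℝ → ℝ × E × (E →L[ℝ] ℝ) → ℝ := fun x q =>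
    om x (q.1, q.2.1) ^ 2 * q.2.2 (gi x (q.1, q.2.1) q.2.2)
  let PP : ℝ → ℝ × E × (E →L[ℝ] ℝ) → ℝ := fun x q =>
    al x (q.1, q.2.1) - be x (q.1, q.2.1) (gi x (q.1, q.2.1) (be x (q.1, q.2.1)))
  have hNN : SmoothFamily (Ioi x₂) (scaledBox θc ρ) NN := by
    have := (lom.mul hbo lom).mul hbo (hη.clm_apply hbo (lgi.clm_apply hbo hη))
    simpa only [← sq] using this
  have hPP : SmoothFamily (Ioi x₂) (scaledBox θc ρ) PP :=
    lal.sub hbo (lbe.clm_apply hbo (lgi.clm_apply hbo lbe))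
  obtain ⟨CN, hCN, hNNb⟩ := hNN.bound_zero
  obtain ⟨CP, hCP, hPPb⟩ := hPP.bound_zero
  obtain ⟨x₃, hx₃, hx₃b⟩ : ∃ x₃, x₂ ≤ x₃ ∧ ∀ x, x₃ < x → x ^ (-(1 + τ)) * (CN + CP) ≤ 1 / 2 := by
    have h1 : Tendsto (fun x : ℝ => x ^ (-(1 + τ)) * (CN + CP)) atTop (𝓝 (0 * (CN + CP))) :=
      (tendsto_rpow_neg_atTop (by linarith)).mul_const _
    rw [zero_mul] at h1
    obtain ⟨x₃, hx₃⟩ := eventually_atTop.1 (h1.eventually (Iic_mem_nhds (by norm_num : (0 : ℝ) < 1 / 2)))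
    exact ⟨max x₂ x₃, le_max_left _ _, fun x hx => hx₃ x ((le_max_right _ _).trans hx.le)⟩
  have hI₃ : Ioi x₃ ⊆ Ioi x₂ := Ioi_subset_Ioi hx₃
  have hpos₃ : ∀ x ∈ Ioi x₃, 0 < x := fun x hx => by
    have : x₁ < x := hI₂ (hI₃ hx); linarith
  have hsN : ∀ x ∈ Ioi x₃, ∀ q ∈ scaledBox θc ρ, |x ^ (-(1 + τ)) * NN x q| ≤ 1 / 2 ∧
      |x ^ (-(1 + τ)) * PP x q| ≤ 1 / 2 := by
    intro x hx q hq
    have hx0 := hpos₃ x hx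
    have hs0 : 0 ≤ x ^ (-(1 + τ)) := by positivity
    have h1 := hNNb x (hI₃ hx) q hq
    have h2 := hPPb x (hI₃ hx) q hq
    have h3 := hx₃b x hx
    rw [Real.norm_eq_abs] at h1 h2
    rw [abs_mul _ (NN x q), abs_mul _ (PP x q), abs_of_nonneg hs0]
    constructor <;> nlinarith
  let DD : ℝ → ℝ × E × (E →L[ℝ] ℝ) → ℝ := fun x q => 1 + x ^ (-(1 + τ)) * PP x q
  have hDD : SmoothFamily (Ioi x₃) (scaledBox θc ρ) DD :=
    (SmoothFamily.const 1).add hbo ((ls.mono hI₃ Subset.rfl).mul hbo (hPP.mono hI₃ Subset.rfl))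
  have hDDb : ∀ x ∈ Ioi x₃, ∀ q ∈ scaledBox θc ρ, 1 / 2 ≤ DD x q ∧ DD x q ≤ 2 := fun x hx q hq => by
    have := abs_le.1 (hsN x hx q hq).2
    constructor <;> simp only [DD] <;> linarith
  have hDDi := hDD.inv hbo (c := 1 / 2) (by norm_num) fun x hx q hq => (hDDb x hx q hq).1
  have hNN1 : ∀ x ∈ Ioi x₃, ∀ q ∈ scaledBox θc ρ, 1 / 2 ≤ 1 - x ^ (-(1 + τ)) * NN x q :=
    fun x hx q hq => by
      have := abs_le.1 (hsN x hx q hq).1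
      linarith
  -- the radial speed
  let xi : ℝ → ℝ × E × (E →L[ℝ] ℝ) → ℝ := fun x q =>
    Real.sqrt ((1 - x ^ (-(1 + τ)) * NN x q) * (DD x q)⁻¹)
  have hxi : SmoothFamily (Ioi x₃) (scaledBox θc ρ) xi := by
    refine SmoothFamily.sqrt hbo (c := 1 / 4) ((SmoothFamily.sub hbo (SmoothFamily.const 1)
      ((ls.mono hI₃ Subset.rfl).mul hbo (hNN.mono hI₃ Subset.rfl))).mul hbo hDDi) (by norm_num)
      fun x hx q hq => ?_
    have h1 := hNN1 x hx q hq
    have h2 := hDDb x hx q hq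
    have h3 : (1 : ℝ) / 2 ≤ (DD x q)⁻¹ := by
      rw [one_div]
      exact inv_anti₀ (by linarith) h2.2
    nlinarith
  have hxi0 : ∀ x q, 0 ≤ xi x q := fun x q => Real.sqrt_nonneg _
  have hxi1 : SmoothFamily (Ioi x₃) (scaledBox θc ρ) (fun x q => (xi x q + 1)⁻¹) :=
    (hxi.add hbo (SmoothFamily.const 1)).inv hbo (c := 1) one_pos fun x _ q _ => by
      linarith [hxi0 x q]
  -- the angular velocity divided by `w`, rescaled
  let ze : ℝ → ℝ × E × (E →L[ℝ] ℝ) → E := fun x q =>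
    om x (q.1, q.2.1) • gi x (q.1, q.2.1) q.2.2 - xi x q • gi x (q.1, q.2.1) (be x (q.1, q.2.1))
  have hze : SmoothFamily (Ioi x₃) (scaledBox θc ρ) ze :=
    (SmoothFamily.smul hbo (lom.mono hI₃ Subset.rfl)
      ((lgi.clm_apply hbo hη).mono hI₃ Subset.rfl)).sub hbo
      (SmoothFamily.smul hbo hxi ((lgi.clm_apply hbo lbe).mono hI₃ Subset.rfl))
  -- twice the rescaled angular force
  let fo : ℝ → ℝ × E × (E →L[ℝ] ℝ) → E → ℝ := fun x q y =>
    fderiv ℝ (al x) (q.1, q.2.1) (0, y) * xi x q * xi x q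
      + 2 * xi x q * fderiv ℝ (be x) (q.1, q.2.1) (0, y) (ze x q)
      + fderiv ℝ (ga x) (q.1, q.2.1) (0, y) (ze x q) (ze x q)
  have hfo (y : E) : SmoothFamily (Ioi x₃) (scaledBox θc ρ) (fun x q => fo x q y) := by
    have e1 := (ldal.clm_comp hbo (ContinuousLinearMap.apply ℝ ℝ ((0, y) : ℝ × E))).mono hI₃
      (Subset.refl (scaledBox θc ρ))
    have e2 := (ldbe.clm_comp hbo (ContinuousLinearMap.apply ℝ (E →L[ℝ] ℝ) ((0, y) : ℝ × E))).mono
      hI₃ (Subset.refl (scaledBox θc ρ))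
    have e3 := (ldga.clm_comp hbo
      (ContinuousLinearMap.apply ℝ (E →L[ℝ] E →L[ℝ] ℝ) ((0, y) : ℝ × E))).mono
      hI₃ (Subset.refl (scaledBox θc ρ))
    exact (((e1.mul hbo hxi).mul hbo hxi).add hbo
      (((SmoothFamily.const 2).mul hbo hxi).mul hbo (e2.clm_apply hbo hze))).add hbo
      ((e3.clm_apply hbo hze).clm_apply hbo hze)
  have hspeed : ∀ x ∈ Ioi x₃, ∀ q, radialSpeed M w (x * q.1, q.2.1) q.2.2 = xi x q :=
    fun x hx q => radialSpeed_eq (hpos₃ x hx) _ _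
  have hang : ∀ x ∈ Ioi x₃, ∀ q, x ^ κ • angularSpeed M w (x * q.1, q.2.1) q.2.2 = ze x q := by
    intro x hx q
    simp only [angularSpeed, ze, hspeed x hx q, smul_sub, smul_smul, be, map_smul, gi, ga, om]
    rw [mul_comm (xi x q)]
  have hmem : ∀ x ∈ Ioi x₃, ∀ q ∈ scaledBox θc ρ, R < x * q.1 ∧ q.2.1 ∈ V := by
    intro x hx q hq
    have h1 : x₁ < x := hI₂ (hI₃ hx)
    have h2 : (1 : ℝ) / 4 < q.1 := hq.1.1
    exact ⟨by nlinarith [hpos₃ x hx], hball (hUK hq.2.1)⟩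
  have hforce : ∀ x ∈ Ioi x₃, ∀ q ∈ scaledBox θc ρ, ∀ y,
      x ^ (1 + τ) * angularForce M w (x * q.1, q.2.1) q.2.2 y = 1 / 2 * fo x q y := by
    intro x hx q hq y
    have hx1 := hI₂ (hI₃ hx)
    have hqU : ((q.1, q.2.1) : ℝ × E) ∈ U' := ⟨hq.1, hq.2.1⟩
    have hz := hmem x hx q hq
    have d1 : fderiv ℝ (al x) (q.1, q.2.1) (0, y) =
        x ^ (1 + τ) * fderiv ℝ (fun θ => M (x * q.1, θ) (1, 0) (1, 0)) q.2.1 y := by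
      rw [fderiv_apply_inr (((hal.slice hx1).contDiffAt (hU'o.mem_nhds hqU)).differentiableAt
        (by simp))]
      simp only [al]
      have := congrFun (fderiv_const_smul_field (𝕜 := ℝ) (x ^ (1 + τ))
        (f := fun θ => M (x * q.1, θ) (1, 0) (1, 0) - 1)) q.2.1
      simp only [Pi.smul_def, smul_eq_mul, fderiv_sub_const] at this
      rw [this]
      rfl
    have d2 : fderiv ℝ (be x) (q.1, q.2.1) (0, y) =
        x ^ κ • fderiv ℝ (fun θ => angularB M w (x * q.1, θ)) q.2.1 y := by
      rw [fderiv_apply_inr (((hbe.slice hx1).contDiffAt (hU'o.mem_nhds hqU)).differentiableAt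
        (by simp))]
      have := congrFun (fderiv_const_smul_field (𝕜 := ℝ) (x ^ κ)
        (f := fun θ => angularB M w (x * q.1, θ))) q.2.1
      simp only [Pi.smul_def] at this
      simp only [be]
      rw [this]
      rfl
    have d3 : fderiv ℝ (ga x) (q.1, q.2.1) (0, y) =
        fderiv ℝ (fun θ => angularG M w (x * q.1, θ)) q.2.1 y :=
      fderiv_apply_inr (((hga.slice hx1).contDiffAt (hU'o.mem_nhds hqU)).differentiableAt
        (by simp)) y
    have hk := rpow_half_mul_self (hpos₃ x hx) τ
    rw [angularForce_apply]
    dsimp only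
    rw [fderiv_metric_decomposition h hz.1 hz.2]
    simp only [fo, d1, d2, d3, ← hang x hx q, hspeed x hx q, map_smul, smul_apply, smul_eq_mul]
    rw [← hk]
    ring
  refine ⟨x₃, by linarith, by linarith, ?_, ?_⟩
  · have hfo' : SmoothFamily (Ioi x₃) (scaledBox θc ρ)
        (fun x q => x ^ (1 + τ) • angularForce M w (x * q.1, q.2.1) q.2.2) :=
      SmoothFamily.of_apply hbo fun y =>
        (((SmoothFamily.const (1 / 2)).mul hbo (hfo y)).congr hbo
          fun x hx q hq => by
            simpa only [smul_apply, smul_eq_mul] using hforce x hx q hq y)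
    -- the factor `x ^ (-1 - τ)` of the excess speed shows up in `xi - 1 = (xi² - 1) / (xi + 1)`
    refine ((((hNN.mono hI₃ Subset.rfl).add hbo (hPP.mono hI₃ Subset.rfl)).neg hbo |>.mul hbo
      hDDi |>.mul hbo hxi1).prodMk hbo
      ((SmoothFamily.smul hbo (lom.mono hI₃ Subset.rfl) hze).prodMk hbo hfo')).congr
        hbo fun x hx q hq => ?_
    have hx0 := hpos₃ x hx
    have h1 : x ^ (-(1 + τ)) * x ^ (1 + τ) = 1 := by rw [← Real.rpow_add hx0]; simp
    simp only [reducedField, Prod.smul_mk, Prod.mk.injEq, smul_eq_mul, and_true]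
    constructor
    · rw [hspeed x hx q]
      have hD := (hDDb x hx q hq).1
      have hsq : xi x q * xi x q = (1 - x ^ (-(1 + τ)) * NN x q) * (DD x q)⁻¹ :=
        Real.mul_self_sqrt (mul_nonneg (by linarith [hNN1 x hx q hq]) (by positivity))
      have hx1 : xi x q + 1 ≠ 0 := by linarith [hxi0 x q]
      have hD0 : DD x q ≠ 0 := by linarith
      rw [eq_mul_inv_iff_mul_eq₀ hx1, eq_mul_inv_iff_mul_eq₀ hD0]
      have hsq' : xi x q * xi x q * DD x q = 1 - x ^ (-(1 + τ)) * NN x q := by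
        rw [hsq, inv_mul_cancel_right₀ hD0]
      have hDe : DD x q = 1 + x ^ (-(1 + τ)) * PP x q := rfl
      linear_combination (x ^ (1 + τ)) * hsq' - x ^ (1 + τ) * hDe - (NN x q + PP x q) * h1
    · rw [← hang x hx q, smul_smul, smul_smul, ← rpow_half_mul_self hx0 τ]
      simp only [om]
      congr 1
      ring
  · intro x hx q hq
    have hx0 := hpos₃ x hx
    have h1 : x ^ (-(1 + τ)) * x ^ (1 + τ) = 1 := by rw [← Real.rpow_add hx0]; simp
    have h2 := rpow_half_mul_self hx0 τ
    have hN := hNN1 x hx q hq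
    have hD := (hDDb x hx q hq).1
    simp only [NN, DD, PP, om, al, be, gi, ga, map_smul, smul_apply, smul_eq_mul] at hN hD
    generalize q.2.2 ((angularG M w (x * q.1, q.2.1)).inverse q.2.2) = n at *
    generalize angularB M w (x * q.1, q.2.1)
      ((angularG M w (x * q.1, q.2.1)).inverse (angularB M w (x * q.1, q.2.1))) = m at *
    constructor
    · have : x ^ (-(1 + τ)) * ((x ^ κ * w (x * q.1)) ^ 2 * n) = w (x * q.1) ^ 2 * n := by
        linear_combination (w (x * q.1) ^ 2 * n) * h1
          + (x ^ (-(1 + τ)) * (w (x * q.1) ^ 2 * n)) * h2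
      linarith
    · have : x ^ (-(1 + τ)) * (x ^ (1 + τ) * (M (x * q.1, q.2.1) (1, 0) (1, 0) - 1)
          - x ^ κ * (x ^ κ * m)) = M (x * q.1, q.2.1) (1, 0) (1, 0) - 1 - m := by
        linear_combination (M (x * q.1, q.2.1) (1, 0) (1, 0) - 1 - m) * h1
          - (x ^ (-(1 + τ)) * m) * h2
      linarith

end ScaledSystem

/-! ### The truncated equations as a smooth family -/

section Retraction

variable {N Q Q' Y : Type*} [NormedAddCommGroup N] [NormedSpace ℝ N] [NormedAddCommGroup Q]
  [NormedSpace ℝ Q] [NormedAddCommGroup Q'] [NormedSpace ℝ Q'] [NormedAddCommGroup Y]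
  [NormedSpace ℝ Y]

/-- A smooth map with bounded derivatives which is the identity on a ball and takes values in a
larger ball. -/
theorem exists_retraction [FiniteDimensional ℝ Q] (I : Set N) (c : Q) {ρ : ℝ} (hρ : 0 < ρ) :
    ∃ κ : Q → Q, SmoothFamily I univ (fun _ => κ) ∧ (∀ q ∈ Metric.closedBall c ρ, κ q = q) ∧
      ∀ q, κ q ∈ Metric.ball c (2 * ρ) := by
  let χ : ContDiffBump c := ⟨ρ, 2 * ρ, hρ, by linarith⟩
  have hsm : ContDiff ℝ ∞ (fun q => χ q • (q - c)) :=
    χ.contDiff.smul (contDiff_id.sub contDiff_const)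
  have hcs : HasCompactSupport (fun q => χ q • (q - c)) := χ.hasCompactSupport.smul_right
  have h1 : SmoothFamily I univ (fun (_ : N) q => χ q • (q - c)) := by
    refine ⟨(hsm.comp contDiff_snd).contDiffOn, fun n => ?_⟩
    obtain ⟨C, hC⟩ := (hsm.continuous_iteratedFDeriv (m := n)
      (by exact_mod_cast le_top)).bounded_above_of_compact_support (hcs.iteratedFDeriv n)
    exact ⟨C, fun _ _ q _ => hC q⟩
  refine ⟨fun q => c + χ q • (q - c), (SmoothFamily.const c).add isOpen_univ h1,
    fun q hq => ?_, fun q => ?_⟩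
  · dsimp only
    rw [χ.one_of_mem_closedBall hq, one_smul, add_sub_cancel]
  · rw [Metric.mem_ball, dist_eq_norm, add_sub_cancel_left, norm_smul,
      Real.norm_of_nonneg χ.nonneg]
    by_cases hq : q ∈ Metric.ball c (2 * ρ)
    · rw [Metric.mem_ball, dist_eq_norm] at hq
      exact (mul_le_of_le_one_left (norm_nonneg _) χ.le_one).trans_lt hq
    · have : χ q = 0 := χ.zero_of_le_dist (by simpa using hq)
      rw [this, zero_mul]
      linarith

/-- Precomposition of a smooth family, defined on the whole space, with affine maps whose linear
parts are bounded. -/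
theorem SmoothFamily.comp_affine {I : Set N} {g : N → Q' → Y} (hg : SmoothFamily I univ g)
    {c : N → Q'} {L : N → (Q →L[ℝ] Q')} (hc : ContDiffOn ℝ ∞ c I) (hL : ContDiffOn ℝ ∞ L I)
    {C : ℝ} (hC : ∀ i ∈ I, ‖L i‖ ≤ C) : SmoothFamily I univ (fun i q => g i (c i + L i q)) := by
  refine ⟨?_, fun n => ?_⟩
  · have h1 : ContDiffOn ℝ ∞ (fun p : N × Q => (p.1, c p.1 + L p.1 p.2)) (I ×ˢ univ) :=
      contDiffOn_fst.prodMk ((hc.comp contDiffOn_fst fun p hp => hp.1).add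
        ((hL.comp contDiffOn_fst fun p hp => hp.1).clm_apply contDiffOn_snd))
    exact hg.contDiffOn.comp h1 fun p hp => ⟨hp.1, mem_univ _⟩
  · obtain ⟨A, hA⟩ := hg.bound n
    refine ⟨A * C ^ n, fun i hi q _ => ?_⟩
    have hd : ContDiff ℝ ∞ (g i) := contDiffOn_univ.1 (hg.slice hi)
    have hd' : ContDiff ℝ ∞ (fun y => g i (c i + y)) := hd.comp (contDiff_const.add contDiff_id)
    have h1 := (L i).iteratedFDeriv_comp_right (hd'.of_le (m := (n : ℕ∞ω)) (by exact_mod_cast le_top))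
      q le_rfl
    have h2 : (fun q => g i (c i + L i q)) = (fun y => g i (c i + y)) ∘ L i := rfl
    rw [h2, h1, iteratedFDeriv_comp_add_left]
    refine (ContinuousMultilinearMap.norm_compContinuousLinearMap_le _ _).trans ?_
    rw [Finset.prod_const, Finset.card_univ, Fintype.card_fin]
    have hA0 : 0 ≤ A := (norm_nonneg _).trans (hA i hi (c i + L i q) (mem_univ _))
    exact mul_le_mul (hA i hi _ (mem_univ _)) (pow_le_pow_left₀ (norm_nonneg _) (hC i hi) n)
      (by positivity) hA0

theorem SmoothFamily.norm_sub_le {I : Set N} {g : N → Q → Y} (hg : SmoothFamily I univ g) :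
    ∃ C : ℝ, 0 ≤ C ∧ ∀ i ∈ I, ∀ q q', ‖g i q - g i q'‖ ≤ C * ‖q - q'‖ := by
  obtain ⟨C, hC0, hC⟩ := hg.bound_fderiv
  refine ⟨C, hC0, fun i hi q q' => ?_⟩
  have hd : ContDiff ℝ ∞ (g i) := contDiffOn_univ.1 (hg.slice hi)
  exact convex_univ.norm_image_sub_le_of_norm_fderiv_le (𝕜 := ℝ) (f := g i)
    (fun z _ => hd.differentiable (by simp) z) (fun z _ => hC i hi z (mem_univ _)) (mem_univ _)
    (mem_univ _)

end Retraction

section LocalFlow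

variable {E : Type*} [NormedAddCommGroup E] [NormedSpace ℝ E] {R τ : ℝ}
  {V : Set E} {M : ℝ × E → (ℝ × E) →L[ℝ] (ℝ × E) →L[ℝ] ℝ} {w : ℝ → ℝ}
  {gbar : E → E →L[ℝ] E →L[ℝ] ℝ}

/-- The variables of the reduced system: the excess `x - r - t`, the angular variable, and the
angular momentum. -/
abbrev FlowState (E : Type*) [NormedAddCommGroup E] [NormedSpace ℝ E] := ℝ × E × (E →L[ℝ] ℝ)

/-- The rescaled variables at time `t` of a trajectory started at `x = r` and run with speed `l`. -/
def scaledState (r t l : ℝ) (u : FlowState E) : FlowState E :=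
  ((r + bracket t)⁻¹ * (r + l * t + u.1), u.2)

theorem abs_sub_bracket_le {t : ℝ} (ht : -1 < t) : |t - bracket t| ≤ 3 := by
  have h1 := bracket_le_one_add_abs t
  have h2 := abs_le_bracket t
  rcases le_or_gt 0 t with h | h
  · rw [abs_of_nonneg h] at h1 h2
    rw [abs_le]; constructor <;> linarith
  · rw [abs_of_neg h] at h1 h2
    rw [abs_le]; constructor <;> linarith

theorem scaledState_mem {θc : E} {ρ r t l : ℝ} (hρ : 0 < ρ) (hr1 : 1 ≤ r)
    (hr : 8 ≤ ρ * r) {θ : E} (hθ : θ ∈ Metric.closedBall θc (ρ / 2)) {u : FlowState E}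
    (hu : ‖u - (0, θ, 0)‖ ≤ ρ / 2) (ht : |l * t - bracket t| ≤ ρ / 4 * |t| + 3) :
    scaledState r t l u ∈ Metric.closedBall ((1, θc, 0) : FlowState E) ρ := by
  have hb := one_le_bracket t
  have hσ : 0 < r + bracket t := by linarith
  have h1 : ‖u.1‖ ≤ ρ / 2 := by
    have := (norm_fst_le (u - ((0, θ, 0) : FlowState E))).trans hu
    simpa using this
  have h2 := (norm_snd_le (u - ((0, θ, 0) : FlowState E))).trans hu
  have h3 : ‖u.2.1 - θ‖ ≤ ρ / 2 := by
    have := (norm_fst_le (u - ((0, θ, 0) : FlowState E)).2).trans h2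
    simpa using this
  have h4 : ‖u.2.2‖ ≤ ρ / 2 := by
    have := (norm_snd_le (u - ((0, θ, 0) : FlowState E)).2).trans h2
    simpa using this
  rw [Metric.mem_closedBall, Prod.dist_eq, Prod.dist_eq]
  refine max_le ?_ (max_le ?_ ?_)
  · rw [Real.dist_eq]
    have e : (r + bracket t)⁻¹ * (r + l * t + u.1) - 1 =
        (r + bracket t)⁻¹ * (l * t - bracket t + u.1) := by field_simp; ring
    change |(r + bracket t)⁻¹ * (r + l * t + u.1) - 1| ≤ ρ
    rw [e, abs_mul, abs_of_pos (inv_pos.2 hσ), inv_mul_le_iff₀ hσ]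
    rw [Real.norm_eq_abs] at h1
    have h5 := abs_add_le (l * t - bracket t) u.1
    have h6 := abs_le_bracket t
    nlinarith
  · change dist u.2.1 θc ≤ ρ
    have h5 := dist_triangle u.2.1 θ θc
    rw [Metric.mem_closedBall] at hθ
    rw [dist_eq_norm u.2.1 θ] at h5
    linarith
  · change dist u.2.2 0 ≤ ρ
    rw [dist_zero_right]
    linarith

theorem ball_subset_scaledBox {θc : E} {ρ : ℝ} (hρ4 : ρ ≤ 1 / 4) :
    Metric.ball ((1, θc, 0) : FlowState E) (2 * ρ) ⊆ scaledBox θc (2 * ρ) := by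
  intro q hq
  rw [Metric.mem_ball, Prod.dist_eq, Prod.dist_eq, max_lt_iff, max_lt_iff, Real.dist_eq,
    abs_lt] at hq
  simp only [] at hq
  refine ⟨⟨by linarith [hq.1.1], by linarith [hq.1.2]⟩, hq.2.1, ?_⟩
  rw [Metric.mem_ball]
  linarith [hq.2.2]

variable [FiniteDimensional ℝ E]

/-- The truncated right-hand side of the reduced system, with the weight `(r + ⟨t⟩)^{-1-τ}` taken
out, and its uniform smoothness in the state and the speed `l`. Where the truncation is inactive it
is the right-hand side of the reduced system. -/
theorem IsAsymptotic.exists_truncation (hτ : 0 < τ) (h : IsAsymptotic R τ V M w gbar) {θc : E}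
    {ρ : ℝ} (hρ : 0 < ρ) (hρ4 : ρ ≤ 1 / 4) (hball : Metric.closedBall θc (2 * ρ) ⊆ V) :
    ∃ x₀ : ℝ, 1 ≤ x₀ ∧ 4 * R ≤ x₀ ∧ ∃ f : ℝ × ℝ → ℝ × FlowState E → FlowState E,
      SmoothFamily (Ioi x₀ ×ˢ univ) univ f ∧
      (∀ r, x₀ < r → ∀ t l : ℝ, |l| ≤ 2 → ∀ u : FlowState E,
        scaledState r t l u ∈ Metric.closedBall ((1, θc, 0) : FlowState E) ρ →
        (r + bracket t) ^ (-1 - τ) • f (r, t) (l, u) =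
          l • reducedField M w (r + l * t + u.1, u.2)) ∧
      (∀ r, x₀ < r → ∀ t l : ℝ, ∀ u : FlowState E,
        scaledState r t l u ∈ Metric.closedBall ((1, θc, 0) : FlowState E) ρ →
        R < r + l * t + u.1 ∧
        0 < 1 - w (r + l * t + u.1) ^ 2
          * u.2.2 ((angularG M w (r + l * t + u.1, u.2.1)).inverse u.2.2) ∧
        0 < M (r + l * t + u.1, u.2.1) (1, 0) (1, 0) - angularB M w (r + l * t + u.1, u.2.1)
          ((angularG M w (r + l * t + u.1, u.2.1)).inverse
            (angularB M w (r + l * t + u.1, u.2.1)))) := by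
  obtain ⟨x₀, hx₀, hx₀R, hF, hFpos⟩ := h.exists_smoothFamily hτ hball
  set I : Set (ℝ × ℝ) := Ioi x₀ ×ˢ univ with hI
  have hbr : ContDiff ℝ ∞ bracket := contDiff_bracket
  have hσ : ∀ i ∈ I, x₀ < i.1 + bracket i.2 := fun i hi => by
    have := one_le_bracket i.2
    have : x₀ < i.1 := hi.1
    linarith
  have hσs : ContDiff ℝ ∞ (fun i : ℝ × ℝ => i.1 + bracket i.2) :=
    contDiff_fst.add (hbr.comp contDiff_snd)
  -- `κ` truncates the rescaled state, `Λ` the speed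
  obtain ⟨κ, hκ, hκid, hκball⟩ := exists_retraction I ((1, θc, 0) : FlowState E) hρ
  obtain ⟨Λ, hΛ, hΛid, -⟩ := exists_retraction I (0 : ℝ) (two_pos : (0 : ℝ) < 2)
  -- the field, as a function on the whole space of rescaled variables
  have h1 : SmoothFamily I univ (fun i q => (i.1 + bracket i.2) ^ (1 + τ) •
      reducedField M w ((i.1 + bracket i.2) * (κ q).1, (κ q).2)) :=
    hκ.comp isOpen_univ (isOpen_scaledBox θc (2 * ρ))
      (hF.reindex (I' := I) hσs.contDiffOn hσ) fun _ _ q _ => ball_subset_scaledBox hρ4 (hκball q)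
  -- the affine change of variables
  let c : ℝ × ℝ → FlowState E := fun i => ((i.1 + bracket i.2)⁻¹ * i.1, 0)
  let L₀ : ℝ × FlowState E →L[ℝ] FlowState E :=
    (ContinuousLinearMap.inl ℝ ℝ (E × (E →L[ℝ] ℝ))).comp (ContinuousLinearMap.fst ℝ ℝ _)
  let L₁ : ℝ × FlowState E →L[ℝ] FlowState E :=
    (ContinuousLinearMap.inl ℝ ℝ (E × (E →L[ℝ] ℝ))).comp
      ((ContinuousLinearMap.fst ℝ ℝ _).comp (ContinuousLinearMap.snd ℝ ℝ _))
  let L₂ : ℝ × FlowState E →L[ℝ] FlowState E :=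
    (ContinuousLinearMap.inr ℝ ℝ (E × (E →L[ℝ] ℝ))).comp
      ((ContinuousLinearMap.snd ℝ ℝ _).comp (ContinuousLinearMap.snd ℝ ℝ _))
  let L : ℝ × ℝ → (ℝ × FlowState E →L[ℝ] FlowState E) := fun i =>
    ((i.1 + bracket i.2)⁻¹ * i.2) • L₀ + (i.1 + bracket i.2)⁻¹ • L₁ + L₂
  have hLe (r t l : ℝ) (u : FlowState E) : c (r, t) + L (r, t) (l, u) = scaledState r t l u := by
    simp only [c, L, L₀, L₁, L₂, scaledState]
    ext <;> simp
    ring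
  have hinv : ContDiffOn ℝ ∞ (fun i : ℝ × ℝ => (i.1 + bracket i.2)⁻¹) I :=
    hσs.contDiffOn.inv fun i hi => by have := hσ i hi; linarith
  have hcs : ContDiffOn ℝ ∞ c I := (hinv.mul contDiffOn_fst).prodMk contDiffOn_const
  have hLs : ContDiffOn ℝ ∞ L I :=
    (((hinv.mul contDiffOn_snd).smul contDiffOn_const).add (hinv.smul contDiffOn_const)).add
      contDiffOn_const
  have hLb : ∀ i ∈ I, ‖L i‖ ≤ ‖L₀‖ + ‖L₁‖ + ‖L₂‖ := by
    intro i hi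
    have hσi := hσ i hi
    have hi1 : x₀ < i.1 := hi.1
    have hpos : 0 < i.1 + bracket i.2 := by linarith
    have e1 : ‖(i.1 + bracket i.2)⁻¹ * i.2‖ ≤ 1 := by
      rw [norm_mul, norm_inv, Real.norm_of_nonneg hpos.le, inv_mul_le_iff₀ hpos, mul_one,
        Real.norm_eq_abs]
      linarith [abs_le_bracket i.2]
    have e2 : ‖(i.1 + bracket i.2)⁻¹‖ ≤ 1 := by
      rw [norm_inv, Real.norm_of_nonneg hpos.le]
      exact inv_le_one_of_one_le₀ (by linarith)
    refine (norm_add₃_le).trans ?_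
    rw [norm_smul, norm_smul]
    have := mul_le_of_le_one_left (norm_nonneg L₀) e1
    have := mul_le_of_le_one_left (norm_nonneg L₁) e2
    linarith
  have h2 := h1.comp_affine hcs hLs hLb
  have h3 : SmoothFamily I univ (fun (_ : ℝ × ℝ) (z : ℝ × FlowState E) => Λ z.1) := by
    have := hΛ.comp_affine (c := fun _ => 0)
      (L := fun _ => ContinuousLinearMap.fst ℝ ℝ (FlowState E)) contDiffOn_const contDiffOn_const
      fun _ _ => le_rfl
    simpa using this
  refine ⟨x₀, hx₀, hx₀R, _, SmoothFamily.smul isOpen_univ h3 h2, ?_, ?_⟩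
  · intro r hr t l hl u hu
    have hpos : 0 < r + bracket t := by linarith [one_le_bracket t]
    have e1 : Λ l = l := hΛid l (by simpa using hl)
    have e2 : (r + bracket t) * (scaledState r t l u).1 = r + l * t + u.1 := by
      simp only [scaledState]
      rw [mul_inv_cancel_left₀ hpos.ne']
    have e3 : (r + bracket t) ^ (-1 - τ) * (r + bracket t) ^ (1 + τ) = 1 := by
      rw [← Real.rpow_add hpos]; simp
    dsimp only
    rw [hLe, hκid _ hu, e1, e2, smul_comm, smul_smul ((r + bracket t) ^ (-1 - τ)), e3, one_smul]
    rfl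
  · intro r hr t l u hu
    have hpos : 0 < r + bracket t := by linarith [one_le_bracket t]
    have hbox : scaledState r t l u ∈ scaledBox θc (2 * ρ) := ball_subset_scaledBox hρ4
      (Metric.closedBall_subset_ball (by linarith) hu)
    have e2 : (r + bracket t) * (scaledState r t l u).1 = r + l * t + u.1 := by
      simp only [scaledState]
      rw [mul_inv_cancel_left₀ hpos.ne']
    have hσr : x₀ < r + bracket t := by linarith [one_le_bracket t]
    have h4 := hFpos _ hσr _ hbox
    rw [e2] at h4
    refine ⟨?_, h4⟩
    have h5 : (1 : ℝ) / 4 < (scaledState r t l u).1 := hbox.1.1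
    nlinarith

end LocalFlow

/-! ### Existence of the trajectories -/

open BoundedContinuousFunction

section LocalFlow

variable {E : Type*} [NormedAddCommGroup E] [NormedSpace ℝ E] {R τ : ℝ}
  {V : Set E} {M : ℝ × E → (ℝ × E) →L[ℝ] (ℝ × E) →L[ℝ] ℝ} {w : ℝ → ℝ}
  {gbar : E → E →L[ℝ] E →L[ℝ] ℝ}

/-- The constant trajectory at `(0, θ, 0)`, which depends linearly on `θ`. -/
def constantState (E : Type*) [NormedAddCommGroup E] [NormedSpace ℝ E] [FiniteDimensional ℝ E] :
    E →L[ℝ] (ℝ →ᵇ FlowState E) :=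
  LinearMap.toContinuousLinearMap
    { toFun := fun θ => BoundedContinuousFunction.const ℝ ((0, θ, 0) : FlowState E)
      map_add' := fun θ θ' => by ext t <;> simp
      map_smul' := fun a θ => by ext t <;> simp }

/-- The trajectory `v`, paired with the constant speed `l`. -/
def withSpeed (E : Type*) [NormedAddCommGroup E] [NormedSpace ℝ E] :
    ℝ × (ℝ →ᵇ FlowState E) →L[ℝ] (ℝ →ᵇ (ℝ × FlowState E)) :=
  (ContinuousLinearMap.smulRight (ContinuousLinearMap.fst ℝ ℝ (ℝ →ᵇ FlowState E))
      (BoundedContinuousFunction.const ℝ ((1, 0) : ℝ × FlowState E))) +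
    ((ContinuousLinearMap.inr ℝ ℝ (FlowState E)).compLeftContinuousBounded ℝ).comp
      (ContinuousLinearMap.snd ℝ ℝ (ℝ →ᵇ FlowState E))

theorem withSpeed_apply (l : ℝ) (v : ℝ →ᵇ FlowState E) (t : ℝ) :
    withSpeed E (l, v) t = (l, v t) := by
  ext <;> simp [withSpeed]

variable [FiniteDimensional ℝ E]

theorem constantState_apply (θ : E) (t : ℝ) : constantState E θ t = (0, θ, 0) := rfl

/-- The trajectories of the reduced system started at `x = r`, `θ` near `θc` and `η = 0`, and run
with speed `l` near `1`. They depend smoothly on `(l, θ)` as bounded functions on the line. The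
integrands `g` are the right-hand sides, with the weight `(r + ⟨t⟩)^{-1-τ}` taken out. -/
theorem IsAsymptotic.exists_trajectories (hτ : 0 < τ) (h : IsAsymptotic R τ V M w gbar) {θc : E}
    {ρ : ℝ} (hρ : 0 < ρ) (hρ4 : ρ ≤ 1 / 4) (hball : Metric.closedBall θc (2 * ρ) ⊆ V) :
    ∃ C r₁ : ℝ, 0 ≤ C ∧ 1 ≤ r₁ ∧ ∀ r, r₁ < r → ∀ hr : 0 ≤ r,
      ∃ v g : ℝ × E → (ℝ →ᵇ FlowState E), ContDiff ℝ ∞ v ∧ ContDiff ℝ ∞ g ∧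
      (∀ p, v p = constantState E p.2 + (endWeight hτ hr).primitive (FlowState E) (g p)) ∧
      (∀ p, ‖g p‖ ≤ C) ∧ (∀ l θ θ', ‖g (l, θ) - g (l, θ')‖ ≤ C * ‖θ - θ'‖) ∧
      (∀ θ ∈ Metric.closedBall θc (ρ / 2), ∀ t, -1 < t →
        (v (1, θ) t).2.1 ∈ Metric.closedBall θc ρ ∧
        R < r + t + (v (1, θ) t).1 ∧
        0 < 1 - w (r + t + (v (1, θ) t).1) ^ 2 * (v (1, θ) t).2.2
          ((angularG M w (r + t + (v (1, θ) t).1, (v (1, θ) t).2.1)).inverse (v (1, θ) t).2.2) ∧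
        0 < M (r + t + (v (1, θ) t).1, (v (1, θ) t).2.1) (1, 0) (1, 0)
          - angularB M w (r + t + (v (1, θ) t).1, (v (1, θ) t).2.1)
            ((angularG M w (r + t + (v (1, θ) t).1, (v (1, θ) t).2.1)).inverse
              (angularB M w (r + t + (v (1, θ) t).1, (v (1, θ) t).2.1))) ∧
        HasDerivAt (v (1, θ)) (reducedField M w (r + t + (v (1, θ) t).1, (v (1, θ) t).2)) t) ∧
      (∀ θ ∈ Metric.closedBall θc (ρ / 2), ∀ l ∈ Ioo (1 - ρ / 4) (1 + ρ / 4), ∀ t, 0 ≤ t →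
        v (1, θ) (l * t) = v (l, θ) t) ∧
      (∀ θ ∈ Metric.closedBall θc (ρ / 2), ∀ l ∈ Ioo (-1 : ℝ) 1,
        v (1, θ) l = v (l, θ) 1) := by
  obtain ⟨x₀, hx₀, hx₀R, f, hf, hfeq, hfpos⟩ := h.exists_truncation hτ hρ hρ4 hball
  obtain ⟨C₀, hC₀, hfb⟩ := hf.bound_zero
  obtain ⟨C₁, hC₁, hfl⟩ := hf.norm_sub_le
  -- `r` is so large that the integral equation is a contraction and the trajectories stay near
  obtain ⟨r₁, hr₁, hmass⟩ : ∃ r₁, max x₀ (8 / ρ) ≤ r₁ ∧ ∀ r, r₁ < r →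
      2 / τ * r ^ (-τ) * (C₀ + C₁ + 1) ≤ ρ / 2 := by
    have h1 : Tendsto (fun x : ℝ => 2 / τ * x ^ (-τ) * (C₀ + C₁ + 1)) atTop
        (𝓝 (2 / τ * 0 * (C₀ + C₁ + 1))) :=
      ((tendsto_rpow_neg_atTop hτ).const_mul _).mul_const _
    rw [mul_zero, zero_mul] at h1
    obtain ⟨x, hx⟩ := eventually_atTop.1 (h1.eventually (Iic_mem_nhds (half_pos hρ)))
    exact ⟨max (max x₀ (8 / ρ)) x, le_max_left _ _, fun r hr => hx r ((le_max_right _ _).trans hr.le)⟩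
  refine ⟨C₀ + 2 * C₁, r₁, by linarith, hx₀.trans ((le_max_left _ _).trans hr₁),
    fun r hr hr0 => ?_⟩
  have hrx : x₀ < r := ((le_max_left _ _).trans hr₁).trans_lt hr
  have hr1 : 1 ≤ r := hx₀.trans hrx.le
  have hρr : 8 ≤ ρ * r := by
    have : 8 / ρ < r := ((le_max_right _ _).trans hr₁).trans_lt hr
    rw [div_lt_iff₀ hρ] at this
    linarith
  set m := endWeight hτ hr0 with hm
  have hmr : m.mass ≤ 2 / τ * r ^ (-τ) := endWeight_mass_le hτ hr1
  have hmC : m.mass * (C₀ + C₁ + 1) ≤ ρ / 2 :=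
    (mul_le_mul_of_nonneg_right hmr (by linarith)).trans (hmass r hr)
  have hm0 := m.mass_nonneg
  have hfr : SmoothFamily univ univ (fun t => f (r, t)) :=
    hf.reindex (I' := univ) (ρ := fun t => (r, t)) (contDiff_const.prodMk contDiff_id).contDiffOn
      fun t _ => ⟨hrx, mem_univ _⟩
  let g₀ : ℝ × (ℝ →ᵇ FlowState E) → (ℝ →ᵇ FlowState E) := fun q =>
    superposition _ hfr (withSpeed E q)
  have hg₀ : ContDiff ℝ ∞ g₀ := (contDiff_superposition _ hfr).comp (withSpeed E).contDiff
  have hg₀a (l : ℝ) (v : ℝ →ᵇ FlowState E) (t : ℝ) : g₀ (l, v) t = f (r, t) (l, v t) := by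
    simp only [g₀, superposition_apply, withSpeed_apply]
  have hg₀l (l : ℝ) (v v' : ℝ →ᵇ FlowState E) : ‖g₀ (l, v) - g₀ (l, v')‖ ≤ C₁ * ‖v - v'‖ := by
    refine (BoundedContinuousFunction.norm_le (by positivity)).2 fun t => ?_
    rw [BoundedContinuousFunction.sub_apply, hg₀a, hg₀a]
    refine (hfl (r, t) ⟨hrx, mem_univ _⟩ _ _).trans (mul_le_mul_of_nonneg_left ?_ hC₁)
    rw [Prod.mk_sub_mk, sub_self, Prod.norm_mk, norm_zero, max_eq_right (norm_nonneg _)]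
    exact (v - v').norm_coe_le_norm t
  have hg₀b (q) : ‖g₀ q‖ ≤ C₀ := (BoundedContinuousFunction.norm_le hC₀).2 fun t =>
    hfb (r, t) ⟨hrx, mem_univ _⟩ _ (mem_univ _)
  have hprim (u : ℝ →ᵇ FlowState E) : ‖m.primitive (FlowState E) u‖ ≤ m.mass * ‖u‖ :=
    (ContinuousLinearMap.le_opNorm _ _).trans
      (mul_le_mul_of_nonneg_right m.norm_primitive_le (norm_nonneg _))
  -- the integral equation `v = (0, θ, 0) + ∫ m g₀`, as a fixed point problem
  let Ψ : (ℝ × E) × (ℝ →ᵇ FlowState E) → (ℝ →ᵇ FlowState E) := fun q =>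
    constantState E q.1.2 + m.primitive (FlowState E) (g₀ (q.1.1, q.2))
  have hΨ : ContDiff ℝ ∞ Ψ := by
    refine ((constantState E).contDiff.comp (contDiff_snd.comp contDiff_fst)).add ?_
    exact (hg₀.comp ((contDiff_fst.comp contDiff_fst).prodMk
      contDiff_snd)).continuousLinearMap_comp (m.primitive (FlowState E))
  have hlip : ∀ p v v', ‖Ψ (p, v) - Ψ (p, v')‖ ≤ 1 / 2 * ‖v - v'‖ := by
    intro p v v'
    simp only [Ψ, add_sub_add_left_eq_sub, ← map_sub]
    refine (hprim _).trans ?_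
    have h1 := mul_le_mul_of_nonneg_left (hg₀l p.1 v v') hm0
    have h2 : m.mass * C₁ ≤ 1 / 2 := by nlinarith
    have h3 := mul_le_mul_of_nonneg_right h2 (norm_nonneg (v - v'))
    linarith
  obtain ⟨v, hv, hvfix⟩ := exists_contDiff_fixedPoint Ψ hΨ hlip
  let g : ℝ × E → (ℝ →ᵇ FlowState E) := fun p => g₀ (p.1, v p)
  have hvg : ∀ p, v p = constantState E p.2 + m.primitive (FlowState E) (g p) := fun p =>
    (hvfix p).symm
  have hgl : ∀ l θ θ', ‖v (l, θ) - v (l, θ')‖ ≤ 2 * ‖θ - θ'‖ := by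
    intro l θ θ'
    have h1 : v (l, θ) - v (l, θ') = constantState E (θ - θ')
        + (Ψ ((l, θ'), v (l, θ)) - Ψ ((l, θ'), v (l, θ'))) := by
      conv_lhs => rw [← hvfix (l, θ), ← hvfix (l, θ')]
      simp only [Ψ, map_sub]
      abel
    have h2 : ‖constantState E (θ - θ')‖ ≤ ‖θ - θ'‖ := by
      refine (BoundedContinuousFunction.norm_le (norm_nonneg _)).2 fun t => ?_
      rw [constantState_apply, Prod.norm_mk, Prod.norm_mk]
      simp
    have h3 := norm_add_le (constantState E (θ - θ'))
      (Ψ ((l, θ'), v (l, θ)) - Ψ ((l, θ'), v (l, θ')))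
    rw [← h1] at h3
    have h4 := hlip (l, θ') (v (l, θ)) (v (l, θ'))
    linarith
  -- the deviation from the constant trajectory
  have hdev (p : ℝ × E) (t : ℝ) : ‖v p t - (0, p.2, 0)‖ ≤ ρ / 2 := by
    have h1 : v p t - (0, p.2, 0) = m.primitive (FlowState E) (g p) t := by
      conv_lhs => rw [hvg p]
      rw [BoundedContinuousFunction.add_apply, constantState_apply, add_sub_cancel_left]
    rw [h1]
    refine ((m.primitive (FlowState E) (g p)).norm_coe_le_norm t).trans ((hprim _).trans ?_)
    have := mul_le_mul_of_nonneg_left (hg₀b (p.1, v p)) hm0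
    change m.mass * ‖g₀ (p.1, v p)‖ ≤ ρ / 2
    nlinarith
  have hderiv (p : ℝ × E) (t : ℝ) : HasDerivAt (v p) (m t • f (r, t) (p.1, v p t)) t := by
    have h1 : (v p : ℝ → FlowState E) = fun t => ((0, p.2, 0) : FlowState E)
        + m.primitive (FlowState E) (g p) t := by
      ext1 t
      conv_lhs => rw [hvg p]
      rfl
    have h2 := (m.hasDerivAt_primitive (g p) t).const_add ((0, p.2, 0) : FlowState E)
    rw [← h1] at h2
    have h3 : g p t = f (r, t) (p.1, v p t) := hg₀a _ _ _
    rwa [h3] at h2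
  -- the truncation is inactive along the trajectories, as long as `l t` is comparable to `⟨t⟩`
  have hact {θ : E} (hθ : θ ∈ Metric.closedBall θc (ρ / 2)) (l t l' t' : ℝ)
      (ht : |l * t - bracket t| ≤ ρ / 4 * |t| + 3) :
      scaledState r t l (v (l', θ) t') ∈ Metric.closedBall ((1, θc, 0) : FlowState E) ρ :=
    scaledState_mem hρ hr1 hρr hθ (hdev _ _) ht
  -- negative times near `0` are kept in order that `0` be an interior point
  have h1t {t : ℝ} (ht : -1 < t) : |1 * t - bracket t| ≤ ρ / 4 * |t| + 3 := by
    rw [one_mul]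
    have := abs_sub_bracket_le ht
    have : 0 ≤ ρ / 4 * |t| := by positivity
    linarith
  have hode {θ : E} (hθ : θ ∈ Metric.closedBall θc (ρ / 2)) {t : ℝ} (ht : -1 < t) :
      HasDerivAt (v (1, θ)) (reducedField M w (r + t + (v (1, θ) t).1, (v (1, θ) t).2)) t := by
    have h2 := hfeq r hrx t 1 (by norm_num) _ (hact hθ 1 t 1 t (h1t ht))
    have h3 := hderiv (1, θ) t
    rw [hm, endWeight_apply] at h3
    rw [h2, one_smul, one_mul] at h3
    exact h3
  -- running a trajectory with speed `l` amounts to rescaling time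
  have hscale {θ : E} (hθ : θ ∈ Metric.closedBall θc (ρ / 2)) {l T : ℝ} (hl2 : |l| ≤ 2)
      (hT : 0 ≤ T) (hlT : ∀ t ∈ Icc 0 T, -1 < l * t)
      (hle : ∀ t ∈ Icc 0 T, |l * t - bracket t| ≤ ρ / 4 * |t| + 3) :
      v (1, θ) (l * T) = v (l, θ) T := by
    have hm1 : ∀ t, m t ≤ 1 := fun t => by
      rw [hm, endWeight_apply]
      exact Real.rpow_le_one_of_one_le_of_nonpos (by linarith [one_le_bracket t]) (by linarith)
    have hK : ∀ t ∈ Ico 0 T, LipschitzOnWith C₁.toNNReal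
        (fun u => m t • f (r, t) (l, u)) univ := by
      intro t _
      refine LipschitzOnWith.of_dist_le_mul fun u _ u' _ => ?_
      rw [dist_eq_norm, dist_eq_norm, ← smul_sub, norm_smul, Real.coe_toNNReal _ hC₁,
        Real.norm_of_nonneg (m.nonneg t)]
      have h2 := hfl (r, t) ⟨hrx, mem_univ _⟩ (l, u) (l, u')
      have h3 : ‖((l, u) : ℝ × FlowState E) - (l, u')‖ = ‖u - u'‖ := by
        rw [Prod.mk_sub_mk, sub_self, Prod.norm_mk, norm_zero, max_eq_right (norm_nonneg _)]
      rw [h3] at h2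
      exact (mul_le_of_le_one_left (norm_nonneg _) (hm1 t)).trans h2
    refine ODE_solution_unique_of_mem_Icc_right (f := fun t => v (1, θ) (l * t)) (g := v (l, θ))
      (s := fun _ => univ) (a := 0) (b := T) hK
      ((v (1, θ)).continuous.comp (continuous_const.mul continuous_id)).continuousOn
      (fun t ht => ?_) (fun _ _ => mem_univ _) (v (l, θ)).continuous.continuousOn
      (fun t ht => (hderiv (l, θ) t).hasDerivWithinAt) (fun _ _ => mem_univ _) ?_
      (right_mem_Icc.2 hT)
    · have ht' : t ∈ Icc 0 T := Ico_subset_Icc_self ht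
      have h2 := (hode hθ (hlT t ht')).scomp t ((hasDerivAt_id t).const_mul l)
      have h3 := hfeq r hrx t l hl2 _ (hact hθ l t 1 (l * t) (hle t ht'))
      rw [hm, endWeight_apply, h3]
      simp only [mul_one] at h2
      exact h2.hasDerivWithinAt
    · simp only [mul_zero]
      rw [hvg, hvg]
      simp only [BoundedContinuousFunction.add_apply, constantState_apply, m.primitive_zero]
  refine ⟨v, g, hv, hg₀.comp (contDiff_fst.prodMk hv), hvg, fun p => ?_, fun l θ θ' => ?_,
    fun θ hθ t ht => ?_, fun θ hθ l hl t ht => ?_, fun θ hθ l hl => ?_⟩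
  · exact (hg₀b _).trans (by linarith)
  · refine (hg₀l l _ _).trans ?_
    have h2 := mul_le_mul_of_nonneg_left (hgl l θ θ') hC₁
    have h3 := mul_nonneg hC₀ (norm_nonneg (θ - θ'))
    nlinarith
  · have h2 := hfpos r hrx t 1 _ (hact hθ 1 t 1 t (h1t ht))
    rw [one_mul] at h2
    refine ⟨?_, h2.1, h2.2.1, h2.2.2, hode hθ ht⟩
    have h3 := hact hθ 1 t 1 t (h1t ht)
    rw [Metric.mem_closedBall, Prod.dist_eq, Prod.dist_eq] at h3
    exact ((le_max_left _ _).trans (le_max_right _ _)).trans h3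
  · have hl2 : |l| ≤ 2 := by rw [abs_le]; constructor <;> linarith [hl.1, hl.2]
    refine hscale hθ hl2 ht (fun s hs => ?_) fun s hs => ?_
    · have : 0 ≤ l * s := mul_nonneg (by linarith [hl.1]) hs.1
      linarith
    · have h2 := bracket_le_one_add_abs s
      have h3 := abs_le_bracket s
      have hs0 := hs.1
      rw [abs_of_nonneg hs0] at h2 h3 ⊢
      rw [abs_le]
      constructor <;> nlinarith [hl.1, hl.2]
  · have hl2 : |l| ≤ 2 := by rw [abs_le]; constructor <;> linarith [hl.1, hl.2]
    have h2 := hscale hθ hl2 zero_le_one (fun s hs => by nlinarith [hs.1, hs.2, hl.1, hl.2])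
      fun s hs => by
        have h2 := bracket_le_one_add_abs s
        have h3 := one_le_bracket s
        have hs0 := hs.1
        have hs1 := hs.2
        have h4 : 0 ≤ ρ / 4 * |s| := by positivity
        rw [abs_of_nonneg hs0] at h2 h4 ⊢
        rw [abs_le]
        constructor <;> nlinarith [hl.1, hl.2]
    rwa [mul_one] at h2

end LocalFlow

/-! ### Smoothness and symbol estimates along the trajectories -/

section Dilation

open BoundedContinuousFunction

universe u

variable {E : Type*} [NormedAddCommGroup E] [NormedSpace ℝ E]
  {Z : Type u} [NormedAddCommGroup Z] [NormedSpace ℝ Z]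
  {v g : ℝ × E → (ℝ →ᵇ Z)} {U : Set E} {a : ℝ}

/-- A family of bounded curves depending smoothly on parameters `(l, θ)`, in which `l` acts as a
dilation of time, is jointly smooth in time and `θ`. -/
theorem contDiffOn_of_dilation (hv : ContDiff ℝ ∞ v) (ha : 0 < a)
    (h1 : ∀ θ ∈ U, ∀ l ∈ Ioo (1 - a) (1 + a), ∀ t, 0 ≤ t → v (1, θ) (l * t) = v (l, θ) t)
    (h2 : ∀ θ ∈ U, ∀ l ∈ Ioo (-1 : ℝ) 1, v (1, θ) l = v (l, θ) 1) :
    ContDiffOn ℝ ∞ (fun p : ℝ × E => v (1, p.2) p.1) (Ioi (-1) ×ˢ U) := by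
  rintro ⟨t, θ⟩ ⟨ht, hθ⟩
  have ht : -1 < t := ht
  -- for `t < 1` the state at time `t` is the one at time `1` for the speed `t`; for `t ≥ 1` the
  -- states at times near `t` are those at time `t` for speeds near `1`
  rcases lt_or_ge t 1 with ht1 | ht1
  · have h3 : ContDiff ℝ ∞ fun p : ℝ × E => v p 1 :=
      hv.continuousLinearMap_comp (evalCLM ℝ (1 : ℝ))
    refine h3.contDiffWithinAt.congr_of_eventuallyEq_of_mem ?_ ⟨ht, hθ⟩
    have h4 : {p : ℝ × E | p.1 ∈ Ioo (-1) 1} ∈ 𝓝 (t, θ) :=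
      continuous_fst.continuousAt.preimage_mem_nhds (isOpen_Ioo.mem_nhds ⟨ht, ht1⟩)
    filter_upwards [self_mem_nhdsWithin, mem_nhdsWithin_of_mem_nhds h4] with p hp hp4
    exact h2 p.2 hp.2 p.1 hp4
  · have ht0 : 0 < t := by linarith
    have h3 : ContDiff ℝ ∞ fun p : ℝ × E => v (p.1 / t, p.2) t :=
      (hv.comp ((contDiff_fst.div_const t).prodMk contDiff_snd)).continuousLinearMap_comp
        (evalCLM ℝ t)
    refine h3.contDiffWithinAt.congr_of_eventuallyEq_of_mem ?_ ⟨ht, hθ⟩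
    have h4 : {p : ℝ × E | p.1 / t ∈ Ioo (1 - a) (1 + a)} ∈ 𝓝 (t, θ) := by
      refine (continuous_fst.div_const t).continuousAt.preimage_mem_nhds (isOpen_Ioo.mem_nhds ?_)
      rw [div_self ht0.ne']
      constructor <;> linarith
    filter_upwards [self_mem_nhdsWithin, mem_nhdsWithin_of_mem_nhds h4] with p hp hp4
    have := h1 p.2 hp.2 _ hp4 t ht0.le
    rwa [div_mul_cancel₀ _ ht0.ne'] at this

variable {τ : ℝ} {m : Weight} {C₀ : ℝ}

theorem Weight.tendsto_primitive [CompleteSpace Z] (hτ : 0 < τ)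
    (hm : ∀ t : ℝ, 0 ≤ t → ∫ s in Ioi t, m s ≤ C₀ * bracket t ^ (-τ)) (u : ℝ →ᵇ Z) :
    Tendsto (fun t => m.primitive Z u t) atTop (𝓝 (m.tail Z 0 u)) := by
  have h1 : Tendsto (fun t => m.tail Z t u) atTop (𝓝 0) := by
    refine squeeze_zero_norm' (a := fun t => |C₀| * t ^ (-τ) * ‖u‖) ?_ ?_
    · filter_upwards [eventually_gt_atTop 0] with t ht
      refine (m.norm_setIntegral_le u _).trans
        (mul_le_mul_of_nonneg_right ((hm t ht.le).trans ?_) (norm_nonneg _))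
      refine mul_le_mul (le_abs_self _) ?_ (by have := bracket_pos t; positivity) (abs_nonneg _)
      refine Real.rpow_le_rpow_of_nonpos ht ?_ (by linarith)
      exact (le_abs_self t).trans (abs_le_bracket t)
    · simpa using ((tendsto_rpow_neg_atTop hτ).const_mul |C₀|).mul_const ‖u‖
  have h2 := h1.const_sub (m.tail Z 0 u)
  rw [sub_zero] at h2
  refine h2.congr fun t => ?_
  rw [← m.tail_zero_sub_primitive u t, sub_sub_cancel]

variable {W : Type*} [NormedAddCommGroup W] [NormedSpace ℝ W] [CompleteSpace W]
  {E' : Type*} [NormedAddCommGroup E'] [NormedSpace ℝ E']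

set_option synthInstance.maxHeartbeats 200000 in
/-- A smooth function with bounded derivatives converges along the trajectories to its limit, as a
symbol of order `-τ`. -/
theorem isSymbol_sub_limit [CompleteSpace Z] (hτ : 0 < τ)
    (hm : ∀ t : ℝ, 0 ≤ t → ∫ s in Ioi t, m s ≤ C₀ * bracket t ^ (-τ))
    (hv : ContDiff ℝ ∞ v) (hg : ContDiff ℝ ∞ g) {c₀ : E →L[ℝ] Z}
    (hvg : ∀ p t, v p t = c₀ p.2 + m.primitive Z (g p) t) (ha : 0 < a) (ha1 : a ≤ 1)
    (h1 : ∀ θ ∈ U, ∀ l ∈ Ioo (1 - a) (1 + a), ∀ t, 0 ≤ t → v (1, θ) (l * t) = v (l, θ) t)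
    (h2 : ∀ θ ∈ U, ∀ l ∈ Ioo (-1 : ℝ) 1, v (1, θ) l = v (l, θ) 1)
    {Θ : Z → Z} (hΘ : ContDiff ℝ ∞ Θ)
    (hΘ' : SmoothFamily univ univ (fun _ : ℝ => fderiv ℝ Θ)) (L : Z →L[ℝ] W)
    {V : Set E'} (hV : IsOpen V) {κ : E' → E} (hκ : ContDiffOn ℝ ∞ κ V) (hκU : MapsTo κ V U) :
    IsSymbol (-τ) 0 V (fun t θ =>
      L (Θ (v (1, κ θ) t)) - L (Θ (c₀ (κ θ) + m.tail Z 0 (g (1, κ θ))))) := by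
  have hlim : ContDiffOn ℝ ∞ (fun θ => c₀ (κ θ) + m.tail Z 0 (g (1, κ θ))) V :=
    (c₀.contDiff.comp_contDiffOn hκ).add
      (((m.tail Z 0).contDiff.comp hg).comp_contDiffOn (contDiffOn_const.prodMk hκ))
  let G : ℝ × E → (ℝ →ᵇ W) := fun p => ((-L).compLeftContinuousBounded ℝ : (ℝ →ᵇ Z) →L[ℝ] _)
    (pointwiseApply ℝ Z Z (superposition _ hΘ' (v p)) (g p))
  have hG : ContDiff ℝ ∞ G := by
    have h3 : ContDiff ℝ ∞ fun p => superposition _ hΘ' (v p) :=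
      (contDiff_superposition _ hΘ').comp hv
    have h4 : ContDiff ℝ ∞ fun p => pointwiseApply ℝ Z Z (superposition _ hΘ' (v p)) :=
      h3.continuousLinearMap_comp (pointwiseApply ℝ Z Z)
    exact (h4.clm_apply hg).continuousLinearMap_comp ((-L).compLeftContinuousBounded ℝ)
  have htend (p : ℝ × E) : Tendsto (fun t => v p t) atTop (𝓝 (c₀ p.2 + m.tail Z 0 (g p))) := by
    simp only [hvg]
    exact (m.tendsto_primitive hτ hm (g p)).const_add _
  have hder (p : ℝ × E) (t : ℝ) : HasDerivAt (v p) (m t • g p t) t := by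
    have h3 : (v p : ℝ → Z) = fun t => c₀ p.2 + m.primitive Z (g p) t := funext fun t => hvg p t
    rw [h3]
    exact (m.hasDerivAt_primitive (g p) t).const_add _
  -- by the fundamental theorem of calculus, the deviation from the limit is the tail of an integral
  have key (p : ℝ × E) {t : ℝ} (ht : 0 ≤ t) :
      L (Θ (v p t)) - L (Θ (c₀ p.2 + m.tail Z 0 (g p))) = m.tail W t (G p) := by
    have h3 (s : ℝ) : HasDerivAt (fun s => -L (Θ (v p s))) (m s • G p s) s := by
      have h4 := ((hΘ.differentiable (by simp) (v p s)).hasFDerivAt.comp_hasDerivAt s (hder p s))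
      have h5 := ((-L).hasFDerivAt.comp_hasDerivAt s h4)
      refine h5.congr_deriv ?_
      simp [G]
    have h4 {t : ℝ} (ht : 0 ≤ t) := m.sub_eq_primitive (G p) ht fun s _ => h3 s
    have hc : Continuous fun z => -L (Θ z) := (L.continuous.comp hΘ.continuous).neg
    have h5 : Tendsto (fun t => -L (Θ (v p t)) - -L (Θ (v p 0))) atTop
        (𝓝 (-L (Θ (c₀ p.2 + m.tail Z 0 (g p))) - -L (Θ (v p 0)))) :=
      ((hc.tendsto _).comp (htend p)).sub_const _
    have h6 : (-L (Θ (c₀ p.2 + m.tail Z 0 (g p))) - -L (Θ (v p 0))) = m.tail W 0 (G p) := by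
      refine tendsto_nhds_unique h5 ((m.tendsto_primitive hτ hm (G p)).congr' ?_)
      filter_upwards [eventually_ge_atTop 0] with s hs using (h4 hs).symm
    rw [← m.tail_zero_sub_primitive (G p) t, ← h6, ← h4 ht]
    abel
  have hjoint : ContDiffOn ℝ ∞ (fun p : ℝ × E' => v (1, κ p.2) p.1) (Ioi (-1) ×ˢ V) :=
    (contDiffOn_of_dilation hv ha h1 h2).comp (f := fun p : ℝ × E' => (p.1, κ p.2))
      (contDiff_fst.contDiffOn.prodMk (hκ.comp contDiff_snd.contDiffOn fun p hp => hp.2))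
      fun p hp => ⟨hp.1, hκU hp.2⟩
  refine isSymbol_of_tail hτ (fun t ht => hm t (zero_le_one.trans ht)) hV one_pos
    (g := fun y θ => G (y, κ θ)) (a := 1 - a) (b := 1 + a) ?_ (by linarith) (by linarith) ?_ ?_
  · refine (((L.contDiff.comp hΘ).comp_contDiffOn hjoint)).sub ?_
    exact ((L.contDiff.comp hΘ).comp_contDiffOn hlim).comp contDiff_snd.contDiffOn
      fun p hp => hp.2
  · exact hG.comp_contDiffOn (contDiff_fst.contDiffOn.prodMk
      (hκ.comp contDiff_snd.contDiffOn fun p hp => hp.2))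
  · intro y hy θ hθ t ht
    have ht0 : 0 ≤ t := zero_le_one.trans ht
    -- the dilated trajectory has the same limit
    have h3 : c₀ (κ θ) + m.tail Z 0 (g (1, κ θ)) = c₀ (κ θ) + m.tail Z 0 (g (y, κ θ)) := by
      refine tendsto_nhds_unique ((htend (1, κ θ)).comp
        (tendsto_id.const_mul_atTop (show (0 : ℝ) < y by linarith [hy.1])))
        ((htend (y, κ θ)).congr' ?_)
      filter_upwards [eventually_ge_atTop 0] with s hs using (h1 _ (hκU hθ) y hy s hs).symm
    rw [← key (y, κ θ) ht0, h3, mul_comm t y, h1 _ (hκU hθ) y hy t ht0]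

end Dilation

section Flow

variable {E : Type*} [NormedAddCommGroup E] [NormedSpace ℝ E]

/-- The pairs `Y t θ` of the radial displacement and of the angular position at time `t`, when
started at `θ`, are `δ`-close to `(0, θ)`, in the Lipschitz sense and for all times, and they
converge to `Yinf` as symbols of order `-τ`. The symbol estimates are stated after a smooth
substitution `κ` of the parameter and, for the angular position, after application of a smooth
function `Θ`, since changes of charts act on both. -/
structure IsNearTranslation (τ δ : ℝ) (U : Set E) (Y : ℝ → E → ℝ × E) (Yinf : E → ℝ × E) :
    Prop where
  contDiffOn : ContDiffOn ℝ ∞ (fun p : ℝ × E => Y p.1 p.2) (Ioi (-1) ×ˢ U)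
  contDiffOn_lim : ContDiffOn ℝ ∞ Yinf U
  initial : ∀ θ ∈ U, Y 0 θ = (0, θ)
  near : ∀ t, 0 ≤ t → ∀ θ ∈ U, ‖Y t θ - (0, θ)‖ ≤ δ
  lipschitz : ∀ t, 0 ≤ t → ∀ t', 0 ≤ t' → ∀ θ ∈ U, ∀ θ' ∈ U,
    ‖(Y t θ - (0, θ)) - (Y t' θ' - (0, θ'))‖ ≤ δ * max |t - t'| ‖θ - θ'‖
  tendsto : ∀ θ ∈ U, Tendsto (fun t => Y t θ) atTop (𝓝 (Yinf θ))
  radial_symbol : ∀ (V : Set E) (κ : E → E), IsOpen V → ContDiffOn ℝ ∞ κ V → MapsTo κ V U →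
    IsSymbol (-τ) 0 V (fun t θ => (Y t (κ θ)).1 - (Yinf (κ θ)).1)
  angular_symbol : ∀ Θ : E → E, ContDiff ℝ ∞ Θ → HasCompactSupport Θ →
    ∀ (V : Set E) (κ : E → E), IsOpen V → ContDiffOn ℝ ∞ κ V → MapsTo κ V U →
    IsSymbol (-τ) 0 V (fun t θ => Θ (Y t (κ θ)).2 - Θ (Yinf (κ θ)).2)

theorem smoothFamily_fderiv_of_hasCompactSupport {Z Q W X : Type*} [NormedAddCommGroup Q]
    [NormedSpace ℝ Q] [NormedAddCommGroup W] [NormedSpace ℝ W] [NormedAddCommGroup Z]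
    [NormedSpace ℝ Z] [NormedAddCommGroup X] [NormedSpace ℝ X] {Θ : Q → W}
    (hΘ : ContDiff ℝ ∞ Θ) (hc : HasCompactSupport Θ) (A : Z →L[ℝ] Q) (B : W →L[ℝ] X) :
    SmoothFamily univ univ (fun _ : ℝ => fderiv ℝ fun u => B (Θ (A u))) := by
  have h0 : ContDiff ℝ ∞ (Θ ∘ A) := hΘ.comp A.contDiff
  have h1 : ContDiff ℝ ∞ (fderiv ℝ fun u => B (Θ (A u))) :=
    (B.contDiff.comp h0).fderiv_right (by simp)
  refine ⟨(h1.comp contDiff_snd).contDiffOn, fun n => ?_⟩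
  obtain ⟨C, hC⟩ := (hc.iteratedFDeriv (𝕜 := ℝ) (n + 1)).exists_bound_of_continuous
    (hΘ.continuous_iteratedFDeriv (by exact_mod_cast le_top))
  refine ⟨‖B‖ * (C * ‖A‖ ^ (n + 1)), fun _ _ q _ => ?_⟩
  rw [norm_iteratedFDeriv_fderiv]
  refine (B.norm_iteratedFDeriv_comp_left h0.contDiffAt (by exact_mod_cast le_top)).trans
    (mul_le_mul_of_nonneg_left ?_ (norm_nonneg _))
  rw [A.iteratedFDeriv_comp_right hΘ q (by exact_mod_cast le_top)]
  refine (ContinuousMultilinearMap.norm_compContinuousLinearMap_le _ _).trans ?_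
  rw [Finset.prod_const, Finset.card_univ, Fintype.card_fin]
  exact mul_le_mul_of_nonneg_right (hC _) (by positivity)

variable [FiniteDimensional ℝ E] {R τ : ℝ}
  {V : Set E} {M : ℝ × E → (ℝ × E) →L[ℝ] (ℝ × E) →L[ℝ] ℝ} {w : ℝ → ℝ}
  {gbar : E → E →L[ℝ] E →L[ℝ] ℝ}

/-- The trajectories issued from `x = r` with vanishing angular momentum `p`, near `θc`: they are
`O(r ^ (-τ))`-close to `(r + t, θ)`. -/
theorem IsAsymptotic.exists_nearTranslation (hτ : 0 < τ) (h : IsAsymptotic R τ V M w gbar)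
    {θc : E} {ρ : ℝ} (hρ : 0 < ρ) (hρ4 : ρ ≤ 1 / 4) (hball : Metric.closedBall θc (2 * ρ) ⊆ V) :
    ∃ C r₁ : ℝ, 0 ≤ C ∧ 1 ≤ r₁ ∧ ∀ r, r₁ < r →
      ∃ (Y : ℝ → E → ℝ × E) (Yinf : E → ℝ × E) (p : ℝ → E → (E →L[ℝ] ℝ)),
      IsNearTranslation τ (C * r ^ (-τ)) (Metric.ball θc (ρ / 2)) Y Yinf ∧
      ∀ θ ∈ Metric.ball θc (ρ / 2), p 0 θ = 0 ∧ ∀ t, -1 < t →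
        (Y t θ).2 ∈ Metric.closedBall θc ρ ∧
        R < r + t + (Y t θ).1 ∧
        0 < 1 - w (r + t + (Y t θ).1) ^ 2 * p t θ
          ((angularG M w (r + t + (Y t θ).1, (Y t θ).2)).inverse (p t θ)) ∧
        0 < M (r + t + (Y t θ).1, (Y t θ).2) (1, 0) (1, 0)
          - angularB M w (r + t + (Y t θ).1, (Y t θ).2)
            ((angularG M w (r + t + (Y t θ).1, (Y t θ).2)).inverse
              (angularB M w (r + t + (Y t θ).1, (Y t θ).2))) ∧
        HasDerivAt (fun s => (((Y s θ).1, (Y s θ).2, p s θ) : FlowState E))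
          (reducedField M w (r + t + (Y t θ).1, (Y t θ).2, p t θ)) t := by
  obtain ⟨C, r₁, hC, hr₁, H⟩ := h.exists_trajectories hτ hρ hρ4 hball
  -- `2 / τ` comes from the integral of the weight, and `1` from its maximum, which bounds the
  -- Lipschitz constant in time
  refine ⟨C * (2 / τ + 1), r₁, by positivity, hr₁, fun r hr => ?_⟩
  have hr1 : 1 ≤ r := hr₁.trans hr.le
  have hr0 : 0 ≤ r := zero_le_one.trans hr1
  obtain ⟨v, g, hv, hg, hvg, hgC, hgl, hstate, hs1, hs2⟩ := H r hr hr0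
  set m := endWeight hτ hr0 with hm
  have hsub : Metric.ball θc (ρ / 2) ⊆ Metric.closedBall θc (ρ / 2) := Metric.ball_subset_closedBall
  have hmr : m.mass ≤ 2 / τ * r ^ (-τ) := endWeight_mass_le hτ hr1
  have hrp : 0 ≤ r ^ (-τ) := by positivity
  have hmt : ∀ t, m t ≤ r ^ (-τ) := fun t => by
    rw [hm, endWeight_apply]
    have hb := bracket_pos t
    exact (Real.rpow_le_rpow_of_nonpos (by linarith) (by linarith) (by linarith)).trans
      (Real.rpow_le_rpow_of_exponent_le hr1 (by linarith))
  have htail : ∀ t : ℝ, 0 ≤ t → ∫ s in Ioi t, m s ≤ 1 / τ * bracket t ^ (-τ) := fun t ht =>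
    (endWeight_tail_le hτ hr1 ht).trans (by rw [div_eq_mul_inv, div_eq_mul_inv]; linarith)
  have hprim (u : BoundedContinuousFunction ℝ (FlowState E)) (t : ℝ) :
      ‖m.primitive (FlowState E) u t‖ ≤ m.mass * ‖u‖ :=
    ((m.primitive (FlowState E) u).norm_coe_le_norm t).trans
      ((ContinuousLinearMap.le_opNorm _ _).trans
        (mul_le_mul_of_nonneg_right m.norm_primitive_le (norm_nonneg _)))
  let c₀ : E →L[ℝ] FlowState E :=
    (ContinuousLinearMap.inr ℝ ℝ (E × (E →L[ℝ] ℝ))).comp (ContinuousLinearMap.inl ℝ E (E →L[ℝ] ℝ))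
  have hvt (p : ℝ × E) (t : ℝ) : v p t = c₀ p.2 + m.primitive (FlowState E) (g p) t := by
    conv_lhs => rw [hvg p]
    rfl
  let P : FlowState E →L[ℝ] ℝ × E :=
    (ContinuousLinearMap.fst ℝ ℝ _).prod
      ((ContinuousLinearMap.fst ℝ E (E →L[ℝ] ℝ)).comp (ContinuousLinearMap.snd ℝ ℝ _))
  have hP (u : FlowState E) : ‖P u‖ ≤ ‖u‖ := by
    change ‖(u.1, u.2.1)‖ ≤ ‖u‖
    rw [Prod.norm_mk]
    exact max_le (norm_fst_le u) ((norm_fst_le u.2).trans (norm_snd_le u))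
  have hPc (θ : E) : P (c₀ θ) = (0, θ) := rfl
  have hs1' := fun θ hθ => hs1 θ (hsub hθ)
  have hs2' := fun θ hθ => hs2 θ (hsub hθ)
  have hρ1 : 0 < ρ / 4 := by positivity
  have hY (θ : E) (t : ℝ) :
      P (v (1, θ) t) - (0, θ) = P (m.primitive (FlowState E) (g (1, θ)) t) := by
    rw [hvt, map_add, hPc, add_sub_cancel_left]
  refine ⟨fun t θ => P (v (1, θ) t), fun θ => P (c₀ θ + m.tail (FlowState E) 0 (g (1, θ))),
    fun t θ => (v (1, θ) t).2.2, ⟨?_, ?_, fun θ hθ => ?_, fun t ht θ hθ => ?_,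
    fun t ht t' ht' θ hθ θ' hθ' => ?_, fun θ hθ => ?_, fun V κ hV hκ hκU => ?_,
    fun Θ hΘ hc V κ hV hκ hκU => ?_⟩, fun θ hθ => ⟨?_, fun t ht => hstate θ (hsub hθ) t ht⟩⟩
  · exact P.contDiff.comp_contDiffOn (contDiffOn_of_dilation hv hρ1 hs1' hs2')
  · exact (P.contDiff.comp (c₀.contDiff.add ((m.tail (FlowState E) 0).contDiff.comp
      (hg.comp (contDiff_const.prodMk contDiff_id))))).contDiffOn
  · have h1 := hY θ 0
    rw [m.primitive_zero, map_zero P] at h1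
    exact sub_eq_zero.1 h1
  · rw [hY]
    refine (hP _).trans ((hprim _ _).trans ?_)
    have h1 : m.mass * ‖g (1, θ)‖ ≤ 2 / τ * r ^ (-τ) * C :=
      mul_le_mul hmr (hgC _) (norm_nonneg _) (by positivity)
    nlinarith [mul_nonneg hC hrp]
  · rw [hY, hY, ← map_sub]
    refine (hP _).trans ?_
    have h1 : ‖m.primitive (FlowState E) (g (1, θ)) t - m.primitive (FlowState E) (g (1, θ')) t‖
        ≤ 2 / τ * r ^ (-τ) * (C * ‖θ - θ'‖) := by
      rw [← BoundedContinuousFunction.sub_apply, ← map_sub]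
      exact (hprim _ _).trans (mul_le_mul hmr (hgl _ _ _) (norm_nonneg _) (by positivity))
    have h2 : ‖m.primitive (FlowState E) (g (1, θ')) t - m.primitive (FlowState E) (g (1, θ')) t'‖
        ≤ r ^ (-τ) * C * |t - t'| := by
      refine convex_univ.norm_image_sub_le_of_norm_hasDerivWithin_le
        (f' := fun s => m s • g (1, θ') s)
        (fun s _ => (m.hasDerivAt_primitive (g (1, θ')) s).hasDerivWithinAt) (fun s _ => ?_)
        (mem_univ _) (mem_univ _)
      rw [norm_smul, Real.norm_of_nonneg (m.nonneg s)]
      exact mul_le_mul (hmt s) (((g (1, θ')).norm_coe_le_norm s).trans (hgC _)) (norm_nonneg _) hrp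
    have h3 := norm_add_le
      (m.primitive (FlowState E) (g (1, θ)) t - m.primitive (FlowState E) (g (1, θ')) t)
      (m.primitive (FlowState E) (g (1, θ')) t - m.primitive (FlowState E) (g (1, θ')) t')
    rw [sub_add_sub_cancel] at h3
    have h4 := mul_le_mul_of_nonneg_left (le_max_left |t - t'| ‖θ - θ'‖) (mul_nonneg hrp hC)
    have h5 := mul_le_mul_of_nonneg_left (le_max_right |t - t'| ‖θ - θ'‖)
      (show 0 ≤ 2 / τ * r ^ (-τ) * C by positivity)
    linarith
  · refine (P.continuous.tendsto _).comp ?_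
    exact ((m.tendsto_primitive hτ htail (g (1, θ))).const_add (c₀ θ)).congr
      fun t => (hvt (1, θ) t).symm
  · exact isSymbol_sub_limit hτ htail hv hg hvt hρ1 (by linarith) hs1' hs2' contDiff_id
      (by
        rw [show fderiv ℝ (id : FlowState E → FlowState E)
          = fun _ => ContinuousLinearMap.id ℝ _ from funext fun _ => fderiv_id]
        exact SmoothFamily.const _)
      (ContinuousLinearMap.fst ℝ ℝ (E × (E →L[ℝ] ℝ))) hV hκ hκU
  · have h1 : SmoothFamily univ univ
        (fun _ : ℝ => fderiv ℝ fun u : FlowState E => ((0, Θ u.2.1, 0) : FlowState E)) :=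
      smoothFamily_fderiv_of_hasCompactSupport hΘ hc
        ((ContinuousLinearMap.fst ℝ E (E →L[ℝ] ℝ)).comp (ContinuousLinearMap.snd ℝ ℝ _)) c₀
    exact isSymbol_sub_limit hτ htail hv hg hvt hρ1 (by linarith) hs1' hs2'
      (Θ := fun u => (0, Θ u.2.1, 0))
      (contDiff_const.prodMk ((hΘ.comp (contDiff_fst.comp contDiff_snd)).prodMk contDiff_const)) h1
      ((ContinuousLinearMap.fst ℝ E (E →L[ℝ] ℝ)).comp (ContinuousLinearMap.snd ℝ ℝ _)) hV hκ hκU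
  · change (v (1, θ) 0).2.2 = 0
    rw [hvt, m.primitive_zero]
    exact add_zero _

end Flow

/-! ### The normal flow in a chart -/

section GeometricFlow

variable {E S : Type*} [NormedAddCommGroup E] [NormedSpace ℝ E]
  [TopologicalSpace S] [ChartedSpace E S] [IsManifold 𝓘(ℝ, E) ∞ S] {R τ : ℝ}

theorem IsSymbolLine.mono {m m' M : ℝ} {f : ℝ → ℝ} (hf : IsSymbolLine m M f) (h : m ≤ m') :
    IsSymbolLine m' M f := by
  refine ⟨hf.1, fun j => ?_⟩
  obtain ⟨C, hC⟩ := hf.2 j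
  refine ⟨|C|, fun x hx => (hC x hx).trans ?_⟩
  have h1 : bracket x ^ (m - j) ≤ bracket x ^ (m' - j) :=
    Real.rpow_le_rpow_of_exponent_le (one_le_bracket x) (by linarith)
  have h0 : 0 ≤ bracket x ^ (m - j) := Real.rpow_nonneg (bracket_pos x).le _
  exact (mul_le_mul_of_nonneg_right (le_abs_self C) h0).trans
    (mul_le_mul_of_nonneg_left h1 (abs_nonneg C))

theorem injective_mfderivModel_chart_symm {e : OpenPartialHomeomorph S E}
    (he : e ∈ IsManifold.maximalAtlas 𝓘(ℝ, E) ∞ S) {θ : E} (hθ : θ ∈ e.target) :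
    Function.Injective (mfderivModel 𝓘(ℝ, E) e.symm θ) := by
  have hz : ((1 : ℝ), θ) ∈ Ioi 0 ×ˢ e.target := ⟨(one_pos : (0 : ℝ) < 1), hθ⟩
  intro u u' h
  have h1 : ((0 : ℝ), u) = (0, u') := by
    refine injective_mfderivModel_endParam he hz ?_
    rw [mfderivModel_endParam he hz, mfderivModel_endParam he hz]
    exact congrArg (Prod.mk (0 : ℝ)) h
  exact congrArg Prod.snd h1

variable [FiniteDimensional ℝ E]

/-- The hypotheses on the coefficients in a chart, in terms of the metric pulled back to
`(R, ∞) × V`. -/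
theorem isAsymptotic_pullbackMetric {G : EndMetric R E S} {gbar : SmoothMetric 𝓘(ℝ, E) S}
    {w : ℝ → ℝ} (hw_pos : ∀ x, R < x → 0 < w x) {lam μ ν : ℝ}
    (hμ : 1 + τ ≤ μ) (hν : (1 + τ) / 2 ≤ ν) (hlam : (1 + τ) / 2 ≤ lam)
    (hw : IsSymbolLine (-lam) R w) {e : OpenPartialHomeomorph S E}
    (he : e ∈ IsManifold.maximalAtlas 𝓘(ℝ, E) ∞ S)
    (ha : IsSymbol (-μ) R e.target (fun x θ => coefA G e x θ - 1))
    (hb : ∀ u : E, IsSymbol (-ν) R e.target (fun x θ => coefB G w e u x θ))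
    (hg : ∀ u v : E,
      IsSymbol (-τ) R e.target (fun x θ => coefG G w e u v x θ - coefBar gbar e u v θ)) :
    IsAsymptotic R τ e.target (pullbackMetric G (endParam R e)) w
      (pullbackMetric gbar e.symm) where
  isOpen := e.open_target
  smooth := contDiffOn_pullbackMetric G (isOpen_Ioi.prod e.open_target) (contMDiffOn_endParam he)
  symm := fun z => pullbackMetric_symm G _ z
  pos := fun z hz v hv => pullbackMetric_pos G (injective_mfderivModel_endParam he hz) hv
  w_pos := hw_pos
  w_symbol := hw.mono (by linarith)
  a_symbol := (ha.mono (by linarith)).congr e.open_target fun x hx θ hθ => by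
    rw [coefA_eq G he hx hθ]
  b_symbol := fun u => ((hb u).mono (by linarith)).congr e.open_target fun x hx θ hθ => by
    rw [coefB_eq G w he hx hθ, angularB_apply]
  g_symbol := fun u v => (hg u v).congr e.open_target fun x hx θ hθ => by
    rw [coefG_eq G w he hx hθ, angularG_apply]
    rfl
  gbar_smooth := contDiffOn_pullbackMetric gbar e.open_target
    (contMDiffOn_symm_of_mem_maximalAtlas he)
  gbar_pos := fun θ hθ v hv => pullbackMetric_pos gbar (injective_mfderivModel_chart_symm he hθ) hv

theorem tangentBundle_mk_eq {F H X : Type*} [NormedAddCommGroup F] [NormedSpace ℝ F]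
    [TopologicalSpace H] {I : ModelWithCorners ℝ F H} [TopologicalSpace X] [ChartedSpace H X]
    {p p' : X} (h : p = p') {v v' : F} (hv : v = v') :
    (⟨p, v⟩ : TangentBundle I X) = ⟨p', v'⟩ := by
  subst h hv
  rfl

/-- The outgoing unit normal is the vector with vanishing angular momentum. -/
theorem mfderivModel_endParam_eq_outgoingNormal (G : EndMetric R E S)
    {e : OpenPartialHomeomorph S E} (he : e ∈ IsManifold.maximalAtlas 𝓘(ℝ, E) ∞ S)
    (r : HalfLine R) {θ : E} (hθ : θ ∈ e.target) {ξ : ℝ × E}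
    (h0 : ∀ u, pullbackMetric G (endParam R e) (r, θ) ξ (0, u) = 0)
    (h1 : pullbackMetric G (endParam R e) (r, θ) ξ ξ = 1) (hpos : 0 < ξ.1) :
    (mfderivModel (𝓘(ℝ, ℝ).prod 𝓘(ℝ, E)) (endParam R e) (r, θ) ξ : ℝ × E)
      = outgoingNormal G (r, e.symm θ) := by
  have hz : ((r : ℝ), θ) ∈ Ioi R ×ˢ e.target := ⟨r.2, hθ⟩
  have key (v : ℝ × E) : tangentPair (r, e.symm θ) v.1 (coordVec e θ v.2)
      = mfderivModel (𝓘(ℝ, ℝ).prod 𝓘(ℝ, E)) (endParam R e) (r, θ) v := by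
    rw [mfderivModel_endParam he hz]
    rfl
  have hsurj : Function.Surjective (mfderivModel 𝓘(ℝ, E) e.symm θ) :=
    LinearMap.surjective_of_injective (f := (mfderivModel 𝓘(ℝ, E) e.symm θ : E →ₗ[ℝ] E))
      (injective_mfderivModel_chart_symm he hθ)
  refine (existsUnique_outgoingNormal G (r, e.symm θ)).unique ?_
    (existsUnique_outgoingNormal G (r, e.symm θ)).choose_spec.1
  rw [← key]
  refine ⟨fun v => ?_, ?_, hpos⟩
  · obtain ⟨u, rfl⟩ := hsurj v
    refine Eq.trans ?_ (h0 u)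
    rw [endMetric_apply G he r.2 hθ]
    rfl
  · refine Eq.trans ?_ h1
    rw [endMetric_apply G he r.2 hθ]

/-- A solution of the reduced system with vanishing initial angular momentum is, in the chart `e`, a
geodesic issued from the unit normal. -/
theorem normalFlow_eq_of_reducedField [T2Space S] {G : EndMetric R E S} {w : ℝ → ℝ}
    {gbar : E → E →L[ℝ] E →L[ℝ] ℝ} {e : OpenPartialHomeomorph S E}
    (he : e ∈ IsManifold.maximalAtlas 𝓘(ℝ, E) ∞ S)
    (h : IsAsymptotic R τ e.target (pullbackMetric G (endParam R e)) w gbar)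
    (r : HalfLine R) {θ : E} (hθ : θ ∈ e.target) {y : ℝ → ℝ × E} {p : ℝ → (E →L[ℝ] ℝ)}
    (hy : ContDiffOn ℝ ∞ y (Ioi (-1))) (hy0 : y 0 = (0, θ)) (hp0 : p 0 = 0)
    (hmem : ∀ t, -1 < t → (y t).2 ∈ e.target) (hR : ∀ t, -1 < t → R < r + t + (y t).1)
    (h1 : ∀ t, -1 < t → 0 < 1 - w (r + t + (y t).1) ^ 2 * p t
      ((angularG (pullbackMetric G (endParam R e)) w (r + t + (y t).1, (y t).2)).inverse (p t)))
    (h2 : ∀ t, -1 < t → 0 < pullbackMetric G (endParam R e) (r + t + (y t).1, (y t).2) (1, 0) (1, 0)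
      - angularB (pullbackMetric G (endParam R e)) w (r + t + (y t).1, (y t).2)
        ((angularG (pullbackMetric G (endParam R e)) w (r + t + (y t).1, (y t).2)).inverse
          (angularB (pullbackMetric G (endParam R e)) w (r + t + (y t).1, (y t).2))))
    (hode : ∀ t, -1 < t → HasDerivAt (fun s => (((y s).1, (y s).2, p s) : FlowState E))
      (reducedField (pullbackMetric G (endParam R e)) w (r + t + (y t).1, (y t).2, p t)) t)
    {t : ℝ} (ht : 0 ≤ t) :
    InExpDomain G (scaledNormal G r t (e.symm θ)) ∧
      normalFlow G r t (e.symm θ) = endParam R e (r + t + (y t).1, (y t).2) := by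
  set M := pullbackMetric G (endParam R e) with hM
  let c : ℝ → ℝ × E := fun s => (r + s + (y s).1, (y s).2)
  have hcs : ContDiffOn ℝ ∞ c (Ioi (-1)) :=
    ((contDiff_const.add contDiff_id).contDiffOn.add (contDiff_fst.comp_contDiffOn hy)).prodMk
      (contDiff_snd.comp_contDiffOn hy)
  have hc2 {s : ℝ} (hs : -1 < s) : ContDiffAt ℝ 2 c s :=
    (hcs.contDiffAt (Ioi_mem_nhds hs)).of_le (WithTop.coe_le_coe.2 le_top)
  have hcm {s : ℝ} (hs : -1 < s) : c s ∈ Ioi R ×ˢ e.target := ⟨hR s hs, hmem s hs⟩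
  have hdc {s : ℝ} (hs : -1 < s) : deriv c s
      = (radialSpeed M w (c s) (p s), w (c s).1 • angularSpeed M w (c s) (p s)) := by
    have h3 := (hode s hs)
    have h4 : HasDerivAt (fun s => (y s).1) (radialSpeed M w (c s) (p s) - 1) s :=
      (ContinuousLinearMap.fst ℝ ℝ (E × (E →L[ℝ] ℝ))).hasFDerivAt.comp_hasDerivAt s h3
    have h5 : HasDerivAt (fun s => (y s).2) (w (c s).1 • angularSpeed M w (c s) (p s)) s :=
      ((ContinuousLinearMap.fst ℝ E (E →L[ℝ] ℝ)).comp
        (ContinuousLinearMap.snd ℝ ℝ _)).hasFDerivAt.comp_hasDerivAt s h3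
    have h6 := (((hasDerivAt_id s).const_add (r : ℝ)).add h4).prodMk h5
    refine h6.deriv.trans (Prod.ext ?_ rfl)
    change 1 + (radialSpeed M w (c s) (p s) - 1) = radialSpeed M w (c s) (p s)
    ring
  have hinv {s : ℝ} (hs : -1 < s) := h.isInvertible_angularG (hcm hs)
  have hmom {s : ℝ} (hs : -1 < s) (u : E) : M (c s) (deriv c s) (0, u) = p s u := by
    rw [hdc hs]
    exact metric_apply_velocity (h.w_pos _ (hcm hs).1).ne' (h.symm _) (hinv hs) u
  have hen {s : ℝ} (hs : -1 < s) : M (c s) (deriv c s) (deriv c s) = 1 := by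
    rw [hdc hs]
    exact metric_velocity_velocity (h.symm _) (hinv hs) (h1 s hs).le (h2 s hs)
  have hpos {s : ℝ} (hs : -1 < s) : 0 < (deriv c s).1 := by
    rw [hdc hs]
    exact Real.sqrt_pos.2 (div_pos (h1 s hs) (h2 s hs))
  have hEL {s : ℝ} (hs : -1 < s) (v : ℝ × E) : eulerLagrange M c s v = 0 := by
    have h3 : HasDerivAt p (angularForce M w (c s) (p s)) s :=
      ((ContinuousLinearMap.snd ℝ E (E →L[ℝ] ℝ)).comp
        (ContinuousLinearMap.snd ℝ ℝ _)).hasFDerivAt.comp_hasDerivAt s (hode s hs)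
    refine eulerLagrange_eq_zero_of_momentum
      ((h.smooth.contDiffAt ((isOpen_Ioi.prod e.open_target).mem_nhds (hcm hs))).differentiableAt
        (by simp)) (h.symm _) (hc2 hs) h3 (fun u => ?_) ?_ ?_ (hpos hs).ne' v
    · rw [angularForce_apply, hdc hs]
    · filter_upwards [Ioi_mem_nhds hs] with s' hs' u using hmom hs' u
    · filter_upwards [Ioi_mem_nhds hs] with s' hs' using hen hs'
  have h0 : (-1 : ℝ) < 0 := by norm_num
  have hc0 : c 0 = ((r : ℝ), θ) := by simp [c, hy0]
  -- `exp (t ν)` is the end point of the geodesic with initial velocity `t ν` and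
  -- parameter in `[0, 1]`
  let γ : ℝ → HalfLine R × S := fun s => endParam R e (c (t * s))
  have hγ0 : γ 0 = (r, e.symm θ) := by
    simp only [γ, mul_zero, hc0, endParam]
    rw [toHalfLine_of_lt r.2]
  have hγd : (mfderiv 𝓘(ℝ, ℝ) (𝓘(ℝ, ℝ).prod 𝓘(ℝ, E)) γ 0 (1 : ℝ) : ℝ × E)
      = t • outgoingNormal G (r, e.symm θ) := by
    have hz : ((r : ℝ), θ) ∈ Ioi R ×ˢ e.target := ⟨r.2, hθ⟩
    rw [← mfderivModel_endParam_eq_outgoingNormal G he r hθ (ξ := deriv c 0)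
      (fun u => by rw [← hc0, hmom h0, hp0]; rfl) (by rw [← hc0]; exact hen h0) (hpos h0)]
    have h3 : HasDerivAt (fun s => c (t * s)) (t • deriv c 0) 0 := by
      have h4 : HasDerivAt c (deriv c 0) (t * 0) := by
        rw [mul_zero]
        exact ((hc2 h0).differentiableAt (by simp)).hasDerivAt
      have h5 := h4.scomp (0 : ℝ) ((hasDerivAt_id (0 : ℝ)).const_mul t)
      rw [mul_one] at h5
      exact h5
    have h5 : HasMFDerivAt 𝓘(ℝ, ℝ × E) (𝓘(ℝ, ℝ).prod 𝓘(ℝ, E)) (endParam R e) (c (t * 0))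
        (mfderivModel (𝓘(ℝ, ℝ).prod 𝓘(ℝ, E)) (endParam R e) (r, θ)) := by
      rw [mul_zero, hc0]
      exact (((contMDiffOn_endParam he).contMDiffAt
        ((isOpen_Ioi.prod e.open_target).mem_nhds hz)).mdifferentiableAt (by simp)).hasMFDerivAt
    have h6 := h5.comp (0 : ℝ) h3.hasFDerivAt.hasMFDerivAt
    have h7 := congrArg (fun L : ℝ →L[ℝ] ℝ × E => L 1) h6.mfderiv
    refine h7.trans ?_
    change mfderivModel (𝓘(ℝ, ℝ).prod 𝓘(ℝ, E)) (endParam R e) (r, θ) ((1 : ℝ) • t • deriv c 0)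
      = t • mfderivModel (𝓘(ℝ, ℝ).prod 𝓘(ℝ, E)) (endParam R e) (r, θ) (deriv c 0)
    rw [one_smul, map_smul]
  have hgeo : IsUnitTimeGeodesic G (scaledNormal G r t (e.symm θ)) γ := by
    refine ⟨tangentBundle_mk_eq hγ0 hγd, fun s hs => ?_⟩
    have hts : -1 < t * s := by
      have := mul_nonneg ht hs.1
      linarith
    have h3 : ContDiffAt ℝ 2 (fun s => c (t * s)) s :=
      (hc2 hts).comp s (contDiff_const.mul contDiff_id).contDiffAt
    rw [isGeodesicAt_iff_pullback G (isOpen_Ioi.prod e.open_target) (contMDiffOn_endParam he)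
      (c := fun s => c (t * s)) (hcm hts) (injective_mfderivModel_endParam he (hcm hts)) h3
      (Eventually.of_forall fun _ => rfl)]
    intro v
    rw [eulerLagrange_comp_mul_left, ← hM, hEL hts, mul_zero]
  refine ⟨⟨γ, hgeo⟩, ?_⟩
  rw [normalFlow, hgeo.expMap_eq]
  simp only [γ, mul_one, c]

/-- In a chart, near a given point, the normal flow is a small perturbation of `(t, θ) ↦ (t, θ)`. -/
theorem IsAsymptotic.exists_normalFlow_eq [T2Space S] {G : EndMetric R E S} {w : ℝ → ℝ}
    {gbar : E → E →L[ℝ] E →L[ℝ] ℝ} {e : OpenPartialHomeomorph S E}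
    (he : e ∈ IsManifold.maximalAtlas 𝓘(ℝ, E) ∞ S) (hτ : 0 < τ)
    (h : IsAsymptotic R τ e.target (pullbackMetric G (endParam R e)) w gbar)
    {θc : E} {ρ : ℝ} (hρ : 0 < ρ) (hρ4 : ρ ≤ 1 / 4)
    (hball : Metric.closedBall θc (2 * ρ) ⊆ e.target) :
    ∃ C r₁ : ℝ, 0 ≤ C ∧ 1 ≤ r₁ ∧ ∀ r : HalfLine R, r₁ < r →
      ∃ (Y : ℝ → E → ℝ × E) (Yinf : E → ℝ × E),
      IsNearTranslation τ (C * (r : ℝ) ^ (-τ)) (Metric.ball θc (ρ / 2)) Y Yinf ∧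
      ∀ θ ∈ Metric.ball θc (ρ / 2), ∀ t, 0 ≤ t → (Y t θ).2 ∈ Metric.closedBall θc ρ ∧
        InExpDomain G (scaledNormal G r t (e.symm θ)) ∧
        radialPart G r t (e.symm θ) = r + t + (Y t θ).1 ∧
        angularPart G r t (e.symm θ) = e.symm (Y t θ).2 := by
  obtain ⟨C, r₁, hC, hr₁, H⟩ := h.exists_nearTranslation hτ hρ hρ4 hball
  refine ⟨C, r₁, hC, hr₁, fun r hr => ?_⟩
  obtain ⟨Y, Yinf, p, hY, hp⟩ := H r hr
  refine ⟨Y, Yinf, hY, fun θ hθ t ht => ?_⟩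
  obtain ⟨hp0, hp⟩ := hp θ hθ
  have hb1 : Metric.closedBall θc ρ ⊆ e.target :=
    (Metric.closedBall_subset_closedBall (by linarith)).trans hball
  have hb2 : Metric.ball θc (ρ / 2) ⊆ e.target :=
    Metric.ball_subset_closedBall.trans ((Metric.closedBall_subset_closedBall (by linarith)).trans
      hb1)
  have ht1 : -1 < t := by linarith
  have hslice : ContDiffOn ℝ ∞ (fun t => Y t θ) (Ioi (-1)) :=
    hY.contDiffOn.comp (f := fun t : ℝ => (t, θ)) (contDiff_prodMk_left θ).contDiffOn
      fun t ht => ⟨ht, hθ⟩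
  obtain ⟨h1, h2⟩ := normalFlow_eq_of_reducedField he h r (hb2 hθ) hslice (hY.initial θ hθ) hp0
    (fun s hs => hb1 (hp s hs).1) (fun s hs => (hp s hs).2.1) (fun s hs => (hp s hs).2.2.1)
    (fun s hs => (hp s hs).2.2.2.1) (fun s hs => (hp s hs).2.2.2.2) ht
  refine ⟨(hp t ht1).1, h1, ?_, ?_⟩
  · rw [radialPart, h2, endParam]
    dsimp only
    rw [toHalfLine_of_lt (hp t ht1).2.1]
  · rw [angularPart, h2]
    rfl

end GeometricFlow

/-! ### Local diffeomorphisms and entourages of the diagonal -/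

section LocalDiffeomorphisms

variable {F : Type*} [NormedAddCommGroup F] [NormedSpace ℝ F] [CompleteSpace F]

/-- A smooth perturbation of the identity by a contraction is a local diffeomorphism. -/
theorem isLocalDiffeomorphAt_of_near_id {φ : F → F} {U : Set F} (hU : IsOpen U)
    (hφ : ContDiffOn ℝ ∞ φ U)
    (hlip : ∀ x ∈ U, ∀ y ∈ U, ‖(φ x - x) - (φ y - y)‖ ≤ 1 / 4 * ‖x - y‖) {x : F} (hx : x ∈ U) :
    IsLocalDiffeomorphAt 𝓘(ℝ, F) 𝓘(ℝ, F) ∞ φ x := by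
  have h1 : ApproximatesLinearOn φ ((ContinuousLinearEquiv.refl ℝ F : F ≃L[ℝ] F) : F →L[ℝ] F) U
      (1 / 4) := by
    intro x hx y hy
    refine le_trans (le_of_eq ?_) ((hlip x hx y hy).trans (le_of_eq (by norm_num)))
    congr 1
    simp only [ContinuousLinearEquiv.coe_refl, ContinuousLinearMap.id_apply]
    abel
  have h2 : Subsingleton F ∨ (1 / 4 : NNReal) <
      ‖((ContinuousLinearEquiv.refl ℝ F).symm : F →L[ℝ] F)‖₊⁻¹ := by
    rcases subsingleton_or_nontrivial F with h | h
    · exact Or.inl h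
    · refine Or.inr ?_
      have : ‖((ContinuousLinearEquiv.refl ℝ F).symm : F →L[ℝ] F)‖₊ = 1 :=
        NNReal.eq ContinuousLinearMap.norm_id
      rw [this, inv_one, ← NNReal.coe_lt_coe]
      norm_num
  let Φ := h1.toOpenPartialHomeomorph φ U h2 hU
  have hd {y : F} (hy : y ∈ U) : ∃ L : F ≃L[ℝ] F, HasFDerivAt φ (L : F →L[ℝ] F) y := by
    have h3 : DifferentiableAt ℝ φ y := (hφ.contDiffAt (hU.mem_nhds hy)).differentiableAt (by simp)
    have h4 : ‖fderiv ℝ (fun z => φ z - z) y‖ ≤ 1 / 4 := by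
      refine norm_fderiv_le_of_lip' ℝ (by norm_num) ?_
      filter_upwards [hU.mem_nhds hy] with z hz using hlip z hz y hy
    have h5 := h3.hasFDerivAt.sub (hasFDerivAt_id y)
    have h6 : ‖-fderiv ℝ (fun z => φ z - z) y‖ < 1 := by
      rw [norm_neg]
      linarith
    refine ⟨ContinuousLinearEquiv.unitsEquiv ℝ F (Units.oneSub _ h6), ?_⟩
    refine h3.hasFDerivAt.congr_fderiv ?_
    ext v
    have h7 : fderiv ℝ (fun z => φ z - z) y = fderiv ℝ φ y - ContinuousLinearMap.id ℝ F := h5.fderiv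
    simp [h7]
  refine ⟨⟨Φ.toPartialEquiv, Φ.open_source, Φ.open_target, hφ.contMDiffOn, ?_⟩, hx,
    fun _ _ => rfl⟩
  intro a ha
  have ha' : Φ.symm a ∈ U := Φ.map_target ha
  obtain ⟨L, hL⟩ := hd ha'
  exact (Φ.contDiffAt_symm ha hL (hφ.contDiffAt (hU.mem_nhds ha'))).contMDiffAt.contMDiffWithinAt

theorem _root_.IsLocalDiffeomorphAt.congr_of_eventuallyEq {F F' H H' X X' : Type*}
    [NormedAddCommGroup F] [NormedSpace ℝ F] [NormedAddCommGroup F'] [NormedSpace ℝ F']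
    [TopologicalSpace H] [TopologicalSpace H'] [TopologicalSpace X] [TopologicalSpace X']
    [ChartedSpace H X] [ChartedSpace H' X'] {I : ModelWithCorners ℝ F H}
    {J : ModelWithCorners ℝ F' H'} {f g : X → X'} {x : X}
    (hf : IsLocalDiffeomorphAt I J ∞ f x) (h : g =ᶠ[𝓝 x] f) :
    IsLocalDiffeomorphAt I J ∞ g x := by
  obtain ⟨Φ, hx, hΦ⟩ := hf
  obtain ⟨s, hs, hso, hxs⟩ := eventually_nhds_iff.1 h
  let Φ' := Φ.toOpenPartialHomeomorph.restrOpen s hso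
  refine ⟨⟨Φ'.toPartialEquiv, Φ'.open_source, Φ'.open_target, ?_, ?_⟩, ⟨hx, hxs⟩, ?_⟩
  · exact Φ.contMDiffOn_toFun.mono inter_subset_left
  · exact Φ.contMDiffOn_invFun.mono inter_subset_left
  · rintro y ⟨hy, hys⟩
    exact (hs y hys).trans (hΦ hy)

variable {E S : Type*} [NormedAddCommGroup E] [NormedSpace ℝ E]
  [TopologicalSpace S] [ChartedSpace E S] [IsManifold 𝓘(ℝ, E) ∞ S] {R : ℝ}

/-- A chart, as a partial diffeomorphism. -/
def chartDiffeomorph {e : OpenPartialHomeomorph S E}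
    (he : e ∈ IsManifold.maximalAtlas 𝓘(ℝ, E) ∞ S) :
    PartialDiffeomorph 𝓘(ℝ, E) 𝓘(ℝ, E) S E ∞ where
  toPartialEquiv := e.toPartialEquiv
  open_source := e.open_source
  open_target := e.open_target
  contMDiffOn_toFun := contMDiffOn_of_mem_maximalAtlas he
  contMDiffOn_invFun := contMDiffOn_symm_of_mem_maximalAtlas he

theorem contMDiff_coe_halfLine :
    ContMDiff 𝓘(ℝ, ℝ) 𝓘(ℝ, ℝ) ∞ (fun x : HalfLine R => (x : ℝ)) := contMDiff_subtype_val

/-- The coordinates of the end, as a partial diffeomorphism. -/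
def endDiffeomorph (R : ℝ) {e : OpenPartialHomeomorph S E}
    (he : e ∈ IsManifold.maximalAtlas 𝓘(ℝ, E) ∞ S) :
    PartialDiffeomorph (𝓘(ℝ, ℝ).prod 𝓘(ℝ, E)) 𝓘(ℝ, ℝ × E) (HalfLine R × S) (ℝ × E) ∞ where
  toFun q := (q.1, e q.2)
  invFun := endParam R e
  source := univ ×ˢ e.source
  target := Ioi R ×ˢ e.target
  map_source' q hq := ⟨q.1.2, e.map_source hq.2⟩
  map_target' z hz := ⟨mem_univ _, e.map_target hz.2⟩
  left_inv' q hq := Prod.ext (toHalfLine_of_lt q.1.2) (e.left_inv hq.2)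
  right_inv' z hz := by
    refine Prod.ext ?_ (e.right_inv hz.2)
    rw [endParam]
    dsimp only
    rw [toHalfLine_of_lt hz.1]
  open_source := isOpen_univ.prod e.open_source
  open_target := isOpen_Ioi.prod e.open_target
  contMDiffOn_toFun := by
    have h1 : ContMDiffOn (𝓘(ℝ, ℝ).prod 𝓘(ℝ, E)) 𝓘(ℝ, E) ∞ (fun q : HalfLine R × S => e q.2)
        (univ ×ˢ e.source) :=
      (contMDiffOn_of_mem_maximalAtlas he).comp contMDiff_snd.contMDiffOn fun q hq => hq.2
    exact (contMDiff_coe_halfLine.comp contMDiff_fst).contMDiffOn.prodMk_space h1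
  contMDiffOn_invFun := contMDiffOn_endParam he

end LocalDiffeomorphisms

section Covers

variable {E S : Type*} [NormedAddCommGroup E] [TopologicalSpace S]

theorem eventually_nhdsSet_diagonal {K O : Set S} (hK : IsClosed K) (hO : IsOpen O) (h : K ⊆ O) :
    ∀ᶠ p in 𝓝ˢ (diagonal S), p.1 ∈ K → p.2 ∈ O := by
  have h1 : IsOpen {p : S × S | p.1 ∈ K → p.2 ∈ O} := by
    have : {p : S × S | p.1 ∈ K → p.2 ∈ O} = {p | p.1 ∈ Kᶜ} ∪ {p | p.2 ∈ O} := by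
      ext p
      simp [imp_iff_not_or]
    rw [this]
    exact (hK.isOpen_compl.preimage continuous_fst).union (hO.preimage continuous_snd)
  refine h1.mem_nhdsSet.2 ?_
  rintro ⟨p, q⟩ (rfl : p = q) hp
  exact h hp

variable [CompactSpace S] [T2Space S]

/-- Lebesgue's number lemma, with an entourage of the diagonal in place of the number. -/
theorem eventually_exists_cell {ι : Type*} {O : ι → Set S} (hO : ∀ i, IsOpen (O i))
    (hc : ⋃ i, O i = univ) :
    ∃ W ∈ 𝓝ˢ (diagonal S), ∀ p, ∃ i, ∀ q, (q, p) ∈ W → q ∈ O i := by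
  let _ : UniformSpace S := uniformSpaceOfCompactR1
  obtain ⟨W, hW, h⟩ := lebesgue_number_lemma (isCompact_univ : IsCompact (univ : Set S)) hO hc.ge
  refine ⟨Prod.swap ⁻¹' W, ?_, fun p => ?_⟩
  · rw [nhdsSet_diagonal_eq_uniformity]
    exact symm_le_uniformity hW
  · obtain ⟨i, hi⟩ := h p (mem_univ p)
    exact ⟨i, fun q hq => hi hq⟩

/-- Each entourage contains the composition of a closed symmetric entourage with itself. -/
theorem exists_closed_comp_subset {W : Set (S × S)} (hW : W ∈ 𝓝ˢ (diagonal S)) :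
    ∃ W' ∈ 𝓝ˢ (diagonal S), IsClosed W' ∧ (∀ p q, (p, q) ∈ W' → (q, p) ∈ W') ∧
      ∀ p q s, (p, q) ∈ W' → (q, s) ∈ W' → (p, s) ∈ W := by
  let _ : UniformSpace S := uniformSpaceOfCompactR1
  rw [nhdsSet_diagonal_eq_uniformity] at hW ⊢
  obtain ⟨V, hV, hVW⟩ := comp_mem_uniformity_sets hW
  obtain ⟨V', ⟨hV', hc⟩, hVV⟩ := uniformity_hasBasis_closed.mem_iff.1 hV
  refine ⟨V' ∩ Prod.swap ⁻¹' V', inter_mem hV' (symm_le_uniformity hV'),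
    hc.inter (hc.preimage continuous_swap), fun p q h => ⟨h.2, h.1⟩, fun p q s h h' => ?_⟩
  exact hVW ⟨q, hVV h.1, hVV h'.1⟩

/-- A continuous map on a compact set is uniformly continuous. -/
theorem exists_norm_sub_le_imp_mem {f : E → S} {K : Set E} (hK : IsCompact K)
    (hf : ContinuousOn f K) {W : Set (S × S)} (hW : W ∈ 𝓝ˢ (diagonal S)) :
    ∃ η > 0, ∀ x ∈ K, ∀ y ∈ K, ‖y - x‖ ≤ η → (f x, f y) ∈ W := by
  let _ : UniformSpace S := uniformSpaceOfCompactR1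
  rw [nhdsSet_diagonal_eq_uniformity] at hW
  have h1 := hK.uniformContinuousOn_of_continuous hf
  obtain ⟨η, hη, h2⟩ := Metric.mem_uniformity_dist.1 (mem_inf_principal.1 (h1 hW))
  refine ⟨η / 2, by positivity, fun x hx y hy hxy => h2 (a := x) (b := y) ?_ ⟨hx, hy⟩⟩
  rw [dist_eq_norm, norm_sub_rev]
  linarith

end Covers

/-! ### Flows close to the identity on a compact manifold -/

section Cell

variable {E S κ : Type*} [NormedAddCommGroup E] [TopologicalSpace S]

/-- The points whose coordinates lie in the ball of the cell `k`. -/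
def cell (e : κ → OpenPartialHomeomorph S E) (θc : κ → E) (ρ : κ → ℝ) (k : κ) : Set S :=
  (e k).source ∩ e k ⁻¹' Metric.ball (θc k) (ρ k / 2)

theorem isOpen_cell {e : κ → OpenPartialHomeomorph S E} {θc : κ → E} {ρ : κ → ℝ} (k : κ) :
    IsOpen (cell e θc ρ k) :=
  (e k).isOpen_inter_preimage Metric.isOpen_ball

end Cell

section Globalization

variable {E S : Type*} [NormedAddCommGroup E] [NormedSpace ℝ E]
  [TopologicalSpace S] [ChartedSpace E S]

/-- A family of coordinate balls of `S` such that all the points `W`-close to a given one lie in one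
of them, and such that moving by at most `δ` in the coordinates gives `W`-close points. -/
structure ChartCover [IsManifold 𝓘(ℝ, E) ∞ S] {κ : Type*} (e : κ → OpenPartialHomeomorph S E)
    (θc : κ → E) (ρ : κ → ℝ) (δ : ℝ) (W : Set (S × S)) : Prop where
  mem_atlas : ∀ k, e k ∈ IsManifold.maximalAtlas 𝓘(ℝ, E) ∞ S
  rho_pos : ∀ k, 0 < ρ k
  closedBall_subset : ∀ k, Metric.closedBall (θc k) (ρ k) ⊆ (e k).target
  refl : ∀ p, (p, p) ∈ W
  exists_cell : ∀ p, ∃ k, ∀ q, (q, p) ∈ W → ∃ θ ∈ Metric.ball (θc k) (ρ k / 2), (e k).symm θ = q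
  close : ∀ k, ∀ θ ∈ Metric.closedBall (θc k) (ρ k), ∀ θ' ∈ Metric.closedBall (θc k) (ρ k),
    ‖θ' - θ‖ ≤ δ → ((e k).symm θ, (e k).symm θ') ∈ W

variable [IsManifold 𝓘(ℝ, E) ∞ S] {κ : Type*} {e : κ → OpenPartialHomeomorph S E}
  {θc : κ → E} {ρ : κ → ℝ} {δ : ℝ} {W : Set (S × S)}

namespace ChartCover

theorem exists_coord (hc : ChartCover e θc ρ δ W) (p : S) :
    ∃ k, ∃ θ ∈ Metric.ball (θc k) (ρ k / 2), (e k).symm θ = p := by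
  obtain ⟨k, hk⟩ := hc.exists_cell p
  exact ⟨k, hk p (hc.refl p)⟩

theorem ball_subset (hc : ChartCover e θc ρ δ W) (k : κ) :
    Metric.ball (θc k) (ρ k / 2) ⊆ Metric.closedBall (θc k) (ρ k) :=
  Metric.ball_subset_closedBall.trans
    (Metric.closedBall_subset_closedBall (by have := hc.rho_pos k; linarith))

theorem ball_subset_target (hc : ChartCover e θc ρ δ W) (k : κ) :
    Metric.ball (θc k) (ρ k / 2) ⊆ (e k).target :=
  (hc.ball_subset k).trans (hc.closedBall_subset k)

theorem mem_cell (hc : ChartCover e θc ρ δ W) {k : κ} {θ : E}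
    (hθ : θ ∈ Metric.ball (θc k) (ρ k / 2)) : (e k).symm θ ∈ cell e θc ρ k := by
  have h1 := hc.ball_subset_target k hθ
  refine ⟨(e k).map_target h1, ?_⟩
  rw [mem_preimage, (e k).right_inv h1]
  exact hθ

theorem isPreconnected_image (hc : ChartCover e θc ρ δ W) (k : κ) :
    IsPreconnected ((e k).symm '' Metric.closedBall (θc k) (ρ k)) :=
  (convex_closedBall (θc k) (ρ k)).isPreconnected.image _
    ((e k).continuousOn_symm.mono (hc.closedBall_subset k))

end ChartCover

/-- A clopen set meeting a connected set through each point is everything. -/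
theorem eq_univ_of_isClopen {Y : Type*} [TopologicalSpace Y] {A : Set Y} (hA : IsClopen A)
    (h : ∀ y, ∃ C : Set Y, IsPreconnected C ∧ y ∈ C ∧ (C ∩ A).Nonempty) : A = univ := by
  refine eq_univ_of_forall fun y => ?_
  obtain ⟨C, hC, hy, hCA⟩ := h y
  exact hC.subset_isClopen hA hCA hy

/-- A map of `S` that is in all the cells a small perturbation of the identity is a
diffeomorphism. -/
theorem ChartCover.exists_diffeomorph [CompleteSpace E] [CompactSpace S] [T2Space S]
    (hc : ChartCover e θc ρ δ W) {f : S → S} {F : κ → E → E}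
    (hf : ∀ k, ∀ θ ∈ Metric.ball (θc k) (ρ k / 2), f ((e k).symm θ) = (e k).symm (F k θ))
    (hF : ∀ k, ContDiffOn ℝ ∞ (F k) (Metric.ball (θc k) (ρ k / 2)))
    (hmem : ∀ k, ∀ θ ∈ Metric.ball (θc k) (ρ k / 2), F k θ ∈ Metric.closedBall (θc k) (ρ k))
    (hnear : ∀ k, ∀ θ ∈ Metric.ball (θc k) (ρ k / 2), ‖F k θ - θ‖ ≤ δ)
    (hlip : ∀ k, ∀ θ ∈ Metric.ball (θc k) (ρ k / 2), ∀ θ' ∈ Metric.ball (θc k) (ρ k / 2),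
      ‖(F k θ - θ) - (F k θ' - θ')‖ ≤ 1 / 4 * ‖θ - θ'‖) :
    ∃ Φ : S ≃ₘ^∞⟮𝓘(ℝ, E), 𝓘(ℝ, E)⟯ S, ∀ σ, Φ σ = f σ := by
  have hW (σ : S) : (σ, f σ) ∈ W := by
    obtain ⟨k, θ, hθ, rfl⟩ := hc.exists_coord σ
    rw [hf k θ hθ]
    exact hc.close k θ (hc.ball_subset k hθ) _ (hmem k θ hθ) (hnear k θ hθ)
  have hloc : IsLocalDiffeomorph 𝓘(ℝ, E) 𝓘(ℝ, E) ∞ f := by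
    intro σ
    obtain ⟨k, θ, hθ, rfl⟩ := hc.exists_coord σ
    have hθt := hc.ball_subset_target k hθ
    have h1 : IsLocalDiffeomorphAt 𝓘(ℝ, E) 𝓘(ℝ, E) ∞ (e k) ((e k).symm θ) :=
      (chartDiffeomorph (hc.mem_atlas k)).isLocalDiffeomorphAt _ _ _ ((e k).map_target hθt)
    have h2 : IsLocalDiffeomorphAt 𝓘(ℝ, E) 𝓘(ℝ, E) ∞ (F k) (e k ((e k).symm θ)) := by
      rw [(e k).right_inv hθt]
      exact isLocalDiffeomorphAt_of_near_id Metric.isOpen_ball (hF k) (hlip k) hθ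
    have h3 : IsLocalDiffeomorphAt 𝓘(ℝ, E) 𝓘(ℝ, E) ∞ (e k).symm (F k (e k ((e k).symm θ))) := by
      rw [(e k).right_inv hθt]
      exact (chartDiffeomorph (hc.mem_atlas k)).symm.isLocalDiffeomorphAt _ _ _
        (hc.closedBall_subset k (hmem k θ hθ))
    refine (h1.comp _ _ (h2.comp _ _ h3)).congr_of_eventuallyEq ?_
    filter_upwards [(isOpen_cell k).mem_nhds (hc.mem_cell hθ)] with q hq
    have h4 := hf k _ hq.2
    rw [(e k).left_inv hq.1] at h4
    exact h4
  -- two points with the same image are both close to it, hence in a common cell, where the map is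
  -- injective
  have hinj : Function.Injective f := by
    intro σ σ' h
    obtain ⟨k, hk⟩ := hc.exists_cell (f σ)
    obtain ⟨θ, hθ, rfl⟩ := hk _ (hW σ)
    obtain ⟨θ', hθ', rfl⟩ := hk σ' (by rw [h]; exact hW σ')
    rw [hf k θ hθ, hf k θ' hθ'] at h
    have h1 : F k θ = F k θ' := (e k).symm.injOn (hc.closedBall_subset k (hmem k θ hθ))
      (hc.closedBall_subset k (hmem k θ' hθ')) h
    have h2 := hlip k θ hθ θ' hθ'
    rw [h1, sub_sub_sub_cancel_left, norm_sub_rev] at h2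
    have h3 : ‖θ - θ'‖ = 0 := by linarith [norm_nonneg (θ - θ')]
    rw [sub_eq_zero.1 (norm_eq_zero.1 h3)]
  -- the image is open and compact, and meets all the cells
  have hsurj : Function.Surjective f := by
    rw [← range_eq_univ]
    refine eq_univ_of_isClopen
      ⟨(isCompact_range hloc.contMDiff.continuous).isClosed, hloc.isOpen_range⟩ fun σ => ?_
    obtain ⟨k, θ, hθ, rfl⟩ := hc.exists_coord σ
    refine ⟨_, hc.isPreconnected_image k, mem_image_of_mem _ (hc.ball_subset k hθ),
      f ((e k).symm θ), ?_, mem_range_self _⟩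
    rw [hf k θ hθ]
    exact mem_image_of_mem _ (hmem k θ hθ)
  exact ⟨hloc.diffeomorphOfBijective ⟨hinj, hsurj⟩, fun _ => rfl⟩

/-- The flow `(rad, ang)` on `S` is described in the cells of a cover by nearly constant
displacements. -/
structure IsFlow (hc : ChartCover e θc ρ δ W) (r τ : ℝ) (rad : ℝ → S → ℝ) (ang : ℝ → S → S)
    (Y : κ → ℝ → E → ℝ × E) (Yinf : κ → E → ℝ × E) : Prop where
  near : ∀ k, IsNearTranslation τ δ (Metric.ball (θc k) (ρ k / 2)) (Y k) (Yinf k)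
  mem : ∀ k, ∀ θ ∈ Metric.ball (θc k) (ρ k / 2), ∀ t, 0 ≤ t →
    (Y k t θ).2 ∈ Metric.closedBall (θc k) (ρ k)
  rad_eq : ∀ k, ∀ θ ∈ Metric.ball (θc k) (ρ k / 2), ∀ t, 0 ≤ t →
    rad t ((e k).symm θ) = r + t + (Y k t θ).1
  ang_eq : ∀ k, ∀ θ ∈ Metric.ball (θc k) (ρ k / 2), ∀ t, 0 ≤ t →
    ang t ((e k).symm θ) = (e k).symm (Y k t θ).2

namespace IsFlow

variable {hc : ChartCover e θc ρ δ W} {r τ : ℝ} {rad : ℝ → S → ℝ} {ang : ℝ → S → S}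
  {Y : κ → ℝ → E → ℝ × E} {Yinf : κ → E → ℝ × E}

/-- Points are moved to `W`-close ones. -/
theorem mem_entourage (hf : IsFlow hc r τ rad ang Y Yinf) {t : ℝ} (ht : 0 ≤ t) (σ : S) :
    (σ, ang t σ) ∈ W := by
  obtain ⟨k, θ, hθ, rfl⟩ := hc.exists_coord σ
  rw [hf.ang_eq k θ hθ t ht]
  exact hc.close k θ (hc.ball_subset k hθ) _ (hf.mem k θ hθ t ht)
    ((norm_snd_le (Y k t θ - (0, θ))).trans ((hf.near k).near t ht θ hθ))

theorem mem_lim (hf : IsFlow hc r τ rad ang Y Yinf) {k : κ} {θ : E}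
    (hθ : θ ∈ Metric.ball (θc k) (ρ k / 2)) : (Yinf k θ).2 ∈ Metric.closedBall (θc k) (ρ k) := by
  refine Metric.isClosed_closedBall.mem_of_tendsto
    ((continuous_snd.tendsto _).comp ((hf.near k).tendsto θ hθ)) ?_
  filter_upwards [eventually_ge_atTop 0] with t ht using hf.mem k θ hθ t ht

theorem lipschitz_slice (hf : IsFlow hc r τ rad ang Y Yinf) (hδ : δ ≤ 1 / 4) {k : κ} {t : ℝ}
    (ht : 0 ≤ t) {θ θ' : E} (hθ : θ ∈ Metric.ball (θc k) (ρ k / 2))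
    (hθ' : θ' ∈ Metric.ball (θc k) (ρ k / 2)) :
    ‖((Y k t θ).2 - θ) - ((Y k t θ').2 - θ')‖ ≤ 1 / 4 * ‖θ - θ'‖ := by
  have h1 := (hf.near k).lipschitz t ht t ht θ hθ θ' hθ'
  rw [sub_self, abs_zero, max_eq_right (norm_nonneg _)] at h1
  exact (norm_snd_le ((Y k t θ - (0, θ)) - (Y k t θ' - (0, θ')))).trans
    (h1.trans (mul_le_mul_of_nonneg_right hδ (norm_nonneg _)))

/-- At each time, the angular part of the flow is a diffeomorphism. -/
theorem exists_diffeomorph_ang [CompleteSpace E] [CompactSpace S] [T2Space S]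
    (hf : IsFlow hc r τ rad ang Y Yinf) (hδ : δ ≤ 1 / 4) {t : ℝ} (ht : 0 ≤ t) :
    ∃ Φ : S ≃ₘ^∞⟮𝓘(ℝ, E), 𝓘(ℝ, E)⟯ S, ∀ σ, Φ σ = ang t σ := by
  refine hc.exists_diffeomorph (F := fun k θ => (Y k t θ).2)
    (fun k θ hθ => hf.ang_eq k θ hθ t ht) (fun k => ?_) (fun k θ hθ => hf.mem k θ hθ t ht)
    (fun k θ hθ => (norm_snd_le (Y k t θ - (0, θ))).trans ((hf.near k).near t ht θ hθ))
    fun k θ hθ θ' hθ' => hf.lipschitz_slice hδ ht hθ hθ'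
  have ht1 : -1 < t := by linarith
  exact contDiff_snd.comp_contDiffOn ((hf.near k).contDiffOn.comp (f := fun θ => (t, θ))
    (contDiff_prodMk_right t).contDiffOn fun θ hθ => ⟨ht1, hθ⟩)

/-- The angular part of the flow converges to a diffeomorphism, whose coordinates in the cells are
the limits of the coordinates. -/
theorem exists_limit [CompleteSpace E] [CompactSpace S] [T2Space S]
    (hf : IsFlow hc r τ rad ang Y Yinf) (hδ : δ ≤ 1 / 4) :
    ∃ Ω : S ≃ₘ^∞⟮𝓘(ℝ, E), 𝓘(ℝ, E)⟯ S, (∀ σ, Tendsto (fun t => ang t σ) atTop (𝓝 (Ω σ))) ∧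
      (∀ k, ∀ θ ∈ Metric.ball (θc k) (ρ k / 2), Ω ((e k).symm θ) = (e k).symm (Yinf k θ).2) ∧
      ∀ σ, (σ, Ω σ) ∈ W := by
  have hlim (k : κ) (θ : E) (hθ : θ ∈ Metric.ball (θc k) (ρ k / 2)) :
      Tendsto (fun t => ang t ((e k).symm θ)) atTop (𝓝 ((e k).symm (Yinf k θ).2)) := by
    have h1 : Tendsto (fun t => (Y k t θ).2) atTop (𝓝 (Yinf k θ).2) :=
      (continuous_snd.tendsto _).comp ((hf.near k).tendsto θ hθ)
    refine ((((e k).continuousAt_symm (hc.closedBall_subset k (hf.mem_lim hθ))).tendsto.comp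
      h1).congr' ?_)
    filter_upwards [eventually_ge_atTop 0] with t ht using (hf.ang_eq k θ hθ t ht).symm
  have hex (σ : S) : ∃ p, Tendsto (fun t => ang t σ) atTop (𝓝 p) := by
    obtain ⟨k, θ, hθ, rfl⟩ := hc.exists_coord σ
    exact ⟨_, hlim k θ hθ⟩
  choose f hf' using hex
  have hfeq (k : κ) (θ : E) (hθ : θ ∈ Metric.ball (θc k) (ρ k / 2)) :
      f ((e k).symm θ) = (e k).symm (Yinf k θ).2 := tendsto_nhds_unique (hf' _) (hlim k θ hθ)
  have hnear (k : κ) (θ : E) (hθ : θ ∈ Metric.ball (θc k) (ρ k / 2)) :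
      ‖(Yinf k θ).2 - θ‖ ≤ δ := by
    have h1 : Tendsto (fun t => ‖Y k t θ - (0, θ)‖) atTop (𝓝 ‖Yinf k θ - (0, θ)‖) :=
      (((hf.near k).tendsto θ hθ).sub_const _).norm
    refine (norm_snd_le (Yinf k θ - (0, θ))).trans (le_of_tendsto h1 ?_)
    filter_upwards [eventually_ge_atTop 0] with t ht using (hf.near k).near t ht θ hθ
  obtain ⟨Ω, hΩ⟩ := hc.exists_diffeomorph (f := f) (F := fun k θ => (Yinf k θ).2) hfeq
    (fun k => contDiff_snd.comp_contDiffOn (hf.near k).contDiffOn_lim)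
    (fun k θ hθ => hf.mem_lim hθ) hnear fun k θ hθ θ' hθ' => by
      have h1 (θ : E) (hθ : θ ∈ Metric.ball (θc k) (ρ k / 2)) :
          Tendsto (fun t => (Y k t θ).2 - θ) atTop (𝓝 ((Yinf k θ).2 - θ)) :=
        ((continuous_snd.tendsto _).comp ((hf.near k).tendsto θ hθ)).sub_const _
      refine le_of_tendsto ((h1 θ hθ).sub (h1 θ' hθ')).norm ?_
      filter_upwards [eventually_ge_atTop 0] with t ht using hf.lipschitz_slice hδ ht hθ hθ'
  refine ⟨Ω, fun σ => by rw [hΩ]; exact hf' σ, fun k θ hθ => by rw [hΩ]; exact hfeq k θ hθ,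
    fun σ => ?_⟩
  obtain ⟨k, θ, hθ, rfl⟩ := hc.exists_coord σ
  rw [hΩ, hfeq k θ hθ]
  exact hc.close k θ (hc.ball_subset k hθ) _ (hf.mem_lim hθ) (hnear k θ hθ)

/-- The excess `x - t` of the radial part converges to a smooth function. -/
theorem exists_radial_limit (hf : IsFlow hc r τ rad ang Y Yinf) :
    ∃ φ : S → ℝ, ContMDiff 𝓘(ℝ, E) 𝓘(ℝ, ℝ) ∞ φ ∧
      ∀ k, ∀ θ ∈ Metric.ball (θc k) (ρ k / 2), φ ((e k).symm θ) = r + (Yinf k θ).1 := by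
  have hlim (k : κ) (θ : E) (hθ : θ ∈ Metric.ball (θc k) (ρ k / 2)) :
      Tendsto (fun t => rad t ((e k).symm θ) - t) atTop (𝓝 (r + (Yinf k θ).1)) := by
    have h1 : Tendsto (fun t => r + (Y k t θ).1) atTop (𝓝 (r + (Yinf k θ).1)) :=
      ((continuous_fst.tendsto _).comp ((hf.near k).tendsto θ hθ)).const_add _
    refine h1.congr' ?_
    filter_upwards [eventually_ge_atTop 0] with t ht
    rw [hf.rad_eq k θ hθ t ht]
    ring
  have hex (σ : S) : ∃ p, Tendsto (fun t => rad t σ - t) atTop (𝓝 p) := by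
    obtain ⟨k, θ, hθ, rfl⟩ := hc.exists_coord σ
    exact ⟨_, hlim k θ hθ⟩
  choose φ hφ using hex
  have hφeq (k : κ) (θ : E) (hθ : θ ∈ Metric.ball (θc k) (ρ k / 2)) :
      φ ((e k).symm θ) = r + (Yinf k θ).1 := tendsto_nhds_unique (hφ _) (hlim k θ hθ)
  refine ⟨φ, fun σ => ?_, hφeq⟩
  obtain ⟨k, θ, hθ, rfl⟩ := hc.exists_coord σ
  have hmem := hc.mem_cell hθ
  have h1 : ContMDiffAt 𝓘(ℝ, E) 𝓘(ℝ, E) ∞ (e k) ((e k).symm θ) :=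
    (contMDiffOn_of_mem_maximalAtlas (hc.mem_atlas k)).contMDiffAt
      ((e k).open_source.mem_nhds hmem.1)
  have h2 : ContMDiffAt 𝓘(ℝ, E) 𝓘(ℝ, ℝ) ∞ (fun θ => r + (Yinf k θ).1) (e k ((e k).symm θ)) :=
    (contDiffAt_const.add (contDiffAt_fst.comp _ ((hf.near k).contDiffOn_lim.contDiffAt
      (Metric.isOpen_ball.mem_nhds hmem.2)))).contMDiffAt
  refine (h2.comp _ h1).congr_of_eventuallyEq ?_
  filter_upwards [(isOpen_cell k).mem_nhds hmem] with q hq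
  have h4 := hφeq k _ hq.2
  rw [(e k).left_inv hq.1] at h4
  exact h4

end IsFlow

end Globalization

/-! ### The flow map of the end -/

section FlowMap

variable {E S : Type*} [NormedAddCommGroup E] [NormedSpace ℝ E]
  [TopologicalSpace S] [ChartedSpace E S] [IsManifold 𝓘(ℝ, E) ∞ S] {κ : Type*}
  {e : κ → OpenPartialHomeomorph S E} {θc : κ → E} {ρ : κ → ℝ} {δ : ℝ} {W : Set (S × S)}
  {hc : ChartCover e θc ρ δ W} {r τ : ℝ} {rad : ℝ → S → ℝ} {ang : ℝ → S → S}
  {Y : κ → ℝ → E → ℝ × E} {Yinf : κ → E → ℝ × E}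

namespace IsFlow

theorem rad_zero (hf : IsFlow hc r τ rad ang Y Yinf) (σ : S) : rad 0 σ = r := by
  obtain ⟨k, θ, hθ, rfl⟩ := hc.exists_coord σ
  rw [hf.rad_eq k θ hθ 0 le_rfl, (hf.near k).initial θ hθ]
  simp

theorem ang_zero (hf : IsFlow hc r τ rad ang Y Yinf) (σ : S) : ang 0 σ = σ := by
  obtain ⟨k, θ, hθ, rfl⟩ := hc.exists_coord σ
  rw [hf.ang_eq k θ hθ 0 le_rfl, (hf.near k).initial θ hθ]

/-- Along the flow, `x` grows at least at half the unit speed. -/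
theorem le_rad (hf : IsFlow hc r τ rad ang Y Yinf) (hδ : δ ≤ 1 / 4) {t : ℝ} (ht : 0 ≤ t) (σ : S) :
    r + t / 2 ≤ rad t σ := by
  obtain ⟨k, θ, hθ, rfl⟩ := hc.exists_coord σ
  have h1 := (hf.near k).lipschitz t ht 0 le_rfl θ hθ θ hθ
  rw [(hf.near k).initial θ hθ, sub_self, sub_zero, sub_zero, sub_self, norm_zero,
    max_eq_left (abs_nonneg _), abs_of_nonneg ht] at h1
  have h2 := (norm_fst_le (Y k t θ - (0, θ))).trans (h1.trans (mul_le_mul_of_nonneg_right hδ ht))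
  rw [Prod.fst_sub, sub_zero, Real.norm_eq_abs] at h2
  rw [hf.rad_eq k θ hθ t ht]
  linarith [neg_le_of_abs_le h2]

/-- The flow in the coordinates of a cell. -/
theorem lipschitz_coord (hf : IsFlow hc r τ rad ang Y Yinf) (hδ : δ ≤ 1 / 4) (k : κ) {x y : ℝ × E}
    (hx : x ∈ Ici 0 ×ˢ Metric.ball (θc k) (ρ k / 2))
    (hy : y ∈ Ici 0 ×ˢ Metric.ball (θc k) (ρ k / 2)) :
    ‖((r + x.1 + (Y k x.1 x.2).1, (Y k x.1 x.2).2) - x)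
      - ((r + y.1 + (Y k y.1 y.2).1, (Y k y.1 y.2).2) - y)‖ ≤ 1 / 4 * ‖x - y‖ := by
  have h1 := (hf.near k).lipschitz x.1 hx.1 y.1 hy.1 x.2 hx.2 y.2 hy.2
  have h2 : ((r + x.1 + (Y k x.1 x.2).1, (Y k x.1 x.2).2) - x)
      - ((r + y.1 + (Y k y.1 y.2).1, (Y k y.1 y.2).2) - y)
      = (Y k x.1 x.2 - (0, x.2)) - (Y k y.1 y.2 - (0, y.2)) := by
    ext
    · simp only [Prod.fst_sub]
      ring
    · simp only [Prod.snd_sub]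
  rw [h2]
  exact h1.trans (mul_le_mul_of_nonneg_right hδ (norm_nonneg (x - y)))

/-- The flow is injective: points with the same image lie in a common cell, where the flow is a
small perturbation of a translation. -/
theorem injective (hf : IsFlow hc r τ rad ang Y Yinf) (hδ : δ ≤ 1 / 4) {t t' : ℝ} (ht : 0 ≤ t)
    (ht' : 0 ≤ t') {σ σ' : S} (h1 : rad t σ = rad t' σ') (h2 : ang t σ = ang t' σ') :
    t = t' ∧ σ = σ' := by
  obtain ⟨k, hk⟩ := hc.exists_cell (ang t σ)
  obtain ⟨θ, hθ, rfl⟩ := hk _ (hf.mem_entourage ht σ)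
  obtain ⟨θ', hθ', rfl⟩ := hk σ' (by rw [h2]; exact hf.mem_entourage ht' σ')
  rw [hf.ang_eq k θ hθ t ht, hf.ang_eq k θ' hθ' t' ht'] at h2
  rw [hf.rad_eq k θ hθ t ht, hf.rad_eq k θ' hθ' t' ht'] at h1
  have h3 := (e k).symm.injOn (hc.closedBall_subset k (hf.mem k θ hθ t ht))
    (hc.closedBall_subset k (hf.mem k θ' hθ' t' ht')) h2
  have hx : (t, θ) ∈ Ici 0 ×ˢ Metric.ball (θc k) (ρ k / 2) := ⟨ht, hθ⟩
  have hy : (t', θ') ∈ Ici 0 ×ˢ Metric.ball (θc k) (ρ k / 2) := ⟨ht', hθ'⟩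
  have h4 := hf.lipschitz_coord hδ k hx hy
  dsimp only at h4
  rw [h1, h3, sub_sub_sub_cancel_left, norm_sub_rev] at h4
  have h5 : ‖(t, θ) - (t', θ')‖ = 0 := by linarith [norm_nonneg ((t, θ) - (t', θ'))]
  have h6 := sub_eq_zero.1 (norm_eq_zero.1 h5)
  rw [Prod.mk.injEq] at h6
  exact ⟨h6.1, by rw [h6.2]⟩

theorem continuous_flow (hf : IsFlow hc r τ rad ang Y Yinf) :
    Continuous fun q : Ici (0 : ℝ) × S => (rad q.1 q.2, ang q.1 q.2) := by
  refine continuous_iff_continuousAt.2 fun q => ?_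
  obtain ⟨⟨t, ht⟩, σ⟩ := q
  have ht : 0 ≤ t := ht
  obtain ⟨k, θ, hθ, rfl⟩ := hc.exists_coord σ
  have hmem := hc.mem_cell hθ
  have ht1 : -1 < t := by linarith
  have h1 : ContinuousAt (fun q : Ici (0 : ℝ) × S => ((q.1 : ℝ), e k q.2)) (⟨t, ht⟩, (e k).symm θ) :=
    (continuous_subtype_val.comp continuous_fst).continuousAt.prodMk
      (ContinuousAt.comp (f := Prod.snd) ((e k).continuousAt hmem.1) continuous_snd.continuousAt)
  have hz : (t, e k ((e k).symm θ)) ∈ Ioi (-1) ×ˢ Metric.ball (θc k) (ρ k / 2) := ⟨ht1, hmem.2⟩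
  have h2 : ContinuousAt (fun p : ℝ × E => Y k p.1 p.2) (t, e k ((e k).symm θ)) :=
    (hf.near k).contDiffOn.continuousOn.continuousAt
      ((isOpen_Ioi.prod Metric.isOpen_ball).mem_nhds hz)
  have h3 : ContinuousAt (fun q : Ici (0 : ℝ) × S => Y k q.1 (e k q.2)) (⟨t, ht⟩, (e k).symm θ) :=
    ContinuousAt.comp (g := fun p : ℝ × E => Y k p.1 p.2)
      (f := fun q : Ici (0 : ℝ) × S => ((q.1 : ℝ), e k q.2)) h2 h1
  have h4 : ContinuousAt (e k).symm (Y k t (e k ((e k).symm θ))).2 :=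
    (e k).continuousAt_symm (hc.closedBall_subset k (hf.mem k _ hmem.2 t ht))
  have h5 : ContinuousAt (fun q : Ici (0 : ℝ) × S => (r + q.1 + (Y k q.1 (e k q.2)).1,
      (e k).symm (Y k q.1 (e k q.2)).2)) (⟨t, ht⟩, (e k).symm θ) := by
    refine ContinuousAt.prodMk ?_ ?_
    · exact (continuousAt_const.add (continuous_subtype_val.comp continuous_fst).continuousAt).add
        (continuous_fst.continuousAt.comp h3)
    · exact ContinuousAt.comp (g := (e k).symm)
        (f := fun q : Ici (0 : ℝ) × S => (Y k q.1 (e k q.2)).2) h4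
        (continuous_snd.continuousAt.comp h3)
  refine h5.congr ?_
  have h6 : ∀ᶠ q : Ici (0 : ℝ) × S in 𝓝 (⟨t, ht⟩, (e k).symm θ), q.2 ∈ cell e θc ρ k :=
    continuous_snd.continuousAt.preimage_mem_nhds ((isOpen_cell k).mem_nhds hmem)
  filter_upwards [h6] with q hq
  have h7 := hf.rad_eq k _ hq.2 q.1 q.1.2
  have h8 := hf.ang_eq k _ hq.2 q.1 q.1.2
  rw [(e k).left_inv hq.1] at h7 h8
  rw [h7, h8]

theorem isLocalDiffeomorph_flow [CompleteSpace E] (hf : IsFlow hc r τ rad ang Y Yinf)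
    (hδ : δ ≤ 1 / 4) :
    IsLocalDiffeomorph (𝓘(ℝ, ℝ).prod 𝓘(ℝ, E)) (𝓘(ℝ, ℝ).prod 𝓘(ℝ, E)) ∞
      fun q : HalfLine 0 × S => (toHalfLine r (rad q.1 q.2), ang q.1 q.2) := by
  rintro ⟨t, σ⟩
  have ht : (0 : ℝ) < t := t.2
  obtain ⟨k, θ, hθ, rfl⟩ := hc.exists_coord σ
  have hθt := hc.ball_subset_target k hθ
  have he := hc.mem_atlas k
  have hz : ((t : ℝ), θ) ∈ Ioi 0 ×ˢ Metric.ball (θc k) (ρ k / 2) := ⟨ht, hθ⟩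
  let Φ : ℝ × E → ℝ × E := fun z => (r + z.1 + (Y k z.1 z.2).1, (Y k z.1 z.2).2)
  have hsub : Ioi (0 : ℝ) ×ˢ Metric.ball (θc k) (ρ k / 2)
      ⊆ Ioi (-1) ×ˢ Metric.ball (θc k) (ρ k / 2) :=
    prod_mono (Ioi_subset_Ioi (by norm_num)) Subset.rfl
  have hΦs : ContDiffOn ℝ ∞ Φ (Ioi 0 ×ˢ Metric.ball (θc k) (ρ k / 2)) :=
    ((contDiff_const.add contDiff_fst).contDiffOn.add (contDiff_fst.comp_contDiffOn
      ((hf.near k).contDiffOn.mono hsub))).prodMk (contDiff_snd.comp_contDiffOn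
      ((hf.near k).contDiffOn.mono hsub))
  have hΦ : IsLocalDiffeomorphAt 𝓘(ℝ, ℝ × E) 𝓘(ℝ, ℝ × E) ∞ Φ (t, θ) :=
    isLocalDiffeomorphAt_of_near_id (isOpen_Ioi.prod Metric.isOpen_ball) hΦs
      (fun x hx y hy => hf.lipschitz_coord hδ k (prod_mono Ioi_subset_Ici_self Subset.rfl hx)
        (prod_mono Ioi_subset_Ici_self Subset.rfl hy)) hz
  have h1 : IsLocalDiffeomorphAt (𝓘(ℝ, ℝ).prod 𝓘(ℝ, E)) 𝓘(ℝ, ℝ × E) ∞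
      (fun q : HalfLine 0 × S => ((q.1 : ℝ), e k q.2)) (t, (e k).symm θ) :=
    (endDiffeomorph 0 he).isLocalDiffeomorphAt _ _ _ ⟨mem_univ _, (e k).map_target hθt⟩
  have h2 : IsLocalDiffeomorphAt 𝓘(ℝ, ℝ × E) 𝓘(ℝ, ℝ × E) ∞ Φ
      ((t : ℝ), e k ((e k).symm θ)) := by
    rw [(e k).right_inv hθt]
    exact hΦ
  have h3 : IsLocalDiffeomorphAt 𝓘(ℝ, ℝ × E) (𝓘(ℝ, ℝ).prod 𝓘(ℝ, E)) ∞ (endParam r (e k))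
      (Φ ((t : ℝ), e k ((e k).symm θ))) := by
    rw [(e k).right_inv hθt]
    refine (endDiffeomorph r he).symm.isLocalDiffeomorphAt _ _ _
      ⟨?_, hc.closedBall_subset k (hf.mem k θ hθ t ht.le)⟩
    have h4 := hf.le_rad hδ ht.le ((e k).symm θ)
    rw [hf.rad_eq k θ hθ t ht.le] at h4
    change r < r + t + (Y k t θ).1
    linarith
  refine (h1.comp _ _ (h2.comp _ _ h3)).congr_of_eventuallyEq ?_
  have h6 : ∀ᶠ q : HalfLine 0 × S in 𝓝 (t, (e k).symm θ), q.2 ∈ cell e θc ρ k :=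
    continuous_snd.continuousAt.preimage_mem_nhds ((isOpen_cell k).mem_nhds (hc.mem_cell hθ))
  filter_upwards [h6] with q hq
  have hq0 : (0 : ℝ) ≤ q.1 := le_of_lt q.1.2
  have h7 := hf.rad_eq k _ hq.2 q.1 hq0
  have h8 := hf.ang_eq k _ hq.2 q.1 hq0
  rw [(e k).left_inv hq.1] at h7 h8
  rw [h7, h8]
  rfl

variable [CompleteSpace E] [CompactSpace S] [T2Space S]

/-- The flow, as a map of half-cylinders. -/
theorem exists_flow_equiv (hf : IsFlow hc r τ rad ang Y Yinf) (hδ : δ ≤ 1 / 4) :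
    (∃ Ψ : (Ici (0 : ℝ) × S) ≃ₜ (Ici r × S), ∀ (t : Ici (0 : ℝ)) (σ : S),
        ((Ψ (t, σ)).1 : ℝ) = rad t σ ∧ (Ψ (t, σ)).2 = ang t σ) ∧
      ∃ Ψ : (HalfLine 0 × S)
          ≃ₘ^∞⟮𝓘(ℝ, ℝ).prod 𝓘(ℝ, E), 𝓘(ℝ, ℝ).prod 𝓘(ℝ, E)⟯ (HalfLine r × S),
        ∀ (t : HalfLine 0) (σ : S), ((Ψ (t, σ)).1 : ℝ) = rad t σ ∧ (Ψ (t, σ)).2 = ang t σ := by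
  have hrad {t : ℝ} (ht : 0 ≤ t) (σ : S) : r ≤ rad t σ := by
    linarith [hf.le_rad hδ ht σ]
  have hrad' {t : ℝ} (ht : 0 < t) (σ : S) : r < rad t σ := by
    linarith [hf.le_rad hδ ht.le σ]
  let N₀ : Ici (0 : ℝ) × S → Ici r × S := fun q => (⟨rad q.1 q.2, hrad q.1.2 q.2⟩, ang q.1 q.2)
  let N : HalfLine 0 × S → HalfLine r × S := fun q =>
    (toHalfLine r (rad q.1 q.2), ang q.1 q.2)
  have h0 (t : HalfLine 0) : (t : ℝ) ∈ Ici (0 : ℝ) := (show (0 : ℝ) < t from t.2).le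
  have hr (x : HalfLine r) : (x : ℝ) ∈ Ici r := (show r < x from x.2).le
  have hN₀ : Continuous N₀ :=
    ((continuous_fst.comp hf.continuous_flow).subtype_mk _).prodMk
      (continuous_snd.comp hf.continuous_flow)
  have hN : IsLocalDiffeomorph (𝓘(ℝ, ℝ).prod 𝓘(ℝ, E)) (𝓘(ℝ, ℝ).prod 𝓘(ℝ, E)) ∞ N :=
    hf.isLocalDiffeomorph_flow hδ
  have hNr (q : HalfLine 0 × S) : ((N q).1 : ℝ) = rad q.1 q.2 := by
    simp only [N]
    rw [toHalfLine_of_lt (hrad' q.1.2 q.2)]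
  -- the flow is proper since `x` grows at least linearly in `t`
  have hproper : IsProperMap N₀ := by
    have : LocallyCompactSpace (Ici r) :=
      isClosed_Ici.isClosedEmbedding_subtypeVal.locallyCompactSpace
    refine isProperMap_iff_isCompact_preimage.2 ⟨hN₀, fun K hK => ?_⟩
    obtain ⟨B, hB⟩ := (hK.image (continuous_subtype_val.comp continuous_fst)).bddAbove
    have h1 : IsCompact ((Subtype.val ⁻¹' Icc (0 : ℝ) (2 * (B - r)) : Set (Ici (0 : ℝ)))
        ×ˢ (univ : Set S)) := by
      refine IsCompact.prod ?_ isCompact_univ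
      refine Topology.IsInducing.subtypeVal.isCompact_preimage' isCompact_Icc ?_
      rw [Subtype.range_coe]
      exact Icc_subset_Ici_self
    refine h1.of_isClosed_subset (hK.isClosed.preimage hN₀) fun q hq => ⟨⟨q.1.2, ?_⟩, mem_univ _⟩
    have h2 : rad q.1 q.2 ≤ B := hB ⟨N₀ q, hq, rfl⟩
    have h3 := hf.le_rad hδ q.1.2 q.2
    linarith
  have hinj₀ : Function.Injective N₀ := by
    rintro ⟨t, σ⟩ ⟨t', σ'⟩ h
    have h1 : rad t σ = rad t' σ' := congrArg (fun y : Ici r × S => (y.1 : ℝ)) h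
    obtain ⟨h2, h3⟩ := hf.injective hδ t.2 t'.2 h1 (congrArg Prod.snd h)
    exact Prod.ext (Subtype.ext h2) h3
  have hinj : Function.Injective N := by
    rintro ⟨t, σ⟩ ⟨t', σ'⟩ h
    have h1 : rad t σ = rad t' σ' := by
      rw [← hNr (t, σ), ← hNr (t', σ'), h]
    obtain ⟨h2, h3⟩ := hf.injective hδ (le_of_lt t.2) (le_of_lt t'.2) h1 (congrArg Prod.snd h)
    exact Prod.ext (Subtype.ext h2) h3
  have hclosed : IsClosed (range N) := by
    let j : HalfLine r × S → Ici r × S := fun y => (⟨y.1, hr y.1⟩, y.2)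
    have hj : Continuous j :=
      ((continuous_subtype_val.comp continuous_fst).subtype_mk _).prodMk continuous_snd
    have h1 : range N = j ⁻¹' range N₀ := by
      ext y
      constructor
      · rintro ⟨q, rfl⟩
        exact ⟨(⟨q.1, h0 q.1⟩, q.2), Prod.ext (Subtype.ext (hNr q).symm) rfl⟩
      · rintro ⟨⟨t, σ⟩, h⟩
        have h2 : rad t σ = y.1 := congrArg (fun y : Ici r × S => (y.1 : ℝ)) h
        have h3 : (0 : ℝ) < t := by
          refine lt_of_le_of_ne t.2 fun h4 => ?_
          rw [← h4, hf.rad_zero] at h2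
          exact absurd y.1.2 (by rw [← h2]; exact lt_irrefl r)
        have h5 : ang t σ = y.2 := congrArg (fun y : Ici r × S => y.2) h
        refine ⟨(⟨t, h3⟩, σ), Prod.ext (Subtype.ext ?_) h5⟩
        rw [hNr]
        exact h2
    rw [h1]
    exact hproper.isClosedMap.isClosed_range.preimage hj
  have hsurj : Function.Surjective N := by
    rw [← range_eq_univ]
    refine eq_univ_of_isClopen ⟨hclosed, hN.isOpen_range⟩ fun y => ?_
    obtain ⟨x, σ⟩ := y
    obtain ⟨k, θ, hθ, rfl⟩ := hc.exists_coord σ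
    have h1 : IsPreconnected (univ : Set (HalfLine r)) :=
      (Subtype.preconnectedSpace isPreconnected_Ioi).isPreconnected_univ
    refine ⟨_, h1.prod (hc.isPreconnected_image k),
      ⟨mem_univ _, mem_image_of_mem _ (hc.ball_subset k hθ)⟩,
      N (⟨1, (one_pos : (0 : ℝ) < 1)⟩, (e k).symm θ), ⟨mem_univ _, ?_⟩, mem_range_self _⟩
    change ang 1 ((e k).symm θ) ∈ _
    rw [hf.ang_eq k θ hθ 1 zero_le_one]
    exact mem_image_of_mem _ (hf.mem k θ hθ 1 zero_le_one)
  have hsurj₀ : Function.Surjective N₀ := by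
    rintro ⟨x, σ⟩
    rcases eq_or_lt_of_le (show r ≤ x from x.2) with h | h
    · refine ⟨(⟨0, (le_rfl : (0 : ℝ) ≤ 0)⟩, σ), Prod.ext (Subtype.ext ?_) (hf.ang_zero σ)⟩
      exact (hf.rad_zero σ).trans h
    · obtain ⟨q, hq⟩ := hsurj (⟨x, h⟩, σ)
      have h5 : ang q.1 q.2 = σ := congrArg (fun y : HalfLine r × S => y.2) hq
      refine ⟨(⟨q.1, h0 q.1⟩, q.2), Prod.ext (Subtype.ext ?_) h5⟩
      exact (hNr q).symm.trans (congrArg (fun y : HalfLine r × S => (y.1 : ℝ)) hq)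
  refine ⟨⟨(Equiv.ofBijective N₀ ⟨hinj₀, hsurj₀⟩).toHomeomorphOfContinuousClosed hN₀
    hproper.isClosedMap, fun _ _ => ⟨rfl, rfl⟩⟩,
    ⟨hN.diffeomorphOfBijective ⟨hinj, hsurj⟩, fun t σ => ⟨hNr (t, σ), rfl⟩⟩⟩

end IsFlow

end FlowMap

/-! ### Symbol estimates on the manifold -/

section Localization

variable {E W : Type*} [NormedAddCommGroup E] [NormedSpace ℝ E] [FiniteDimensional ℝ E]
  [NormedAddCommGroup W] [NormedSpace ℝ W]

/-- Being a symbol is a local property in the parameters. -/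
theorem IsSymbol.of_local {m M : ℝ} {V : Set E} {f : ℝ → E → W}
    (h : ∀ θ ∈ V, ∃ V', IsOpen V' ∧ θ ∈ V' ∧ IsSymbol m M V' f) : IsSymbol m M V f := by
  refine ⟨?_, fun K hKV hK j k => ?_⟩
  · rintro ⟨x, θ⟩ ⟨hx, hθ⟩
    obtain ⟨V', hV', hθ', hf⟩ := h θ hθ
    have hz : (x, θ) ∈ Ioi M ×ˢ V' := ⟨hx, hθ'⟩
    exact (hf.1.contDiffAt ((isOpen_Ioi.prod hV').mem_nhds hz)).contDiffWithinAt
  · refine hK.induction_on (p := fun K => ∃ C : ℝ, ∀ x ∈ Ioi M, ∀ θ ∈ K,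
      ‖iteratedDeriv j (fun s : ℝ => iteratedFDeriv ℝ k (f s) θ) x‖ ≤ C * bracket x ^ (m - j))
      ⟨0, fun _ _ _ h => h.elim⟩ ?_ ?_ ?_
    · rintro s t hst ⟨C, hC⟩
      exact ⟨C, fun x hx θ hθ => hC x hx θ (hst hθ)⟩
    · rintro s t ⟨C, hC⟩ ⟨D, hD⟩
      refine ⟨max C D, fun x hx θ hθ => ?_⟩
      have hb : 0 ≤ bracket x ^ (m - j) := Real.rpow_nonneg (bracket_pos x).le _
      rcases hθ with hθ | hθ
      · exact (hC x hx θ hθ).trans (mul_le_mul_of_nonneg_right (le_max_left _ _) hb)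
      · exact (hD x hx θ hθ).trans (mul_le_mul_of_nonneg_right (le_max_right _ _) hb)
    · intro θ hθ
      obtain ⟨V', hV', hθ', hf⟩ := h θ (hKV hθ)
      obtain ⟨L, hL, hLV, hLc⟩ := local_compact_nhds (hV'.mem_nhds hθ')
      exact ⟨L, mem_nhdsWithin_of_mem_nhds hL, hf.2 L hLV hLc j k⟩

/-- A smooth function near a compact set agrees there with a compactly supported one. -/
theorem exists_contDiff_eqOn_of_isCompact {Ψ : E → W} {O K : Set E} (hO : IsOpen O)
    (hK : IsCompact K) (hKO : K ⊆ O) (hΨ : ContDiffOn ℝ ∞ Ψ O) :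
    ∃ Θ : E → W, ContDiff ℝ ∞ Θ ∧ HasCompactSupport Θ ∧ EqOn Θ Ψ K := by
  obtain ⟨L, hL, hKL, hLO⟩ := exists_compact_between hK hO hKO
  obtain ⟨χ, h0, h1, -⟩ := exists_contMDiffMap_zero_one_of_isClosed (n := ⊤) 𝓘(ℝ, E)
    isOpen_interior.isClosed_compl hK.isClosed (disjoint_left.2 fun x hx hxK => hx (hKL hxK))
  have hz {x : E} (hx : x ∉ L) : χ x = 0 := h0 fun h => hx (interior_subset h)
  refine ⟨fun x => χ x • Ψ x, contDiff_iff_contDiffAt.2 fun x => ?_,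
    HasCompactSupport.intro hL fun x hx => by rw [hz hx, zero_smul], fun x hx => ?_⟩
  · by_cases hx : x ∈ O
    · exact χ.contMDiff.contDiff.contDiffAt.smul (hΨ.contDiffAt (hO.mem_nhds hx))
    · refine (contDiffAt_const (c := (0 : W))).congr_of_eventuallyEq ?_
      filter_upwards [hL.isClosed.isOpen_compl.mem_nhds fun h => hx (hLO h)] with y hy
      rw [hz hy, zero_smul]
  · have : χ x = 1 := h1 hx
    simp only [this, one_smul]

end Localization

section FlowSymbols

variable {E S : Type*} [NormedAddCommGroup E] [NormedSpace ℝ E]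
  [TopologicalSpace S] [ChartedSpace E S] [IsManifold 𝓘(ℝ, E) ∞ S] {κ : Type*}
  {e : κ → OpenPartialHomeomorph S E} {θc : κ → E} {ρ : κ → ℝ} {δ : ℝ} {W : Set (S × S)}
  {hc : ChartCover e θc ρ δ W} {r τ : ℝ} {rad : ℝ → S → ℝ} {ang : ℝ → S → S}
  {Y : κ → ℝ → E → ℝ × E} {Yinf : κ → E → ℝ × E}

/-- The change of coordinates from a chart `e'` to a cell. -/
theorem ChartCover.contDiffOn_chart_change (hc : ChartCover e θc ρ δ W)
    {e' : OpenPartialHomeomorph S E} (he' : e' ∈ IsManifold.maximalAtlas 𝓘(ℝ, E) ∞ S) (k : κ) :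
    ContDiffOn ℝ ∞ (fun θ => e k (e'.symm θ)) (e'.target ∩ e'.symm ⁻¹' cell e θc ρ k) := by
  rw [← contMDiffOn_iff_contDiffOn]
  exact (contMDiffOn_of_mem_maximalAtlas (hc.mem_atlas k)).comp
    ((contMDiffOn_symm_of_mem_maximalAtlas he').mono inter_subset_left) fun θ hθ => hθ.2.1

variable [FiniteDimensional ℝ E]

namespace IsFlow

/-- The radial part approaches `t + φ` as a symbol of order `-τ`. -/
theorem isSymbol_radial (hf : IsFlow hc r τ rad ang Y Yinf) {φ : S → ℝ}
    (hφ : ∀ k, ∀ θ ∈ Metric.ball (θc k) (ρ k / 2), φ ((e k).symm θ) = r + (Yinf k θ).1) :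
    IsSymbolOnManifold (E := E) (-τ) 0 (fun t σ => rad t σ - (t + φ σ)) := by
  intro e' he'
  refine IsSymbol.of_local fun θ hθ => ?_
  obtain ⟨k, θ', hθ', hσ⟩ := hc.exists_coord (e'.symm θ)
  have hV : IsOpen (e'.target ∩ e'.symm ⁻¹' cell e θc ρ k) :=
    e'.isOpen_inter_preimage_symm (isOpen_cell k)
  refine ⟨_, hV, ⟨hθ, by rw [mem_preimage, ← hσ]; exact hc.mem_cell hθ'⟩, ?_⟩
  refine ((hf.near k).radial_symbol _ (fun θ => e k (e'.symm θ)) hV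
    (hc.contDiffOn_chart_change he' k) fun θ hθ => hθ.2.2).congr hV fun t ht θ hθ => ?_
  have h1 := hf.rad_eq k _ hθ.2.2 t (le_of_lt ht)
  have h2 := hφ k _ hθ.2.2
  rw [(e k).left_inv hθ.2.1] at h1 h2
  dsimp only
  rw [h1, h2]
  ring

/-- The angular part approaches its limit `Ω`, read in a chart `e'` after composition with `Ω⁻¹`, as
a symbol of order `-τ`. -/
theorem isSymbol_angular [CompactSpace S] [T2Space S] (hf : IsFlow hc r τ rad ang Y Yinf)
    (hW : IsClosed W) {Ω : S ≃ₘ^∞⟮𝓘(ℝ, E), 𝓘(ℝ, E)⟯ S}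
    (hΩ : ∀ k, ∀ θ ∈ Metric.ball (θc k) (ρ k / 2), Ω ((e k).symm θ) = (e k).symm (Yinf k θ).2)
    (hΩW : ∀ σ, (σ, Ω σ) ∈ W)
    {e' : OpenPartialHomeomorph S E} (he' : e' ∈ IsManifold.maximalAtlas 𝓘(ℝ, E) ∞ S)
    {θ₀ : E} {η : ℝ} (hball : Metric.closedBall θ₀ η ⊆ e'.target)
    (hWe : ∀ σ ∈ e'.symm '' Metric.closedBall θ₀ η, ∀ p, (σ, p) ∈ W → Ω.symm p ∈ e'.source) :
    IsSymbol (-τ) 0 (Metric.ball θ₀ η)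
      (fun t θ => e' (Ω.symm (ang t (e'.symm θ))) - θ) := by
  refine IsSymbol.of_local fun θ hθ => ?_
  have hbt : Metric.ball θ₀ η ⊆ e'.target := Metric.ball_subset_closedBall.trans hball
  obtain ⟨k, θ', hθ', hσ⟩ := hc.exists_coord (e'.symm θ)
  have hV : IsOpen (Metric.ball θ₀ η ∩ (e'.target ∩ e'.symm ⁻¹' cell e θc ρ k)) :=
    Metric.isOpen_ball.inter (e'.isOpen_inter_preimage_symm (isOpen_cell k))
  refine ⟨_, hV, ⟨hθ, hbt hθ, by rw [mem_preimage, ← hσ]; exact hc.mem_cell hθ'⟩, ?_⟩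
  -- the inverse of the limit map, read in the chart `e'` and in the cell, and cut off
  let Ψ : E → E := fun y => e' (Ω.symm ((e k).symm y))
  let O : Set E := (e k).target ∩ (e k).symm ⁻¹' (Ω.symm ⁻¹' e'.source)
  have hO : IsOpen O := (e k).isOpen_inter_preimage_symm
    (e'.open_source.preimage Ω.symm.contMDiff.continuous)
  have hΨ : ContDiffOn ℝ ∞ Ψ O := by
    rw [← contMDiffOn_iff_contDiffOn]
    exact (contMDiffOn_of_mem_maximalAtlas he').comp (Ω.symm.contMDiff.comp_contMDiffOn
      ((contMDiffOn_symm_of_mem_maximalAtlas (hc.mem_atlas k)).mono inter_subset_left))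
      fun y hy => hy.2
  let K₀ : Set S := e'.symm '' Metric.closedBall θ₀ η
  have hK₀ : IsCompact K₀ :=
    (isCompact_closedBall θ₀ η).image_of_continuousOn (e'.continuousOn_symm.mono hball)
  -- the points that are `W`-close to the coordinate ball; they are mapped by `Ω⁻¹` to the chart
  -- `e'`, so that their coordinates in the cell form a compact subset `K` of the domain `O` of `Ψ`
  let A : Set S := Prod.snd '' (W ∩ K₀ ×ˢ univ)
  have hA : IsClosed A :=
    ((hK₀.prod isCompact_univ).inter_left hW).image continuous_snd |>.isClosed
  let K : Set E := Metric.closedBall (θc k) (ρ k) ∩ (e k).symm ⁻¹' A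
  have hK : IsCompact K := by
    refine (isCompact_closedBall (θc k) (ρ k)).of_isClosed_subset ?_ inter_subset_left
    exact ((e k).continuousOn_symm.mono (hc.closedBall_subset k)).preimage_isClosed_of_isClosed
      Metric.isClosed_closedBall hA
  have hKO : K ⊆ O := by
    rintro y ⟨hy, ⟨σ, p⟩, ⟨hσp, hσ, -⟩, hp⟩
    refine ⟨hc.closedBall_subset k hy, ?_⟩
    have hp : p = (e k).symm y := hp
    rw [mem_preimage, ← hp]
    exact hWe σ hσ p hσp
  obtain ⟨Θ, hΘ, hΘc, hΘK⟩ := exists_contDiff_eqOn_of_isCompact hO hK hKO hΨ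
  refine ((hf.near k).angular_symbol Θ hΘ hΘc _ (fun θ => e k (e'.symm θ)) hV
    ((hc.contDiffOn_chart_change he' k).mono inter_subset_right)
    fun θ hθ => hθ.2.2.2).congr hV fun t ht θ hθ => ?_
  have ht0 : 0 ≤ t := le_of_lt ht
  have hσK : e'.symm θ ∈ K₀ := mem_image_of_mem _ (Metric.ball_subset_closedBall hθ.1)
  have h1 := hf.ang_eq k _ hθ.2.2.2 t ht0
  have h2 := hΩ k _ hθ.2.2.2
  have h3 := hf.mem_entourage ht0 (e'.symm θ)
  have h4 := hΩW (e'.symm θ)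
  rw [(e k).left_inv hθ.2.2.1] at h1 h2
  rw [h1] at h3
  rw [h2] at h4
  rw [hΘK ⟨hf.mem k _ hθ.2.2.2 t ht0, _, ⟨h3, hσK, mem_univ _⟩, rfl⟩,
    hΘK ⟨hf.mem_lim hθ.2.2.2, _, ⟨h4, hσK, mem_univ _⟩, rfl⟩]
  simp only [Ψ]
  rw [← h1, ← h2, Ω.symm_apply_apply, e'.right_inv hθ.2.1]

end IsFlow

end FlowSymbols

/-! ### Comparison with the geodesic distance -/

section Distance

variable {E S : Type*} [NormedAddCommGroup E] [NormedSpace ℝ E] [FiniteDimensional ℝ E]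
  [TopologicalSpace S] [ChartedSpace E S] [IsManifold 𝓘(ℝ, E) ∞ S]

open MeasureTheory in
/-- The geodesic distance is bounded by the distance of the coordinates, by comparison with the
length of coordinate segments. -/
theorem exists_geodesicEDist_le (h : SmoothMetric 𝓘(ℝ, E) S) {e : OpenPartialHomeomorph S E}
    (he : e ∈ IsManifold.maximalAtlas 𝓘(ℝ, E) ∞ S) {K : Set E} (hK : IsCompact K)
    (hKc : Convex ℝ K) (hKe : K ⊆ e.target) :
    ∃ C : ℝ, 0 ≤ C ∧ ∀ θ ∈ K, ∀ θ' ∈ K,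
      geodesicEDist h (e.symm θ) (e.symm θ') ≤ ENNReal.ofReal (C * ‖θ' - θ‖) := by
  have hs := contMDiffOn_symm_of_mem_maximalAtlas he
  obtain ⟨B, hB⟩ := hK.exists_bound_of_continuousOn
    ((contDiffOn_pullbackMetric h e.open_target hs).continuousOn.mono hKe)
  refine ⟨Real.sqrt |B|, Real.sqrt_nonneg _, fun θ hθ θ' hθ' => ?_⟩
  let c : ℝ → E := fun s => θ + s • (θ' - θ)
  have hc : ContDiff ℝ ∞ c := contDiff_const.add (contDiff_id.smul contDiff_const)
  have hcK {s : ℝ} (hs : s ∈ Icc (0 : ℝ) 1) : c s ∈ K := hKc.add_smul_sub_mem hθ hθ' hs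
  have hd (s : ℝ) : HasDerivAt c (θ' - θ) s := by
    have h1 := ((hasDerivAt_id s).smul_const (θ' - θ)).const_add θ
    rw [one_smul] at h1
    exact h1
  have hγ {s : ℝ} (hs' : s ∈ Icc (0 : ℝ) 1) :
      ContMDiffAt 𝓘(ℝ, ℝ) 𝓘(ℝ, E) ∞ (fun s => e.symm (c s)) s :=
    (hs.contMDiffAt (e.open_target.mem_nhds (hKe (hcK hs')))).comp s hc.contMDiff.contMDiffAt
  have hder : ∀ s ∈ Icc (0 : ℝ) 1, (mfderiv 𝓘(ℝ, ℝ) 𝓘(ℝ, E) (fun s => e.symm (c s)) s (1 : ℝ) : E)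
      = mfderivModel 𝓘(ℝ, E) e.symm (c s) (θ' - θ) := by
    intro s hs'
    have h1 : HasMFDerivAt 𝓘(ℝ, E) 𝓘(ℝ, E) e.symm (c s) (mfderiv 𝓘(ℝ, E) 𝓘(ℝ, E) e.symm (c s)) :=
      ((hs.contMDiffAt (e.open_target.mem_nhds (hKe (hcK hs')))).mdifferentiableAt
        (by simp)).hasMFDerivAt
    have h2 : HasMFDerivAt 𝓘(ℝ, ℝ) 𝓘(ℝ, E) c s
        (ContinuousLinearMap.toSpanSingleton ℝ (θ' - θ) : ℝ →L[ℝ] E) :=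
      hasMFDerivAt_iff_hasFDerivAt.2 (hd s).hasFDerivAt
    have h4 := congrArg (fun L : ℝ →L[ℝ] E => L 1) (h1.comp s h2).mfderiv
    refine h4.trans ?_
    change mfderivModel 𝓘(ℝ, E) e.symm (c s) ((1 : ℝ) • (θ' - θ)) = _
    rw [one_smul]
  let _ : Bundle.RiemannianBundle (fun p : S => TangentSpace 𝓘(ℝ, E) p) := ⟨h.toRiemannianMetric⟩
  change Manifold.riemannianEDist 𝓘(ℝ, E) (e.symm θ) (e.symm θ') ≤ _
  refine (Manifold.riemannianEDist_le_pathELength (γ := fun s => e.symm (c s)) (a := 0) (b := 1)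
    (fun s hs' => ((hγ hs').of_le (by exact_mod_cast le_top)).contMDiffWithinAt)
    (by simp [c]) (by simp [c]) zero_le_one).trans ?_
  rw [Manifold.pathELength_eq_lintegral_mfderiv_Icc]
  have hpt : ∀ s ∈ Icc (0 : ℝ) 1, ‖mfderiv 𝓘(ℝ, ℝ) 𝓘(ℝ, E) (fun s => e.symm (c s)) s (1 : ℝ)‖ₑ
      ≤ ENNReal.ofReal (Real.sqrt |B| * ‖θ' - θ‖) := by
    intro s hs'
    set v : TangentSpace 𝓘(ℝ, E) (e.symm (c s)) :=
      mfderiv 𝓘(ℝ, ℝ) 𝓘(ℝ, E) (fun s => e.symm (c s)) s (1 : ℝ) with hv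
    rw [← ofReal_norm]
    refine ENNReal.ofReal_le_ofReal ?_
    have h5 : ‖v‖ ^ 2 = pullbackMetric h e.symm (c s) (θ' - θ) (θ' - θ) := by
      rw [← real_inner_self_eq_norm_sq]
      change metricForm h (e.symm (c s)) v v = metricForm h (e.symm (c s)) _ _
      exact congrArg (fun u : E => metricForm h (e.symm (c s)) u u) (hder s hs')
    refine abs_le_of_sq_le_sq' ?_ (by positivity) |>.2
    rw [h5, mul_pow, Real.sq_sqrt (abs_nonneg _)]
    have h6 := ContinuousLinearMap.le_opNorm₂ (pullbackMetric h e.symm (c s)) (θ' - θ) (θ' - θ)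
    have h7 := (hB _ (hcK hs')).trans (le_abs_self B)
    refine (le_abs_self _).trans (h6.trans ?_)
    rw [mul_assoc, ← sq]
    gcongr
  refine (setLIntegral_mono' measurableSet_Icc hpt).trans ?_
  rw [setLIntegral_const, Real.volume_Icc]
  simp

end Distance

/-! ### Finite covers by coordinate balls -/

theorem IsNearTranslation.mono {E : Type*} [NormedAddCommGroup E] [NormedSpace ℝ E]
    {τ δ δ' : ℝ} {U : Set E} {Y : ℝ → E → ℝ × E} {Yinf : E → ℝ × E}
    (h : IsNearTranslation τ δ U Y Yinf) (hδ : δ ≤ δ') : IsNearTranslation τ δ' U Y Yinf where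
  contDiffOn := h.contDiffOn
  contDiffOn_lim := h.contDiffOn_lim
  initial := h.initial
  near t ht θ hθ := (h.near t ht θ hθ).trans hδ
  lipschitz t ht t' ht' θ hθ θ' hθ' := (h.lipschitz t ht t' ht' θ hθ θ' hθ').trans
    (mul_le_mul_of_nonneg_right hδ ((abs_nonneg _).trans (le_max_left _ _)))
  tendsto := h.tendsto
  radial_symbol := h.radial_symbol
  angular_symbol := h.angular_symbol

theorem rpow_neg_le_bracket_rpow {r τ : ℝ} (hr : 1 ≤ r) (hτ : 0 ≤ τ) :
    r ^ (-τ) ≤ 2 ^ τ * bracket r ^ (-τ) := by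
  have h0 : 0 < r := by linarith
  have hb : bracket r ≤ 2 * r := by
    refine Real.sqrt_le_iff.2 ⟨by linarith, by nlinarith⟩
  have hb0 : 0 < bracket r := Real.sqrt_pos.2 (by positivity)
  have h1 : (2 * r) ^ (-τ) ≤ bracket r ^ (-τ) :=
    Real.rpow_le_rpow_of_nonpos hb0 hb (by linarith)
  rw [Real.mul_rpow (by norm_num) h0.le] at h1
  calc r ^ (-τ) = 2 ^ τ * (2 ^ (-τ) * r ^ (-τ)) := by
        rw [← mul_assoc, ← Real.rpow_add (by norm_num), add_neg_cancel, Real.rpow_zero, one_mul]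
    _ ≤ _ := by gcongr

section Existence

variable {E S : Type*} [NormedAddCommGroup E] [TopologicalSpace S] [CompactSpace S]

theorem exists_finite_cells {A : Set (OpenPartialHomeomorph S E)}
    (hA : ∀ σ : S, ∃ e ∈ A, σ ∈ e.source) :
    ∃ (s : Finset S) (e : s → OpenPartialHomeomorph S E) (θc : s → E) (ρ : s → ℝ),
      (∀ k, e k ∈ A) ∧ (∀ k, 0 < ρ k) ∧ (∀ k, ρ k ≤ 1 / 4) ∧
      (∀ k, Metric.closedBall (θc k) (2 * ρ k) ⊆ (e k).target) ∧
      ⋃ k, cell e θc ρ k = univ := by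
  have h1 : ∀ σ : S, ∃ e ∈ A, σ ∈ e.source ∧ ∃ ρ : ℝ, 0 < ρ ∧ ρ ≤ 1 / 4 ∧
      Metric.closedBall (e σ) (2 * ρ) ⊆ e.target := by
    intro σ
    obtain ⟨e, he, hσ⟩ := hA σ
    obtain ⟨η, hη, hb⟩ := Metric.nhds_basis_closedBall.mem_iff.1
      (e.open_target.mem_nhds (e.map_source hσ))
    refine ⟨e, he, hσ, min (η / 2) (1 / 4), by positivity, min_le_right _ _,
      (Metric.closedBall_subset_closedBall ?_).trans hb⟩
    linarith [min_le_left (η / 2) (1 / 4)]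
  choose e he hσ ρ hρ hρ4 hb using h1
  obtain ⟨s, hs⟩ := isCompact_univ.elim_finite_subcover
    (fun σ => cell e (fun σ => e σ σ) ρ σ) (fun σ => isOpen_cell σ)
    fun σ _ => mem_iUnion.2 ⟨σ, hσ σ, Metric.mem_ball_self (half_pos (hρ σ))⟩
  refine ⟨s, fun k => e k, fun k => e k k, fun k => ρ k, fun k => he k, fun k => hρ k,
    fun k => hρ4 k, fun k => hb k, eq_univ_of_forall fun σ => ?_⟩
  obtain ⟨k, hk, h2⟩ := mem_iUnion₂.1 (hs (mem_univ σ))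
  exact mem_iUnion.2 ⟨⟨k, hk⟩, h2⟩

/-- A closed symmetric entourage fine enough for an open cover, and for a finite family of
inclusions of closed sets in open sets. -/
theorem exists_entourage [T2Space S] {κ ι : Type*} [Finite ι] {O : κ → Set S}
    (hO : ∀ k, IsOpen (O k)) (hc : ⋃ k, O k = univ) {K N : ι → Set S}
    (hK : ∀ i, IsClosed (K i)) (hN : ∀ i, IsOpen (N i)) (hKN : ∀ i, K i ⊆ N i) :
    ∃ W ∈ 𝓝ˢ (diagonal S), IsClosed W ∧ (∀ p q, (p, q) ∈ W → (q, p) ∈ W) ∧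
      (∀ p, ∃ k, ∀ q, (q, p) ∈ W → q ∈ O k) ∧
      ∀ i, ∀ p ∈ K i, ∀ q s, (p, q) ∈ W → (q, s) ∈ W → s ∈ N i := by
  obtain ⟨W₁, hW₁, h1⟩ := eventually_exists_cell hO hc
  have h2 : ∀ᶠ p in 𝓝ˢ (diagonal S), ∀ i, p.1 ∈ K i → p.2 ∈ N i :=
    eventually_all.2 fun i => eventually_nhdsSet_diagonal (hK i) (hN i) (hKN i)
  obtain ⟨W, hW, hWc, hWs, hWW⟩ := exists_closed_comp_subset (inter_mem hW₁ h2)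
  have hrefl (p : S) : (p, p) ∈ W := subset_of_mem_nhdsSet hW rfl
  refine ⟨W, hW, hWc, hWs, fun p => ?_, fun i p hp q s hpq hqs => (hWW p q s hpq hqs).2 i hp⟩
  obtain ⟨k, hk⟩ := h1 p
  exact ⟨k, fun q hq => hk q (hWW q p p hq (hrefl p)).1⟩

end Existence

/-! ### The normal flow in a finite cover -/

section Distance

variable {E S : Type*} [NormedAddCommGroup E] [NormedSpace ℝ E]
  [TopologicalSpace S] [ChartedSpace E S] [IsManifold 𝓘(ℝ, E) ∞ S]

/-- A flow moves the points of `S` by a distance controlled by its displacement in the cells. -/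
theorem IsFlow.geodesicEDist_le {κ : Type*} {e : κ → OpenPartialHomeomorph S E} {θc : κ → E}
    {ρ : κ → ℝ} {δ : ℝ} {W : Set (S × S)} {hc : ChartCover e θc ρ δ W} {r τ : ℝ}
    {rad : ℝ → S → ℝ} {ang : ℝ → S → S} {Y : κ → ℝ → E → ℝ × E} {Yinf : κ → E → ℝ × E}
    (hf : IsFlow hc r τ rad ang Y Yinf) (h : SmoothMetric 𝓘(ℝ, E) S) {D : ℝ} (hD0 : 0 ≤ D)
    (hD : ∀ k, ∀ θ ∈ Metric.closedBall (θc k) (ρ k), ∀ θ' ∈ Metric.closedBall (θc k) (ρ k),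
      geodesicEDist h ((e k).symm θ) ((e k).symm θ') ≤ ENNReal.ofReal (D * ‖θ' - θ‖))
    {t : ℝ} (ht : 0 ≤ t) (σ : S) :
    geodesicEDist h σ (ang t σ) ≤ ENNReal.ofReal (D * δ) := by
  obtain ⟨k, θ, hθ, rfl⟩ := hc.exists_coord σ
  rw [hf.ang_eq k θ hθ t ht]
  refine (hD k θ (hc.ball_subset k hθ) _ (hf.mem k θ hθ t ht)).trans
    (ENNReal.ofReal_le_ofReal ?_)
  have h1 := (norm_snd_le (Y k t θ - (0, θ))).trans ((hf.near k).near t ht θ hθ)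
  rw [Prod.snd_sub] at h1
  gcongr

variable [FiniteDimensional ℝ E]

theorem exists_geodesicEDist_le_of_finite {κ : Type*} [Finite κ] (h : SmoothMetric 𝓘(ℝ, E) S)
    {e : κ → OpenPartialHomeomorph S E} {θc : κ → E} {ρ : κ → ℝ}
    (he : ∀ k, e k ∈ IsManifold.maximalAtlas 𝓘(ℝ, E) ∞ S)
    (hball : ∀ k, Metric.closedBall (θc k) (ρ k) ⊆ (e k).target) :
    ∃ D : ℝ, 0 ≤ D ∧ ∀ k, ∀ θ ∈ Metric.closedBall (θc k) (ρ k),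
      ∀ θ' ∈ Metric.closedBall (θc k) (ρ k),
        geodesicEDist h ((e k).symm θ) ((e k).symm θ') ≤ ENNReal.ofReal (D * ‖θ' - θ‖) := by
  choose D hD0 hD using fun k => exists_geodesicEDist_le h (he k)
    (isCompact_closedBall (θc k) (ρ k)) (convex_closedBall _ _) (hball k)
  obtain ⟨D', hD'⟩ := (finite_range D).bddAbove
  refine ⟨max D' 0, le_max_right _ _, fun k θ hθ θ' hθ' => (hD k θ hθ θ' hθ').trans
    (ENNReal.ofReal_le_ofReal ?_)⟩
  gcongr
  exact (hD' (mem_range_self k)).trans (le_max_left _ _)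

variable [T2Space S] [CompactSpace S] {R : ℝ}

/-- For large `r`, the normal flow issued from `{r} × S` is described in the cells of a finite
cover by displacements of size `O(r ^ (-τ))`. -/
theorem exists_isFlow_normalFlow {κ : Type*} [Finite κ] {G : EndMetric R E S} {w : ℝ → ℝ}
    {τ : ℝ} (hτ : 0 < τ) {e : κ → OpenPartialHomeomorph S E} {θc : κ → E} {ρ : κ → ℝ}
    (he : ∀ k, e k ∈ IsManifold.maximalAtlas 𝓘(ℝ, E) ∞ S)
    {g : κ → E → E →L[ℝ] E →L[ℝ] ℝ}
    (h : ∀ k, IsAsymptotic R τ (e k).target (pullbackMetric G (endParam R (e k))) w (g k))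
    (hρ : ∀ k, 0 < ρ k) (hρ4 : ∀ k, ρ k ≤ 1 / 4)
    (hball : ∀ k, Metric.closedBall (θc k) (2 * ρ k) ⊆ (e k).target)
    {W : Set (S × S)} (hW : W ∈ 𝓝ˢ (diagonal S))
    (hcell : ∀ p, ∃ k, ∀ q, (q, p) ∈ W → q ∈ cell e θc ρ k) :
    ∃ C r₀ : ℝ, 0 ≤ C ∧ 1 ≤ r₀ ∧ ∀ r : HalfLine R, r₀ ≤ (r : ℝ) →
      C * (r : ℝ) ^ (-τ) ≤ 1 / 4 ∧
      ∃ (hc : ChartCover e θc ρ (C * (r : ℝ) ^ (-τ)) W) (Y : κ → ℝ → E → ℝ × E)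
        (Yinf : κ → E → ℝ × E),
        IsFlow hc r τ (radialPart G r) (angularPart G r) Y Yinf ∧
        ∀ t, 0 ≤ t → ∀ σ, InExpDomain G (scaledNormal G r t σ) := by
  have hb1 (k : κ) : Metric.closedBall (θc k) (ρ k) ⊆ (e k).target :=
    (Metric.closedBall_subset_closedBall (by linarith [hρ k])).trans (hball k)
  choose C r₁ hC hr₁ H using fun k =>
    (h k).exists_normalFlow_eq (he k) hτ (hρ k) (hρ4 k) (hball k)
  choose η hη Hη using fun k => exists_norm_sub_le_imp_mem
    (isCompact_closedBall (θc k) (ρ k)) ((e k).continuousOn_symm.mono (hb1 k)) hW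
  obtain ⟨C', hC'⟩ := (finite_range C).bddAbove
  have hC' (k : κ) : C k ≤ max C' 0 := (hC' (mem_range_self k)).trans (le_max_left _ _)
  have hlim : Tendsto (fun r : ℝ => max C' 0 * r ^ (-τ)) atTop (𝓝 0) := by
    simpa using (tendsto_rpow_neg_atTop hτ).const_mul (max C' 0)
  have hev : ∀ᶠ r : ℝ in atTop, (∀ k, r₁ k < r) ∧ (∀ k, max C' 0 * r ^ (-τ) ≤ η k) ∧
      max C' 0 * r ^ (-τ) ≤ 1 / 4 :=
    (eventually_all.2 fun k => eventually_gt_atTop _).and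
      ((eventually_all.2 fun k => hlim.eventually_le_const (hη k)).and
        (hlim.eventually_le_const (by norm_num)))
  obtain ⟨r₀, hr₀⟩ := eventually_atTop.1 hev
  refine ⟨max C' 0, max r₀ 1, le_max_right _ _, le_max_right _ _, fun r hr => ?_⟩
  obtain ⟨hr1, hrη, hr4⟩ := hr₀ r ((le_max_left _ _).trans hr)
  have hr0 : (0 : ℝ) < r := zero_lt_one.trans_le ((le_max_right _ _).trans hr)
  have hc : ChartCover e θc ρ (max C' 0 * (r : ℝ) ^ (-τ)) W :=
    { mem_atlas := he
      rho_pos := hρ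
      closedBall_subset := hb1
      refl := fun p => subset_of_mem_nhdsSet hW rfl
      exists_cell := fun p => by
        obtain ⟨k, hk⟩ := hcell p
        exact ⟨k, fun q hq => ⟨e k q, (hk q hq).2, (e k).left_inv (hk q hq).1⟩⟩
      close := fun k θ hθ θ' hθ' hd => Hη k θ hθ θ' hθ' (hd.trans (hrη k)) }
  choose Y Yinf hY hflow using fun k => H k r (hr1 k)
  refine ⟨hr4, hc, Y, Yinf, ⟨fun k => (hY k).mono ?_, fun k θ hθ t ht => (hflow k θ hθ t ht).1,
    fun k θ hθ t ht => (hflow k θ hθ t ht).2.2.1, fun k θ hθ t ht => (hflow k θ hθ t ht).2.2.2⟩,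
    fun t ht σ => ?_⟩
  · gcongr
    exact hC' k
  · obtain ⟨k, θ, hθ, rfl⟩ := hc.exists_coord σ
    exact (hflow k θ hθ t ht).2.1

end Distance

end NormalFlow

end

open NormalFlow in
theorem mainTheorem2
    {E : Type*} [NormedAddCommGroup E] [NormedSpace ℝ E] [FiniteDimensional ℝ E]
    (hdim : 1 ≤ Module.finrank ℝ E)
    {S : Type*} [TopologicalSpace S] [T2Space S] [CompactSpace S] [ChartedSpace E S]
    [IsManifold 𝓘(ℝ, E) ∞ S]
    (R : ℝ) (G : EndMetric R E S) (gbar : SmoothMetric 𝓘(ℝ, E) S)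
    (w : ℝ → ℝ) (hw_smooth : ContDiffOn ℝ ∞ w (Set.Ioi R)) (hw_pos : ∀ x, R < x → 0 < w x)
    (lam ε μ ν τ : ℝ) (hε : 0 < ε) (hτ : 0 < τ)
    (hμ : 1 + τ ≤ μ) (hν : (1 + τ) / 2 ≤ ν) (hlam : (1 + τ) / 2 ≤ lam)
    (hw : IsSymbolLine (-lam) R w)
    (hw' : IsSymbolLine (-1 - ε) R (deriv (fun x => deriv w x / w x)))
    -- the decay of the coefficients of the metric, in the charts of some atlas of `S`
    (A : Set (OpenPartialHomeomorph S E))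
    (hA : A ⊆ IsManifold.maximalAtlas 𝓘(ℝ, E) ∞ S) (hA_cover : ∀ σ : S, ∃ e ∈ A, σ ∈ e.source)
    (ha : ∀ e ∈ A, IsSymbol (-μ) R e.target (fun x θ => coefA G e x θ - 1))
    (hb : ∀ e ∈ A, ∀ u : E, IsSymbol (-ν) R e.target (fun x θ => coefB G w e u x θ))
    (hg : ∀ e ∈ A, ∀ u v : E,
      IsSymbol (-τ) R e.target (fun x θ => coefG G w e u v x θ - coefBar gbar e u v θ))
    -- an auxiliary Riemannian metric on `S`, defining the distance `d`
    (h : SmoothMetric 𝓘(ℝ, E) S)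
    -- a finite cover of `S` by coordinate balls
    {ι : Type*} [Finite ι] (chart : ι → OpenPartialHomeomorph S E)
    (hchart : ∀ i, chart i ∈ IsManifold.maximalAtlas 𝓘(ℝ, E) ∞ S)
    (θ₀ : ι → E) (δ : ι → ℝ) (hδ : ∀ i, 0 < δ i)
    (hball : ∀ i, Metric.closedBall (θ₀ i) (4 * δ i) ⊆ (chart i).target)
    (hcover : ⋃ i, (chart i).symm '' Metric.ball (θ₀ i) (δ i) = Set.univ) :
    ∃ C r₀ : ℝ, ∀ r : HalfLine R, r₀ ≤ (r : ℝ) →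
      -- the normal flow is defined for all nonnegative times
      (∀ t : ℝ, 0 ≤ t → ∀ σ : S, InExpDomain G (scaledNormal G r t σ)) ∧
      -- the angular part is a diffeomorphism close to the identity
      (∀ t : ℝ, 0 ≤ t →
        (∃ Φ : S ≃ₘ^∞⟮𝓘(ℝ, E), 𝓘(ℝ, E)⟯ S, ∀ σ, Φ σ = angularPart G r t σ) ∧
        ∀ σ : S, geodesicEDist h σ (angularPart G r t σ)
          ≤ ENNReal.ofReal (C * bracket (r : ℝ) ^ (-τ))) ∧
      -- the limit of the angular part, and the convergence to it
      (∃ Ω : S ≃ₘ^∞⟮𝓘(ℝ, E), 𝓘(ℝ, E)⟯ S,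
        (∀ σ : S, Filter.Tendsto (fun t => angularPart G r t σ) Filter.atTop (𝓝 (Ω σ))) ∧
        ∀ i,
          (∀ t : ℝ, 0 ≤ t → ∀ θ ∈ Metric.ball (θ₀ i) (δ i),
            Ω.symm (angularPart G r t ((chart i).symm θ)) ∈ (chart i).source) ∧
          IsSymbol (-τ) 0 (Metric.ball (θ₀ i) (δ i))
            (fun t θ => chart i (Ω.symm (angularPart G r t ((chart i).symm θ))) - θ)) ∧
      -- the asymptotics of the radial part
      (∃ φ : S → ℝ, ContMDiff 𝓘(ℝ, E) 𝓘(ℝ, ℝ) ∞ φ ∧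
        IsSymbolOnManifold (E := E) (-τ) 0 (fun t σ => radialPart G r t σ - (t + φ σ))) ∧
      -- the normal flow is a homeomorphism, and a diffeomorphism on the interiors
      (∃ Ψ : (Set.Ici (0 : ℝ) × S) ≃ₜ (Set.Ici (r : ℝ) × S), ∀ (t : Set.Ici (0 : ℝ)) (σ : S),
        ((Ψ (t, σ)).1 : ℝ) = radialPart G r t σ ∧ (Ψ (t, σ)).2 = angularPart G r t σ) ∧
      (∃ Ψ : (HalfLine 0 × S)
          ≃ₘ^∞⟮𝓘(ℝ, ℝ).prod 𝓘(ℝ, E), 𝓘(ℝ, ℝ).prod 𝓘(ℝ, E)⟯ (HalfLine (r : ℝ) × S),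
        ∀ (t : HalfLine 0) (σ : S),
          ((Ψ (t, σ)).1 : ℝ) = radialPart G r t σ ∧ (Ψ (t, σ)).2 = angularPart G r t σ) := by
  have : CompleteSpace E := FiniteDimensional.complete ℝ E
  obtain ⟨s, e, θc, ρ, heA, hρ, hρ4, hcb, hcell⟩ := exists_finite_cells hA_cover
  have he (k : s) : e k ∈ IsManifold.maximalAtlas 𝓘(ℝ, E) ∞ S := hA (heA k)
  have hbi (i : ι) : Metric.closedBall (θ₀ i) (δ i) ⊆ (chart i).target :=
    (Metric.closedBall_subset_closedBall (by linarith [hδ i])).trans (hball i)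
  obtain ⟨W, hW, hWc, hWs, hWcell, hWchart⟩ := exists_entourage
    (fun k => isOpen_cell (e := e) (θc := θc) (ρ := ρ) k) hcell
    (K := fun i => (chart i).symm '' Metric.closedBall (θ₀ i) (δ i))
    (N := fun i => (chart i).source)
    (fun i => ((isCompact_closedBall _ _).image_of_continuousOn
      ((chart i).continuousOn_symm.mono (hbi i))).isClosed)
    (fun i => (chart i).open_source)
    (fun i => image_subset_iff.2 fun θ hθ => (chart i).map_target (hbi i hθ))
  obtain ⟨C, r₀, hC, hr₀, H⟩ := exists_isFlow_normalFlow hτ he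
    (fun k => isAsymptotic_pullbackMetric hw_pos hμ hν hlam hw (he k) (ha _ (heA k))
      (hb _ (heA k)) (hg _ (heA k))) hρ hρ4 hcb hW hWcell
  obtain ⟨D, hD0, hD⟩ := exists_geodesicEDist_le_of_finite h he
    (fun k => (Metric.closedBall_subset_closedBall (by linarith [hρ k])).trans (hcb k))
  refine ⟨D * (C * 2 ^ τ), r₀, fun r hr => ?_⟩
  obtain ⟨hδ4, hc, Y, Yinf, hf, hexp⟩ := H r hr
  obtain ⟨Ω, hΩlim, hΩ, hΩW⟩ := hf.exists_limit hδ4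
  obtain ⟨φ, hφ, hφk⟩ := hf.exists_radial_limit
  obtain ⟨hΨ, hΨ'⟩ := hf.exists_flow_equiv hδ4
  -- points that are `W`-close to one of the coordinate balls are mapped by `Ω⁻¹` to its chart
  have hΩchart : ∀ i, ∀ σ ∈ (chart i).symm '' Metric.closedBall (θ₀ i) (δ i), ∀ p, (σ, p) ∈ W →
      Ω.symm p ∈ (chart i).source := by
    intro i σ hσ p hp
    have h1 := hΩW (Ω.symm p)
    rw [Ω.apply_symm_apply] at h1
    exact hWchart i σ hσ p _ hp (hWs _ _ h1)
  refine ⟨hexp, fun t ht => ⟨hf.exists_diffeomorph_ang hδ4 ht, fun σ => ?_⟩,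
    ⟨Ω, hΩlim, fun i => ⟨fun t ht θ hθ => ?_, ?_⟩⟩,
    ⟨φ, hφ, hf.isSymbol_radial hφk⟩, hΨ, hΨ'⟩
  · refine (hf.geodesicEDist_le h hD0 hD ht σ).trans (ENNReal.ofReal_le_ofReal ?_)
    have h1 := rpow_neg_le_bracket_rpow (hr₀.trans hr) hτ.le
    calc D * (C * (r : ℝ) ^ (-τ)) ≤ D * (C * (2 ^ τ * bracket (r : ℝ) ^ (-τ))) := by gcongr
      _ = _ := by ring
  · exact hΩchart i _ (mem_image_of_mem _ (Metric.ball_subset_closedBall hθ)) _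
      (hf.mem_entourage ht _)
  · exact hf.isSymbol_angular hWc hΩ hΩW (hchart i) (hbi i) (hΩchart i)
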